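/- Let $\Bbbk$ be a field of characteristic zero. *Trees.* An $A_\infty$-labeled tree with $n$ white vertices is a planar tree without tails (a cyclic order on the flags at each vertex is given) whose vertices are black or white, the white ones being labeled bijectively by $1,\dots,n$, and whose black vertices all have valence $\ge 3$. Black edges are allowed: a connected component of black vertices and black edges represents one black vertex of the underlying black-and-white tree together with the planar tree with tails (a cell of $\mathcal A_\infty$) labeling it. An angle is the arc between two cyclically adjacent flags at a vertex; the tree with one vertex has one angle. A rooted $A_\infty$-labeled tree is a planar tree of the same kind with a chosen angle (root), where the root counts toward the valence of the root vertex. An orientation of a tree is a total order of its edges up to even permutations. A root $r$ induces the planar order of the edges: the order of first contact when walking around the tree starting at $r$. *The minimal operad.* $\mathsf M(n)$ has as basis the rooted $A_\infty$-labeled trees with $n$ white vertices, each oriented by its planar order; a rooted tree with another orientation denotes $\pm$ the basis element. The degree of a rooted tree is the sum of the degrees of its vertices: the number of incoming edges for a white vertex, and that number minus $2$ for a black vertex. The group $S_n$ acts by relabeling, and the unit is the tree with a single white vertex. $T\circ_i T'$ is the sum over all rooted trees obtained by replacing the vertex $i$ of $T$ by $T'$ and grafting the branches of $T$ at $i$ into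 the angles of $T'$ in all ways compatible with the planar order (white labels being renumbered as usual); the result is oriented by the edges of $T$ followed by those of $T'$. The differential $\partial$, of degree $-1$, sends $T$ to the sum over all rooted $A_\infty$-labeled trees obtained by splitting off from a vertex $v$ a new black vertex, joined to $v$ by a new edge and carrying consecutive flags of $v$ (each resulting tree together with its new edge being counted once); the result is oriented by the new edge followed by the edges of $T$. With these structures $\mathsf M$ is a dg operad. *The spaces $\mathsf M_\circlearrowright(n)$.* $\mathsf M_\circlearrowright(n)$ is the vector space spanned by the oriented (unrooted) $A_\infty$-labeled trees $T_\prec$ with $n$ white vertices, modulo $T_\prec=-T_{\bar\prec}$, where $\bar\prec$ is the opposite orientation. **Proposition.** There are well-defined linear maps $\phi\colon \mathsf M_\circlearrowright(n)\to\mathsf M(n)$, $n\ge 0$, with $$\phi(T_\prec)=\sum_{r}\pm(T,r),$$ where $r$ runs over all (black and white) angles of $T$ and the sign is that of the permutation taking the order $\prec$ to the planar order starting at $r$. These maps are injective. Their images form a dg suboperad of $\mathsf M$: they are graded subspaces, contain the unit, and are closed under the differential, the symmetric group actions and all compositions $\circ_i$. Consequently there is exactly one dg operad structure (grading, differential, symmetric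 group actions, unit and compositions) on $\mathsf M_\circlearrowright$ for which $\phi\colon\mathsf M_\circlearrowright\to\mathsf M$ is a morphism of dg operads. -/

import Mathlib

noncomputable section

namespace AInfTrees

/-! ## Planar trees -/

/-- A finite ordered list of branches of a planar rooted tree. In `cons e v above rest` the first
branch starts with the edge `e`, at whose other end sits the vertex `v`, which carries the list
`above` of further branches; `rest` is the list of the remaining branches. A vertex is
`some i` (white, with label `i`; labels start at `0`) or `none` (black). Edges carry names
in `ε`. -/
inductive Branches (ε : Type) : Type
  | nil : Branches ε
  | cons (e : ε) (v : Option ℕ) (above rest : Branches ε) : Branches ε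

namespace Branches

variable {ε δ : Type}

/-- Concatenation of two lists of branches. -/
def append : Branches ε → Branches ε → Branches ε
  | nil, G => G
  | cons e v A R, G => cons e v A (append R G)

/-- The number of branches in the list. -/
def length : Branches ε → ℕ
  | nil => 0
  | cons _ _ _ R => R.length + 1

/-- The number of edges (equivalently, of vertices) in the whole list of branches. -/
def size : Branches ε → ℕ
  | nil => 0
  | cons _ _ A R => A.size + R.size + 1

/-- The names of the edges in the planar order (order of first contact). -/
def edges : Branches ε → List ε
  | nil => []
  | cons e _ A R => e :: (A.edges ++ R.edges)

/-- The labels of the white vertices in the planar order. -/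
def whites : Branches ε → List ℕ
  | nil => []
  | cons _ v A R => v.toList ++ (A.whites ++ R.whites)

/-- Rename the edges. -/
def mapEdges (f : ε → δ) : Branches ε → Branches δ
  | nil => nil
  | cons e v A R => cons (f e) v (A.mapEdges f) (R.mapEdges f)

/-- Relabel the white vertices. -/
def relabel (f : ℕ → ℕ) : Branches ε → Branches ε
  | nil => nil
  | cons e v A R => cons e (v.map f) (A.relabel f) (R.relabel f)

/-- Name the edges by `s, s + 1, …` in the planar order. -/
def number (s : ℕ) : Branches ε → Branches ℕ
  | nil => nil
  | cons _ v A R => cons s v (A.number (s + 1)) (R.number (s + 1 + A.size))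

/-- Every black vertex has valence at least `3`, that is, at least two branches above it. -/
def Stable : Branches ε → Prop
  | nil => True
  | cons _ v A R => (v = none → 2 ≤ A.length) ∧ A.Stable ∧ R.Stable

/-- All ways of cutting a list of branches into an initial and a final segment. -/
def cuts : Branches ε → List (Branches ε × Branches ε)
  | nil => [(nil, nil)]
  | cons e v A R => (nil, cons e v A R) :: R.cuts.map fun p => (cons e v A p.1, p.2)

/-- All ways of cutting a list of branches into three consecutive segments. -/
def cuts₃ (F : Branches ε) : List (Branches ε × Branches ε × Branches ε) :=
  F.cuts.flatMap fun p => p.2.cuts.map fun q => (p.1, q.1, q.2)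

/-- All ways of grafting the branches `B`, in their given order, into the angles of the branches
`F` (including the angles of the vertex which carries `F`), keeping the planar order. -/
def spread (B : Branches ε) : Branches ε → List (Branches ε)
  | nil => [B]
  | cons e v A R => B.cuts₃.flatMap fun p =>
      (spread p.2.1 A).flatMap fun A' =>
        (spread p.2.2 R).map fun R' => p.1.append (cons e v A' R')

end Branches

/-- The degree of a vertex of a rooted tree with a list `A` of incoming branches: for a white vertex
it is the number of its arcs (angles) minus one; a black vertex with `m` incoming branches is
a vertex of an `A_∞` label and contributes the dimension `m - 2` of the associahedron of `μ_m`. -/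
def vertexDegree {ε : Type} (v : Option ℕ) (A : Branches ε) : ℤ :=
  if v = none then (A.length : ℤ) - 2 else A.length

/-- The sum of the degrees of all vertices. -/
def Branches.degree {ε : Type} : Branches ε → ℤ
  | .nil => 0
  | .cons _ v A R => vertexDegree v A + A.degree + R.degree

/-- A planar tree with a root, i.e. with a chosen angle. The branches of the root vertex
are listed in the planar order, starting at the root. -/
structure PTree (ε : Type) : Type where
  root : Option ℕ
  branches : Branches ε

namespace PTree

variable {ε δ : Type}

/-- The number of edges. -/
def size (T : PTree ε) : ℕ := T.branches.size

/-- The names of the edges in the planar order starting at the root. -/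
def edges (T : PTree ε) : List ε := T.branches.edges

/-- The labels of the white vertices. -/
def whites (T : PTree ε) : List ℕ := T.root.toList ++ T.branches.whites

def mapEdges (f : ε → δ) (T : PTree ε) : PTree δ := ⟨T.root, T.branches.mapEdges f⟩

/-- Forget the names of the edges. -/
def forget (T : PTree ε) : PTree Unit := T.mapEdges fun _ => ()

def relabel (f : ℕ → ℕ) (T : PTree ε) : PTree ε := ⟨T.root.map f, T.branches.relabel f⟩

/-- Name the edges by `s, s + 1, …` in the planar order starting at the root. -/
def number (s : ℕ) (T : PTree ε) : PTree ℕ := ⟨T.root, T.branches.number s⟩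

def degree (T : PTree ε) : ℤ := vertexDegree T.root T.branches + T.branches.degree

/-- `T` is a rooted `A_∞`-labeled tree with `n` white vertices: the white vertices are labeled
bijectively by `0, …, n - 1` and every black vertex has valence at least `3`, where the root counts
toward the valence. Black edges are allowed: a connected component of black vertices and
black edges is one black vertex of the underlying b/w tree, together with the planar tree with tails
that is its `A_∞` label. -/
def IsRooted (n : ℕ) (T : PTree ε) : Prop :=
  T.whites.Perm (List.range n) ∧ (T.root = none → 2 ≤ T.branches.length) ∧ T.branches.Stable

/-- `T` is an (unrooted) `A_∞`-labeled tree with `n` white vertices and a chosen angle: as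
`IsRooted`, but the root does not count toward the valence. -/
def IsUnrooted (n : ℕ) (T : PTree ε) : Prop :=
  T.whites.Perm (List.range n) ∧ (T.root = none → 3 ≤ T.branches.length) ∧ T.branches.Stable

/-- Move the root to the next angle met on walking around the tree: pass along the first
edge `e` after the root, to the angle following `e` at its other end. -/
def rot : PTree ε → PTree ε
  | ⟨v, .nil⟩ => ⟨v, .nil⟩
  | ⟨v, .cons e w A R⟩ => ⟨w, A.append (.cons e v R .nil)⟩

/-- The number of angles. Every vertex has as many angles as flags, so that there are twice as many
angles as edges; the tree with a single vertex has one angle. The walk around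
the tree given by `rot` visits every angle once. -/
def numAngles (T : PTree ε) : ℕ := max 1 (2 * T.size)

end PTree

/-! ## Composition and blow-up of trees with named edges -/

/-- Insert `T'` into the vertex labeled `i` of a tree or list of branches: this vertex is replaced by `T'`, and its branches are
grafted into the angles of `T'` in all ways which keep the planar order. -/
def Branches.insert {ε : Type} (i : ℕ) (T' : PTree ε) : Branches ε → List (Branches ε)
  | .nil => [.nil]
  | .cons e v A R =>
      if v = some i then (A.spread T'.branches).map fun A' => .cons e T'.root A' R
      else (A.insert i T').flatMap fun A' => (R.insert i T').map fun R' => .cons e v A' R'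

def PTree.insert {ε : Type} (T : PTree ε) (i : ℕ) (T' : PTree ε) : List (PTree ε) :=
  if T.root = some i then (T.branches.spread T'.branches).map fun F => ⟨T'.root, F⟩
  else (T.branches.insert i T').map fun F => ⟨T.root, F⟩

/-- All ways of splitting a new black vertex off the vertex `v` with incoming branches `A`; the new
edge has the name `0`. The flags of the new black vertex, besides the new edge, are
consecutive flags of `v`. They are either the branches in a middle segment `Y` of `A`; or,
if `v` is white, they are the outgoing flag of `v` and the branches in `X` and `Z`. (If `v` is
black, the second kind would repeat the first.) The result is the vertex now adjacent to the
outgoing flag, with its incoming branches. -/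
def vertexSplits (v : Option ℕ) (A : Branches ℕ) : List (Option ℕ × Branches ℕ) :=
  (A.cuts₃.map fun p => (v, p.1.append (.cons 0 none p.2.1 p.2.2))) ++
    if v = none then []
    else A.cuts₃.map fun p => (none, p.1.append (.cons 0 v p.2.1 p.2.2))

def Branches.blowups : Branches ℕ → List (Branches ℕ)
  | .nil => []
  | .cons e v A R =>
      (vertexSplits v A).map (fun p => .cons e p.1 p.2 R) ++
      (A.blowups.map (fun A' => .cons e v A' R) ++ R.blowups.map fun R' => .cons e v A R')

/-- All trees which arise by splitting a new black vertex off a vertex of the tree `T` (some of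
these trees may have unstable black vertices). -/
def PTree.blowups (T : PTree ℕ) : List (PTree ℕ) :=
  (vertexSplits T.root T.branches).map (fun p => ⟨p.1, p.2⟩) ++
    T.branches.blowups.map fun F => ⟨T.root, F⟩

/-- The number of inversions of a list. -/
def inversions : List ℕ → ℕ
  | [] => 0
  | a :: l => (l.filter fun b => b < a).length + inversions l

/-- The sign of the permutation which sorts a list without repetitions. -/
def listSign (l : List ℕ) : ℤ := (-1) ^ inversions l

/-! ## Differential graded operads -/

section Operads

variable (k : Type*) [Field k]

/-- The data of a (symmetric) dg operad on the spaces `P n`: gradings, differential, actions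
of the symmetric groups, unit, and partial compositions `a ∘_i b`, where the inputs of `a` are
numbered by `Fin n`. -/
structure OperadData (P : ℕ → Type*) [∀ n, AddCommGroup (P n)] [∀ n, Module k (P n)] where
  /-- the part of degree `e` of `P n` -/
  gr : ∀ n, ℤ → Submodule k (P n)
  d : ∀ n, P n →ₗ[k] P n
  act : ∀ n, Equiv.Perm (Fin n) → P n →ₗ[k] P n
  one : P 1
  comp : ∀ {n m l : ℕ} (_ : n + m = l + 1) (_ : Fin n), P n →ₗ[k] P m →ₗ[k] P l

/-- The number in `a ∘_i b` of the input `j ≠ i` of `a`, if `b` has `m` inputs. The input `j` of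
`b` gets the number `i + j`. -/
def outerIndex (i m j : ℕ) : ℕ := if j ≤ i then j else j + m - 1

variable {k}
variable {P : ℕ → Type*} [∀ n, AddCommGroup (P n)] [∀ n, Module k (P n)]
variable {Q : ℕ → Type*} [∀ n, AddCommGroup (Q n)] [∀ n, Module k (Q n)]

/-- The axioms of a dg operad (homological grading, Koszul signs, left actions of the symmetric
groups). -/
structure IsDGOperad (D : OperadData k P) : Prop where
  internal : ∀ n, DirectSum.IsInternal (D.gr n)
  d_mem : ∀ n e, ∀ a ∈ D.gr n e, D.d n a ∈ D.gr n (e - 1)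
  d_d : ∀ n a, D.d n (D.d n a) = 0
  act_one : ∀ n a, D.act n 1 a = a
  act_mul : ∀ n σ τ a, D.act n (σ * τ) a = D.act n σ (D.act n τ a)
  act_mem : ∀ n σ e, ∀ a ∈ D.gr n e, D.act n σ a ∈ D.gr n e
  act_d : ∀ n σ a, D.d n (D.act n σ a) = D.act n σ (D.d n a)
  one_mem : D.one ∈ D.gr 1 0
  d_one : D.d 1 D.one = 0
  comp_mem : ∀ {n m l : ℕ} (h : n + m = l + 1) (i : Fin n) (e f : ℤ),
    ∀ a ∈ D.gr n e, ∀ b ∈ D.gr m f, D.comp h i a b ∈ D.gr l (e + f)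
  comp_one : ∀ {n : ℕ} (i : Fin n) (a : P n), D.comp rfl i a D.one = a
  one_comp : ∀ {n : ℕ} (b : P n), D.comp (Nat.add_comm 1 n) 0 D.one b = b
  /-- the differential is a derivation of the compositions -/
  d_comp : ∀ {n m l : ℕ} (h : n + m = l + 1) (i : Fin n) (e : ℤ), ∀ a ∈ D.gr n e, ∀ b : P m,
    D.d l (D.comp h i a b) =
      D.comp h i (D.d n a) b + (e.negOnePow : ℤ) • D.comp h i a (D.d m b)
  /-- sequential associativity: `(a ∘_i b) ∘_{i+j} c = a ∘_i (b ∘_j c)` -/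
  assoc_seq : ∀ {n m p l r q : ℕ} (h₁ : n + m = l + 1) (h₂ : l + p = q + 1) (h₃ : m + p = r + 1)
    (h₄ : n + r = q + 1) (i : Fin n) (j : Fin m) (s : Fin l), (s : ℕ) = i + j →
    ∀ (a : P n) (b : P m) (c : P p),
      D.comp h₂ s (D.comp h₁ i a b) c = D.comp h₄ i a (D.comp h₃ j b c)
  /-- parallel associativity: `(a ∘_i b) ∘_{j+m-1} c = (-1)^{|b||c|} (a ∘_j c) ∘_i b` for
  `i < j` -/
  assoc_par : ∀ {n m p l r q : ℕ} (h₁ : n + m = l + 1) (h₂ : l + p = q + 1) (h₃ : n + p = r + 1)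
    (h₄ : r + m = q + 1) (i j : Fin n) (s : Fin l) (t : Fin r), i < j →
    (s : ℕ) + 1 = j + m → (t : ℕ) = i → ∀ (e f : ℤ) (a : P n), ∀ b ∈ D.gr m e, ∀ c ∈ D.gr p f,
      D.comp h₂ s (D.comp h₁ i a b) c =
        ((e * f).negOnePow : ℤ) • D.comp h₄ t (D.comp h₃ j a c) b
  /-- equivariance: `σ a ∘_{σ i} τ b = ρ (a ∘_i b)`, where `ρ` is the permutation induced by
  `σ` and `τ` on the inputs of `a ∘_i b` -/
  equivariant : ∀ {n m l : ℕ} (h : n + m = l + 1) (i : Fin n)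
    (σ : Equiv.Perm (Fin n)) (τ : Equiv.Perm (Fin m)) (ρ : Equiv.Perm (Fin l)),
    (∀ (s : Fin l) (j : Fin n), j ≠ i → (s : ℕ) = outerIndex i m j →
      (ρ s : ℕ) = outerIndex (σ i) m (σ j)) →
    (∀ (s : Fin l) (j : Fin m), (s : ℕ) = i + j → (ρ s : ℕ) = σ i + τ j) →
    ∀ (a : P n) (b : P m),
      D.comp h (σ i) (D.act n σ a) (D.act m τ b) = D.act l ρ (D.comp h i a b)

/-- The subspaces `N n` form a dg suboperad. -/
structure IsDGSuboperad (D : OperadData k P) (N : ∀ n, Submodule k (P n)) : Prop where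
  /-- graded subspaces -/
  graded : ∀ n, N n = ⨆ e, N n ⊓ D.gr n e
  d_mem : ∀ n, ∀ a ∈ N n, D.d n a ∈ N n
  act_mem : ∀ n σ, ∀ a ∈ N n, D.act n σ a ∈ N n
  one_mem : D.one ∈ N 1
  comp_mem : ∀ {n m l : ℕ} (h : n + m = l + 1) (i : Fin n), ∀ a ∈ N n, ∀ b ∈ N m,
    D.comp h i a b ∈ N l

/-- The linear maps `φ n` form a morphism of dg operads. -/
structure IsDGMorphism (D : OperadData k P) (E : OperadData k Q)
    (φ : ∀ n, P n →ₗ[k] Q n) : Prop where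
  map_gr : ∀ n e, ∀ a ∈ D.gr n e, φ n a ∈ E.gr n e
  map_d : ∀ n a, φ n (D.d n a) = E.d n (φ n a)
  map_act : ∀ n σ a, φ n (D.act n σ a) = E.act n σ (φ n a)
  map_one : φ 1 D.one = E.one
  map_comp : ∀ {n m l : ℕ} (h : n + m = l + 1) (i : Fin n) (a : P n) (b : P m),
    φ l (D.comp h i a b) = E.comp h i (φ n a) (φ m b)

end Operads

/-! ## The minimal operad -/

variable (k : Type*) [Field k]

/-- Rooted `A_∞`-labeled trees with `n` white vertices. -/
def RootedTree (n : ℕ) : Type := {T : PTree Unit // T.IsRooted n}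

/-- The space `M(n)` with basis the rooted `A_∞`-labeled trees with `n` white vertices. Each
basis tree stands for the tree oriented by the planar order of its edges. -/
abbrev M (n : ℕ) : Type _ := RootedTree n →₀ k

open Classical in
/-- The element of `M(n)` given by a tree whose edges have pairwise different names in `ℕ`, with the
orientation given by the order of the names: it is the sign of the permutation from this order
to the planar order, times the basis tree. A tree that is not a rooted `A_∞`-labeled tree
gives `0`. -/
def ofOriented (n : ℕ) (T : PTree ℕ) : M k n :=
  if h : T.forget.IsRooted n then Finsupp.single ⟨T.forget, h⟩ (listSign T.edges : k) else 0

/-- The function on labels given by a permutation of `0, …, n - 1`. -/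
def permFun {n : ℕ} (σ : Equiv.Perm (Fin n)) (j : ℕ) : ℕ := if h : j < n then σ ⟨j, h⟩ else j

/-- The minimal operad.

* The differential is the sum over all ways of splitting a new black vertex off a vertex. At a white
  vertex this contracts one or more adjacent white angles; at a black vertex it is the
  differential of the `A_∞` label. The orientation is the new edge followed by the old edges.
* A permutation relabels the white vertices.
* The unit is the tree with a single white vertex.
* `T ∘_i T'` is the sum over all insertions of `T'` into the vertex `i` of `T`. The orientation is
  the edges of `T` followed by those of `T'`. -/
def minimalOperad : OperadData k (M k) where
  gr n e := Finsupp.supported k k {T : RootedTree n | T.1.degree = e}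
  d n := Finsupp.linearCombination k fun T : RootedTree n =>
    ((T.1.number 1).blowups.map (ofOriented k n)).sum
  act n σ := Finsupp.linearCombination k fun T : RootedTree n =>
    ofOriented k n ((T.1.number 0).relabel (permFun σ))
  one := ofOriented k 1 ⟨some 0, .nil⟩
  comp {n m l} _ i := Finsupp.linearCombination k fun T : RootedTree n =>
    Finsupp.linearCombination k fun T' : RootedTree m =>
      ((((T.1.number 0).relabel (outerIndex i m)).insert i
        ((T'.1.number T.1.size).relabel fun j => i + j)).map (ofOriented k l)).sum

/-! ## Oriented unrooted trees -/

/-- An `A_∞`-labeled tree with `n` white vertices, with a total order on the set of its edges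
(given by numbering the edges), and an auxiliary chosen angle. -/
def OrderedTree (n : ℕ) : Type :=
  {T : PTree ℕ // T.IsUnrooted n ∧ T.edges.Perm (List.range T.size)}

/-- The relations between ordered trees: the chosen angle does not matter, and reordering the edges
multiplies by the sign of the permutation. -/
def cyclicRelations (n : ℕ) : Submodule k (OrderedTree n →₀ k) :=
  Submodule.span k
    ({x | ∃ T T' : OrderedTree n, T'.1 = T.1.rot ∧ x = Finsupp.single T 1 - Finsupp.single T' 1} ∪
     {x | ∃ T T' : OrderedTree n, T'.1.forget = T.1.forget ∧ x = Finsupp.single T 1 -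
        ((listSign T.1.edges * listSign T'.1.edges : ℤ) : k) • Finsupp.single T' 1})

/-- The space `M_↻(n)` spanned by the oriented `A_∞`-labeled trees with `n` white vertices, modulo
the relation that reversing the orientation changes the sign. -/
abbrev MCyc (n : ℕ) : Type _ := (OrderedTree n →₀ k) ⧸ cyclicRelations k n

/-- The class of an ordered tree. -/
def MCyc.mk {n : ℕ} (T : OrderedTree n) : MCyc k n :=
  (cyclicRelations k n).mkQ (Finsupp.single T 1)

/-- The sum over all angles `r` of the tree `T` of the rooted trees `(T, r)`, each with the sign of
the permutation from the given order of the edges to the planar order starting at `r`. -/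
def sumOverAngles {n : ℕ} (T : OrderedTree n) : M k n :=
  ∑ j ∈ Finset.range T.1.numAngles, ofOriented k n (PTree.rot^[j] T.1)

end AInfTrees

end

open AInfTrees

noncomputable section

namespace AInfTrees

/-! ## Signs -/

/-! A tree whose edges have distinct names in `ℕ` is oriented by the order of the names, so each
element `x` of `M k n` has a coefficient `ev S x` at every such tree `S`. The operations are defined
by sums over insertions and splittings; in these coordinates they become sums over contractions,
which are functions and much easier to compose.

A tree `S` arises by inserting one tree into the vertex `i` of another exactly when its edges can be
divided into a set `P` and its complement such that contracting `P` to a vertex `i` gives the host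
and contracting the complement gives the inserted tree (`PTree.mem_insert_iff`). Hence the
coefficient of `x ∘ᵢ y` at `S` is the sum over all `P` of a shuffle sign times a coefficient of `x`
and a coefficient of `y` (`ev_comp`). Likewise the coefficient of `d x` is a signed sum over the
edges of `S` of the coefficients of `x` after contracting that edge (`ev_d`). Vertices carry
arbitrary finite sets of labels, so that every contraction makes sense; trees that are not basis
trees simply have coefficient zero. Contractions compose (`Tr.op_op`), and the operad axioms reduce
to identities between labels and between shuffle signs.

The delicate point is the differential at unstable trees. At a black vertex of valence two the
contractions of its two edges cancel, and restricting the sum to edges with labels on both sides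
makes the formula valid without stability (`ev_d_of_separated`). This is needed for the Leibniz
rule, where removing labels creates unstable trees, and for cyclic invariance, where moving the root
does.

Contraction commutes with moving the root to the next angle, except that a step along a contracted
edge becomes no step at all (`Tr.op_rot`). Since the sets of edges and the shuffle signs do not see
the root, the elements whose coefficients are independent of the root (`rotInvariants`) are closed
under all operations. Sums over all angles are such elements. Forgetting the root and dividing by
the number of angles, which is possible in characteristic zero, is a left inverse of the sum over
angles (`forgetRoot_angleSum`), and averaging shows that every root independent element is reached
(`range_angleSum`). The map is therefore injective with a dg suboperad as image, and the structure
is transported back in a unique way (`existsUnique_isDGOperad`). -/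

/-- The sign contributed by a pair of names, `a` standing before `b`. -/
def pairSign (a b : ℕ) : ℤ := if b < a then -1 else 1

lemma pairSign_swap {a b : ℕ} (h : a ≠ b) : pairSign b a = -pairSign a b := by
  unfold pairSign; split_ifs <;> first | rfl | omega

lemma listSign_nil : listSign [] = 1 := rfl

/-- Inversions with the first entry are split off. This turns the sign into a product over pairs,
which can be regrouped along shuffles. -/
lemma listSign_cons (a : ℕ) (l : List ℕ) :
    listSign (a :: l) = (l.map (pairSign a)).prod * listSign l := by
  have h : ∀ l : List ℕ, (-1 : ℤ) ^ (l.filter fun b => b < a).length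
      = (l.map (pairSign a)).prod := by
    intro l
    induction l with
    | nil => rfl
    | cons b l ih =>
      by_cases hb : b < a <;> simp [hb, pairSign, pow_succ, ← ih]
  simp only [listSign, inversions, pow_add, h]

lemma listSign_mul_self (l : List ℕ) : listSign l * listSign l = 1 := by
  rw [listSign, ← mul_pow]; simp

/-- The sign of the shuffle that puts the names in `A` before those in `B`. -/
def shuffleSign (A B : Finset ℕ) : ℤ := ∏ a ∈ A, ∏ b ∈ B, pairSign a b

lemma shuffleSign_union_left {A A' : Finset ℕ} (B : Finset ℕ) (h : Disjoint A A') :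
    shuffleSign (A ∪ A') B = shuffleSign A B * shuffleSign A' B :=
  Finset.prod_union h

lemma shuffleSign_union_right (A : Finset ℕ) {B B' : Finset ℕ} (h : Disjoint B B') :
    shuffleSign A (B ∪ B') = shuffleSign A B * shuffleSign A B' := by
  simp only [shuffleSign, Finset.prod_union h, Finset.prod_mul_distrib]

/-- Each of the `A.card * B.card` pairs changes its sign. This is where the Koszul signs of the
operad come from. -/
lemma shuffleSign_swap {A B : Finset ℕ} (h : Disjoint A B) :
    shuffleSign B A = (-1) ^ (A.card * B.card) * shuffleSign A B := by
  have : ∀ a ∈ A, ∀ b ∈ B, pairSign b a = -1 * pairSign a b := fun a ha b hb => by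
    rw [pairSign_swap (by rintro rfl; exact Finset.disjoint_left.1 h ha hb)]; ring
  unfold shuffleSign
  rw [Finset.prod_comm, Finset.prod_congr rfl fun a ha => Finset.prod_congr rfl (this a ha)]
  simp [Finset.prod_mul_distrib, pow_mul, mul_comm A.card, Finset.prod_neg]

@[simp] lemma shuffleSign_empty_left (B : Finset ℕ) : shuffleSign ∅ B = 1 := rfl

@[simp] lemma shuffleSign_empty_right (A : Finset ℕ) : shuffleSign A ∅ = 1 := by
  simp [shuffleSign]

/-- The sign of a word in two colors: each `true` standing before a `false` counts. -/
def colorSign : List Bool → ℤ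
  | [] => 1
  | b :: w => (if b then (-1) ^ w.count false else 1) * colorSign w

/-- Sort the pairs by color. Pairs of equal color give the last two factors. A mixed pair with
`true` in front enters `listSign` in the wrong order, and `colorSign` corrects exactly these; so the
mixed pairs give the shuffle sign, whatever the positions. For the edges of a tree, the two filtered
lists are the planar orders of its two contractions. -/
lemma colorSign_mul_listSign {l : List ℕ} (hl : l.Nodup) (p : ℕ → Bool) :
    colorSign (l.map p) * listSign l =
      shuffleSign (l.toFinset.filter fun a => p a = false) (l.toFinset.filter fun a => p a = true) *
        (listSign (l.filter fun a => !p a) * listSign (l.filter p)) := by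
  induction l with
  | nil => rfl
  | cons a l ih =>
    obtain ⟨ha, hl⟩ := List.nodup_cons.1 hl
    have ih := ih hl
    have ha' : a ∉ l.toFinset := by simpa using ha
    have hsplit : (l.map (pairSign a)).prod = (∏ b ∈ l.toFinset with p b = false, pairSign a b) *
        ∏ b ∈ l.toFinset with p b = true, pairSign a b := by
      rw [← List.prod_toFinset _ hl, ← Finset.prod_filter_mul_prod_filter_not l.toFinset
        (fun b => p b = false)]
      simp
    have hfilt : ∀ q : ℕ → Bool, ((l.filter q).map (pairSign a)).prod =
        ∏ b ∈ l.toFinset with q b = true, pairSign a b := by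
      intro q
      rw [← List.prod_toFinset _ (hl.filter _), List.toFinset_filter]
    cases hp : p a
    · have h1 : a ∉ l.toFinset.filter fun b => p b = false := by simp [ha]
      simp only [List.map_cons, hp, colorSign, listSign_cons, hsplit, List.toFinset_cons,
        Finset.filter_insert, List.filter_cons, hfilt, shuffleSign, Finset.prod_insert h1,
        Bool.not_false, if_true, if_false, Bool.false_eq_true, Bool.not_eq_true']
      unfold shuffleSign at ih
      linear_combination ((∏ b ∈ l.toFinset with p b = false, pairSign a b) *
        ∏ b ∈ l.toFinset with p b = true, pairSign a b) * ih
    · have h1 : a ∉ l.toFinset.filter fun b => p b = true := by simp [ha]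
      -- The color sign reverses each pair formed by `a` and a later name of color `false`.
      have hc : (-1 : ℤ) ^ (l.map p).count false * (∏ b ∈ l.toFinset with p b = false, pairSign a b)
          = ∏ b ∈ l.toFinset with p b = false, pairSign b a := by
        have : (l.map p).count false = (l.toFinset.filter fun b => p b = false).card := by
          rw [List.count, List.countP_map, List.countP_eq_length_filter,
            ← List.toFinset_card_of_nodup (hl.filter _), List.toFinset_filter]
          congr 1; ext; simp
        rw [this, ← Finset.prod_const, ← Finset.prod_mul_distrib]
        refine Finset.prod_congr rfl fun b hb => ?_
        rw [pairSign_swap (a := a) (b := b)]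
        · ring
        · rintro rfl; simp [ha] at hb
      simp only [List.map_cons, hp, colorSign, listSign_cons, hsplit, List.toFinset_cons,
        Finset.filter_insert, List.filter_cons, hfilt, shuffleSign, Finset.prod_insert h1,
        Bool.not_true, if_true, if_false, Bool.false_eq_true, Finset.prod_mul_distrib,
        reduceCtorEq, ← hc]
      unfold shuffleSign at ih
      linear_combination ((-1 : ℤ) ^ (l.map p).count false *
        (∏ b ∈ l.toFinset with p b = false, pairSign a b) *
        ∏ b ∈ l.toFinset with p b = true, pairSign a b) * ih

lemma listSign_of_sorted {l : List ℕ} (h : l.Pairwise (· < ·)) : listSign l = 1 := by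
  induction l with
  | nil => rfl
  | cons a l ih =>
    rw [List.pairwise_cons] at h
    rw [listSign_cons, ih h.2, mul_one]
    refine List.prod_eq_one fun x hx => ?_
    obtain ⟨b, hb, rfl⟩ := List.mem_map.1 hx
    have := h.1 b hb
    unfold pairSign; split_ifs <;> first | rfl | omega

/-- The sign of a renaming depends on the set of names only. -/
lemma listSign_map_mul {l l' : List ℕ} (h : l.Perm l') (hl : l.Nodup) (f : ℕ → ℕ)
    (hf : (l.map f).Nodup) :
    listSign (l.map f) * listSign l = listSign (l'.map f) * listSign l' := by
  induction h with
  | nil => rfl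
  | @cons a l₁ l₂ h ih =>
    have := ih (List.nodup_cons.1 hl).2 (List.nodup_cons.1 hf).2
    simp only [List.map_cons, listSign_cons]
    rw [((h.map f).map (pairSign (f a))).prod_eq, (h.map (pairSign a)).prod_eq]
    linear_combination (((l₂.map f).map (pairSign (f a))).prod * (l₂.map (pairSign a)).prod) * this
  | swap a b l =>
    have h1 : a ≠ b := by rintro rfl; simp at hl
    have h2 : f a ≠ f b := by intro e; simp [e] at hf
    simp only [List.map_cons, listSign_cons, List.prod_cons, pairSign_swap h1, pairSign_swap h2]
    ring
  | trans h₁ h₂ ih₁ ih₂ =>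
    exact (ih₁ hl hf).trans (ih₂ (h₁.nodup_iff.1 hl) ((h₁.map f).nodup_iff.1 hf))

/-- A transposition is odd: an entry in between changes its pairs with both `a` and `b`, so that
only the pair of `a` and `b` itself matters. -/
lemma listSign_swap {a b : ℕ} (h : a ≠ b) {l₁ : List ℕ} (ha : a ∉ l₁) (hb : b ∉ l₁)
    (l₂ : List ℕ) : listSign (b :: (l₁ ++ a :: l₂)) = -listSign (a :: (l₁ ++ b :: l₂)) := by
  induction l₁ with
  | nil => simp only [List.nil_append, listSign_cons, List.map_cons, List.prod_cons,
      pairSign_swap h]; ring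
  | cons c l₁ ih =>
    rw [List.mem_cons, not_or] at ha hb
    have ih := ih ha.2 hb.2
    simp only [listSign_cons, List.cons_append, List.map_cons, List.map_append, List.prod_append,
      List.prod_cons] at ih ⊢
    rw [pairSign_swap ha.1, pairSign_swap hb.1]
    linear_combination (-pairSign b c * pairSign a c * (l₁.map (pairSign c)).prod *
      (l₂.map (pairSign c)).prod) * ih

/-! ## Planar trees with sets of labels -/

/-- A list of branches of a planar tree each of whose vertices carries a finite set of labels. -/
inductive Br (ε : Type) : Type
  | nil : Br ε
  | cons (e : ε) (v : Finset ℕ) (A R : Br ε) : Br ε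

namespace Br

variable {ε δ γ : Type}

def app : Br ε → Br ε → Br ε
  | nil, G => G
  | cons e v A R, G => cons e v A (app R G)

def length : Br ε → ℕ
  | nil => 0
  | cons _ _ _ R => R.length + 1

def edges : Br ε → List ε
  | nil => []
  | cons e _ A R => e :: (A.edges ++ R.edges)

def mapE (f : ε → δ) : Br ε → Br δ
  | nil => nil
  | cons e v A R => cons (f e) v (A.mapE f) (R.mapE f)

/-- The number of vertices that carry the label `b`. -/
def cnt (b : ℕ) : Br ε → ℕ
  | nil => 0
  | cons _ v A R => (if b ∈ v then 1 else 0) + A.cnt b + R.cnt b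

/-- Every vertex carries at most one label. -/
def Simple : Br ε → Prop
  | nil => True
  | cons _ v A R => v.card ≤ 1 ∧ A.Simple ∧ R.Simple

/-- Every vertex without labels has at least two branches above it. -/
def Stable : Br ε → Prop
  | nil => True
  | cons _ v A R => (v = ∅ → 2 ≤ A.length) ∧ A.Stable ∧ R.Stable

/-- Replace each label `a` by the set of labels `g a`, and contract each edge `e` for which `h e` is
a set; the vertex obtained by the contraction receives the labels in `h e` as well. The first
component of the result is the set of labels contributed to the vertex that carries the branches. -/
def op (g : ℕ → Finset ℕ) (h : ε → Option (Finset ℕ)) : Br ε → Finset ℕ × Br ε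
  | nil => (∅, nil)
  | cons e v A R =>
    match h e with
    | none => ((op g h R).1, cons e (v.biUnion g ∪ (op g h A).1) (op g h A).2 (op g h R).2)
    | some l => (l ∪ (v.biUnion g ∪ (op g h A).1) ∪ (op g h R).1, (op g h A).2.app (op g h R).2)

variable {g : ℕ → Finset ℕ} {h : ε → Option (Finset ℕ)}

@[simp] lemma op_nil : op g h nil = (∅, nil) := rfl

lemma op_cons_none {e : ε} (he : h e = none) (v : Finset ℕ) (A R : Br ε) :
    op g h (cons e v A R) =
      ((op g h R).1, cons e (v.biUnion g ∪ (op g h A).1) (op g h A).2 (op g h R).2) := by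
  simp [op, he]

lemma op_cons_some {e : ε} {l : Finset ℕ} (he : h e = some l) (v : Finset ℕ) (A R : Br ε) :
    op g h (cons e v A R) = (l ∪ (v.biUnion g ∪ (op g h A).1) ∪ (op g h R).1,
      (op g h A).2.app (op g h R).2) := by
  simp [op, he]

@[simp] lemma nil_app (F : Br ε) : nil.app F = F := rfl
@[simp] lemma cons_app (e : ε) (v A R) (F : Br ε) :
    (cons e v A R).app F = cons e v A (R.app F) := rfl
@[simp] lemma app_nil (F : Br ε) : F.app nil = F := by
  induction F with
  | nil => rfl
  | cons e v A R _ ih => rw [cons_app, ih]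
@[simp] lemma app_assoc (F G H : Br ε) : (F.app G).app H = F.app (G.app H) := by
  induction F with
  | nil => rfl
  | cons e v A R _ ih => simp [ih]
@[simp] lemma edges_app (F G : Br ε) : (F.app G).edges = F.edges ++ G.edges := by
  induction F with
  | nil => rfl
  | cons e v A R _ ih => simp [edges, ih]
@[simp] lemma length_app (F G : Br ε) : (F.app G).length = F.length + G.length := by
  induction F with
  | nil => simp [length]
  | cons e v A R _ ih => simp [length, ih]; omega
@[simp] lemma mapE_app (f : ε → δ) (F G : Br ε) : (F.app G).mapE f = (F.mapE f).app (G.mapE f) := by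
  induction F with
  | nil => rfl
  | cons e v A R _ ih => simp [mapE, ih]
@[simp] lemma cnt_app (b : ℕ) (F G : Br ε) : (F.app G).cnt b = F.cnt b + G.cnt b := by
  induction F with
  | nil => simp [cnt]
  | cons e v A R _ ih => simp [cnt, ih]; omega
@[simp] lemma stable_app {F G : Br ε} : (F.app G).Stable ↔ F.Stable ∧ G.Stable := by
  induction F with
  | nil => simp [Stable]
  | cons e v A R _ ih => simp [Stable, ih, and_assoc]
@[simp] lemma simple_app {F G : Br ε} : (F.app G).Simple ↔ F.Simple ∧ G.Simple := by
  induction F with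
  | nil => simp [Simple]
  | cons e v A R _ ih => simp [Simple, ih, and_assoc]
@[simp] lemma edges_mapE (f : ε → δ) (F : Br ε) : (F.mapE f).edges = F.edges.map f := by
  induction F with
  | nil => rfl
  | cons e v A R ih1 ih2 => simp [mapE, edges, ih1, ih2]
@[simp] lemma length_mapE (f : ε → δ) (F : Br ε) : (F.mapE f).length = F.length := by
  induction F with
  | nil => rfl
  | cons e v A R ih1 ih2 => simp [mapE, length, ih2]
@[simp] lemma mapE_mapE (f : ε → δ) (f' : δ → γ) (F : Br ε) :
    (F.mapE f).mapE f' = F.mapE (f' ∘ f) := by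
  induction F with
  | nil => rfl
  | cons e v A R ih1 ih2 => simp [mapE, ih1, ih2]
@[simp] lemma cnt_mapE (b : ℕ) (f : ε → δ) (F : Br ε) : (F.mapE f).cnt b = F.cnt b := by
  induction F with
  | nil => rfl
  | cons e v A R ih1 ih2 => simp [mapE, cnt, ih1, ih2]
@[simp] lemma stable_mapE (f : ε → δ) (F : Br ε) : (F.mapE f).Stable ↔ F.Stable := by
  induction F with
  | nil => rfl
  | cons e v A R ih1 ih2 => simp [mapE, Stable, ih1, ih2]
@[simp] lemma simple_mapE (f : ε → δ) (F : Br ε) : (F.mapE f).Simple ↔ F.Simple := by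
  induction F with
  | nil => rfl
  | cons e v A R ih1 ih2 => simp [mapE, Simple, ih1, ih2]

lemma mapE_congr {f f' : ε → δ} {F : Br ε} (H : ∀ e ∈ F.edges, f e = f' e) :
    F.mapE f = F.mapE f' := by
  induction F with
  | nil => rfl
  | cons e v A R ih1 ih2 =>
    simp only [edges, List.mem_cons, List.mem_append] at H
    simp only [mapE, H e (Or.inl rfl), ih1 fun e h => H e (by tauto), ih2 fun e h => H e (by tauto)]

lemma mapE_id (F : Br ε) : F.mapE id = F := by
  induction F with
  | nil => rfl
  | cons e v A R ih1 ih2 => simp [mapE, ih1, ih2]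

lemma op_app (F G : Br ε) :
    op g h (F.app G) = ((op g h F).1 ∪ (op g h G).1, (op g h F).2.app (op g h G).2) := by
  induction F with
  | nil => simp [op]
  | cons e v A R _ ih =>
    cases he : h e with
    | none => simp [op_cons_none he, ih]
    | some l => simp [op_cons_some he, ih, Finset.union_assoc]

/-- Two contractions in succession are a single one, where an edge contracted first passes its
labels through the second label map. This reduces identities between iterated contractions of a tree
to pointwise identities for labels and edges. -/
lemma op_op {g' : ℕ → Finset ℕ} {h' : ε → Option (Finset ℕ)} {g'' : ℕ → Finset ℕ}
    {h'' : ε → Option (Finset ℕ)} (hg : ∀ a, g'' a = (g a).biUnion g')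
    (hh : ∀ e, h'' e = match h e with
      | none => h' e
      | some l => some (l.biUnion g')) (F : Br ε) :
    ((op g h F).1.biUnion g' ∪ (op g' h' (op g h F).2).1, (op g' h' (op g h F).2).2) =
      op g'' h'' F := by
  induction F with
  | nil => simp [op]
  | cons e v A R ih1 ih2 =>
    have hv : v.biUnion g'' = (v.biUnion g).biUnion g' := by
      rw [Finset.biUnion_biUnion]; exact Finset.biUnion_congr rfl fun a _ => hg a
    have he := hh e
    cases he1 : h e with
    | none =>
      simp only [he1] at he
      cases he2 : h' e with
      | none =>
        rw [he2] at he
        rw [op_cons_none he1, op_cons_none he, op_cons_none he2, ← ih1, ← ih2, hv,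
          Finset.union_biUnion, Finset.union_assoc]
      | some l =>
        rw [he2] at he
        rw [op_cons_none he1, op_cons_some he, op_cons_some he2, ← ih1, ← ih2, hv]
        simp only [Finset.union_biUnion, Prod.mk.injEq, and_true]
        ac_rfl
    | some l =>
      simp only [he1] at he
      rw [op_cons_some he1, op_cons_some he, op_app, ← ih1, ← ih2, hv]
      simp only [Finset.union_biUnion, Prod.mk.injEq, and_true]
      ac_rfl

/-- Some identities between label maps fail for labels beyond the number of white vertices; it
suffices to have them for the labels that occur. -/
lemma op_congr {g' : ℕ → Finset ℕ} {h' : ε → Option (Finset ℕ)} {F : Br ε}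
    (hg : ∀ a, 0 < F.cnt a → g a = g' a) (hh : ∀ e ∈ F.edges, h e = h' e) :
    op g h F = op g' h' F := by
  induction F with
  | nil => rfl
  | cons e v A R ih1 ih2 =>
    simp only [edges, List.mem_cons, List.mem_append] at hh
    have h1 := ih1 (fun a ha => hg a (by simp only [cnt]; omega)) fun e h => hh e (by tauto)
    have h2 := ih2 (fun a ha => hg a (by simp only [cnt]; omega)) fun e h => hh e (by tauto)
    have h3 : v.biUnion g = v.biUnion g' :=
      Finset.biUnion_congr rfl fun a ha => hg a (by simp [cnt, ha])
    simp only [op, h1, h2, h3, hh e (Or.inl rfl)]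

lemma op_id {h : ε → Option (Finset ℕ)} {F : Br ε} (hh : ∀ e ∈ F.edges, h e = none) :
    op (fun a => {a}) h F = (∅, F) := by
  induction F with
  | nil => rfl
  | cons e v A R ih1 ih2 =>
    simp only [edges, List.mem_cons, List.mem_append] at hh
    rw [op_cons_none (hh e (Or.inl rfl)), ih1 fun e h => hh e (by tauto),
      ih2 fun e h => hh e (by tauto)]
    simp

lemma op_mapE (f : δ → ε) (F : Br δ) :
    op g h (F.mapE f) = ((op g (h ∘ f) F).1, (op g (h ∘ f) F).2.mapE f) := by
  induction F with
  | nil => rfl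
  | cons e v A R ih1 ih2 =>
    cases he : h (f e) with
    | none =>
      rw [mapE, op_cons_none he, op_cons_none (h := h ∘ f) he, ih1, ih2]; rfl
    | some l =>
      rw [mapE, op_cons_some he, op_cons_some (h := h ∘ f) he, ih1, ih2, mapE_app]

/-- Contraction does not disturb the planar order of the surviving edges, so the orientation signs
of contracted trees are signs of sublists. -/
lemma edges_op (F : Br ε) : (op g h F).2.edges = F.edges.filter fun e => (h e).isNone := by
  induction F with
  | nil => rfl
  | cons e v A R ih1 ih2 =>
    cases he : h e with
    | none => simp [op_cons_none he, edges, ih1, ih2, he]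
    | some l => simp [op_cons_some he, edges, ih1, ih2, he]

/-- As no label is lost, an unlabeled vertex of the result is merged from unlabeled vertices only,
and each contracted edge replaces one branch by at least two. The second clause carries this count
of branches through the induction. -/
lemma stable_op (hg : ∀ a, (g a).Nonempty) {F : Br ε} (hF : F.Stable) :
    (op g h F).2.Stable ∧ ((op g h F).1 = ∅ → F.length ≤ (op g h F).2.length) := by
  have hv : ∀ v : Finset ℕ, v.biUnion g = ∅ → v = ∅ := fun v hv => by
    by_contra hne
    obtain ⟨a, ha⟩ := Finset.nonempty_iff_ne_empty.2 hne
    obtain ⟨b, hb⟩ := hg a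
    exact Finset.notMem_empty b (hv ▸ Finset.mem_biUnion.2 ⟨a, ha, hb⟩)
  induction F with
  | nil => simp [op, Stable]
  | cons e v A R ih1 ih2 =>
    obtain ⟨h0, hA, hR⟩ := hF
    have ih1 := ih1 hA
    have ih2 := ih2 hR
    cases he : h e with
    | none =>
      rw [op_cons_none he]
      refine ⟨⟨fun hl => ?_, ih1.1, ih2.1⟩, fun hl => by simpa [length] using ih2.2 hl⟩
      rw [Finset.union_eq_empty] at hl
      exact (h0 (hv v hl.1)).trans (ih1.2 hl.2)
    | some l =>
      rw [op_cons_some he]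
      refine ⟨stable_app.2 ⟨ih1.1, ih2.1⟩, fun hl => ?_⟩
      simp only [Finset.union_eq_empty] at hl
      have := h0 (hv v hl.1.2.1)
      have := ih1.2 hl.1.2.2
      have := ih2.2 hl.2
      simp only [length, length_app]; omega

/-- If only the label `a` can produce the label `b`, then `op` does not increase its number. -/
lemma cnt_op_le {a b : ℕ} (hg : ∀ a', b ∈ g a' → a' = a) (hh : ∀ e l, h e = some l → b ∉ l)
    (F : Br ε) : (op g h F).2.cnt b + (if b ∈ (op g h F).1 then 1 else 0) ≤ F.cnt a := by
  induction F with
  | nil => simp [op, cnt]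
  | cons e v A R ih1 ih2 =>
    have hv : b ∈ v.biUnion g → a ∈ v := fun hb => by
      obtain ⟨a', ha', hb⟩ := Finset.mem_biUnion.1 hb
      exact hg a' hb ▸ ha'
    cases he : h e with
    | none =>
      rw [op_cons_none he]
      simp only [cnt, Finset.mem_union]
      split_ifs at * <;> first | omega | tauto
    | some l =>
      have := hh e l he
      rw [op_cons_some he]
      simp only [cnt_app, cnt, Finset.mem_union]
      split_ifs at * <;> first | omega | tauto

end Br

/-- A planar rooted tree each of whose vertices carries a finite set of labels: the labels of the
root vertex and the branches at the root. -/
abbrev Tr (ε : Type) : Type := Finset ℕ × Br ε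

namespace Tr

variable {ε δ γ : Type}

def edges (S : Tr ε) : List ε := S.2.edges
def mapE (f : ε → δ) (S : Tr ε) : Tr δ := (S.1, S.2.mapE f)
def forget (S : Tr ε) : Tr Unit := S.mapE fun _ => ()
def cnt (b : ℕ) (S : Tr ε) : ℕ := (if b ∈ S.1 then 1 else 0) + S.2.cnt b
def Simple (S : Tr ε) : Prop := S.1.card ≤ 1 ∧ S.2.Simple
def Stable (S : Tr ε) : Prop := (S.1 = ∅ → 2 ≤ S.2.length) ∧ S.2.Stable

/-- See `Br.op`. -/
def op (g : ℕ → Finset ℕ) (h : ε → Option (Finset ℕ)) (S : Tr ε) : Tr ε :=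
  (S.1.biUnion g ∪ (S.2.op g h).1, (S.2.op g h).2)

/-- Move the root to the next angle. -/
def rot : Tr ε → Tr ε
  | (v, .nil) => (v, .nil)
  | (v, .cons e w A R) => (w, A.app (.cons e v R .nil))

variable {g : ℕ → Finset ℕ} {h : ε → Option (Finset ℕ)}

@[simp] lemma edges_mapE (f : ε → δ) (S : Tr ε) : (S.mapE f).edges = S.edges.map f :=
  Br.edges_mapE f S.2
@[simp] lemma mapE_mapE (f : ε → δ) (f' : δ → γ) (S : Tr ε) :
    (S.mapE f).mapE f' = S.mapE (f' ∘ f) := by simp [mapE]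
@[simp] lemma forget_mapE (f : ε → δ) (S : Tr ε) : (S.mapE f).forget = S.forget := by
  simp only [forget, mapE_mapE, Function.comp_def]
@[simp] lemma cnt_mapE (b : ℕ) (f : ε → δ) (S : Tr ε) : (S.mapE f).cnt b = S.cnt b := by
  rw [cnt, cnt, mapE, Br.cnt_mapE]
@[simp] lemma stable_mapE (f : ε → δ) {S : Tr ε} : (S.mapE f).Stable ↔ S.Stable := by
  simp [Stable, mapE]
@[simp] lemma simple_mapE (f : ε → δ) {S : Tr ε} : (S.mapE f).Simple ↔ S.Simple := by
  simp [Simple, mapE]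
@[simp] lemma stable_forget {S : Tr ε} : S.forget.Stable ↔ S.Stable := by
  simp [Stable, forget, mapE]

lemma mapE_congr {f f' : ε → δ} {S : Tr ε} (H : ∀ e ∈ S.edges, f e = f' e) :
    S.mapE f = S.mapE f' := by
  rw [mapE, mapE, Br.mapE_congr H]

lemma op_op {g' : ℕ → Finset ℕ} {h' : ε → Option (Finset ℕ)} {g'' : ℕ → Finset ℕ}
    {h'' : ε → Option (Finset ℕ)} (hg : ∀ a, g'' a = (g a).biUnion g')
    (hh : ∀ e, h'' e = match h e with
      | none => h' e
      | some l => some (l.biUnion g')) (S : Tr ε) :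
    (S.op g h).op g' h' = S.op g'' h'' := by
  rw [op, op, op, ← Br.op_op hg hh]
  have hv : S.1.biUnion g'' = (S.1.biUnion g).biUnion g' := by
    rw [Finset.biUnion_biUnion]; exact Finset.biUnion_congr rfl fun a _ => hg a
  simp only [hv, Finset.union_biUnion, Finset.union_assoc]

lemma op_congr {g' : ℕ → Finset ℕ} {h' : ε → Option (Finset ℕ)} {S : Tr ε}
    (hg : ∀ a, 0 < S.cnt a → g a = g' a) (hh : ∀ e ∈ S.edges, h e = h' e) :
    S.op g h = S.op g' h' := by
  rw [op, op, Br.op_congr (fun a ha => hg a (by simp only [cnt]; omega)) hh,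
    Finset.biUnion_congr rfl fun a ha => hg a (by simp [cnt, ha])]

lemma op_id {S : Tr ε} (hh : ∀ e ∈ S.edges, h e = none) : S.op (fun a => {a}) h = S := by
  rw [op, Br.op_id hh]; simp

lemma op_mapE (f : δ → ε) (S : Tr δ) : (S.mapE f).op g h = (S.op g (h ∘ f)).mapE f := by
  simp [op, mapE, Br.op_mapE]

lemma edges_op (S : Tr ε) : (S.op g h).edges = S.edges.filter fun e => (h e).isNone :=
  Br.edges_op S.2

lemma stable_op (hg : ∀ a, (g a).Nonempty) {S : Tr ε} (hS : S.Stable) : (S.op g h).Stable := by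
  have h1 := Br.stable_op (h := h) hg hS.2
  refine ⟨fun hl => ?_, h1.1⟩
  rw [op, Finset.union_eq_empty] at hl
  refine (hS.1 ?_).trans (h1.2 hl.2)
  by_contra hne
  obtain ⟨a, ha⟩ := Finset.nonempty_iff_ne_empty.2 hne
  obtain ⟨b, hb⟩ := hg a
  exact Finset.notMem_empty b (hl.1 ▸ Finset.mem_biUnion.2 ⟨a, ha, hb⟩)

lemma cnt_op_le {a b : ℕ} (hg : ∀ a', b ∈ g a' → a' = a) (hh : ∀ e l, h e = some l → b ∉ l)
    (S : Tr ε) : (S.op g h).cnt b ≤ S.cnt a := by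
  have := Br.cnt_op_le hg hh S.2
  have hv : b ∈ S.1.biUnion g → a ∈ S.1 := fun hb => by
    obtain ⟨a', ha', hb⟩ := Finset.mem_biUnion.1 hb
    exact hg a' hb ▸ ha'
  simp only [cnt, op, Finset.mem_union]
  split_ifs at * <;> first | omega | tauto

@[simp] lemma rot_nil (v : Finset ℕ) : rot (v, (.nil : Br ε)) = (v, .nil) := rfl
@[simp] lemma rot_cons (v e w) (A R : Br ε) :
    rot (v, .cons e w A R) = (w, A.app (.cons e v R .nil)) := rfl

lemma edges_rot (S : Tr ε) : S.rot.edges.Perm S.edges := by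
  rcases S with ⟨v, _ | ⟨e, w, A, R⟩⟩
  · rfl
  · simp only [rot_cons, edges, Br.edges_app, Br.edges, List.append_nil]
    exact List.perm_middle

lemma cnt_rot (b : ℕ) (S : Tr ε) : S.rot.cnt b = S.cnt b := by
  rcases S with ⟨v, _ | ⟨e, w, A, R⟩⟩
  · rfl
  · change (if b ∈ w then 1 else 0) + (A.app (.cons e v R .nil)).cnt b =
      (if b ∈ v then 1 else 0) + (Br.cons e w A R).cnt b
    simp only [Br.cnt_app, Br.cnt]; omega

lemma mapE_rot (f : ε → δ) (S : Tr ε) : S.rot.mapE f = (S.mapE f).rot := by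
  rcases S with ⟨v, _ | ⟨e, w, A, R⟩⟩
  · rfl
  · simp [mapE, Br.mapE]

lemma forget_rot (S : Tr ε) : S.rot.forget = S.forget.rot := mapE_rot _ S

/-- Contraction of edges commutes with moving the root, where passing along a contracted edge
does not move the root of the result. -/
lemma op_rot (S : Tr ε) : S.rot.op g h = (S.op g h).rot ∨ S.rot.op g h = S.op g h := by
  rcases S with ⟨v, _ | ⟨e, w, A, R⟩⟩
  · exact Or.inr rfl
  · cases he : h e with
    | none => left; simp [op, Br.op_app, Br.op_cons_none he, Br.op_nil]
    | some l =>
      right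
      simp only [op, rot_cons, Br.op_app, Br.op_cons_some he, Br.op_nil, Br.app_nil, Prod.mk.injEq,
        and_true, Finset.union_empty]
      ac_rfl

/-- Every edge of `A` is passed twice in the walk around these branches, after which they lie behind
the root. -/
lemma iterate_rot_append (A G : Br ε) (v : Finset ℕ) :
    rot^[2 * A.edges.length] (v, A.app G) = (v, G.app A) := by
  induction A generalizing G v with
  | nil => simp [Br.edges]
  | cons e w A R ih1 ih2 =>
    -- One step along the first edge, the walk around `A`, one step back, and the walk around `R`.
    have : 2 * (Br.cons e w A R).edges.length
        = 2 * R.edges.length + (1 + (2 * A.edges.length + 1)) := by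
      simp [Br.edges]; omega
    rw [this, Function.iterate_add_apply, Function.iterate_add_apply, Function.iterate_add_apply]
    simp only [Function.iterate_one, Br.cons_app, rot_cons, ih1, Br.nil_app, Br.app_assoc, ih2]

lemma iterate_rot_self (S : Tr ε) : rot^[2 * S.edges.length] S = S := by
  have := iterate_rot_append S.2 .nil S.1
  rwa [Br.app_nil, Br.nil_app] at this

/-- To prove a property of trees with a chosen edge that does not depend on the root, one may assume
that the edge is the first one after the root. -/
lemma rot_induction {Φ : Tr ε → Prop} (hΦ : ∀ S, Φ S.rot → Φ S) {e : ε}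
    (h0 : ∀ v w A R, Φ (v, .cons e w A R)) (S : Tr ε) (he : e ∈ S.edges) : Φ S := by
  have hit : ∀ n S, Φ (rot^[n] S) → Φ S := by
    intro n
    induction n with
    | zero => exact fun S h => h
    | succ n ih => exact fun S h => hΦ S (ih _ h)
  obtain ⟨v, F⟩ := S
  suffices H : ∀ F : Br ε, e ∈ F.edges → ∀ v G, Φ (v, F.app G) by simpa using H F he v .nil
  intro F
  induction F with
  | nil => simp [Br.edges]
  | cons e' w A R ih1 ih2 =>
    intro he v G
    simp only [Br.edges, List.mem_cons, List.mem_append] at he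
    rcases he with rfl | he | he
    · exact h0 _ _ _ _
    · apply hΦ; simp only [Br.cons_app, rot_cons]; exact ih1 he _ _
    -- The walk around the first branch alone brings `R` to the front.
    · apply hit (2 * (Br.cons e' w A .nil).edges.length)
      have := iterate_rot_append (Br.cons e' w A .nil) (R.app G) v
      simp only [Br.cons_app, Br.nil_app] at this ⊢
      rw [this, Br.app_assoc]
      exact ih2 he _ _

end Tr

/-! ## Planar trees as trees with sets of labels -/

namespace Branches

variable {ε δ γ : Type}

/-- The image consists of the forests with at most one label at each vertex (`exists_toBr_eq`);
larger label sets only arise from contractions. -/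
def toBr : Branches ε → Br ε
  | nil => .nil
  | cons e v A R => .cons e v.toFinset A.toBr R.toBr

lemma toBr_injective : Function.Injective (toBr : Branches ε → Br ε) := by
  intro F
  induction F with
  | nil => rintro (_ | _) h <;> simp [toBr] at h ⊢
  | cons e v A R ih1 ih2 =>
    rintro (_ | ⟨e', v', A', R'⟩) h
    · simp [toBr] at h
    · simp only [toBr, Br.cons.injEq] at h
      obtain ⟨rfl, h2, h3, h4⟩ := h
      rw [ih1 h3, ih2 h4]
      congr 1
      cases v <;> cases v' <;> simp_all

@[simp] lemma toBr_append (F G : Branches ε) : (F.append G).toBr = F.toBr.app G.toBr := by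
  induction F with
  | nil => rfl
  | cons e v A R _ ih => simp [append, toBr, ih]

@[simp] lemma edges_toBr (F : Branches ε) : F.toBr.edges = F.edges := by
  induction F with
  | nil => rfl
  | cons e v A R ih1 ih2 => simp [edges, Br.edges, toBr, ih1, ih2]

@[simp] lemma length_toBr (F : Branches ε) : F.toBr.length = F.length := by
  induction F with
  | nil => rfl
  | cons e v A R ih1 ih2 => simp [length, Br.length, toBr, ih2]

lemma toBr_mapEdges (f : ε → δ) (F : Branches ε) : (F.mapEdges f).toBr = F.toBr.mapE f := by
  induction F with
  | nil => rfl
  | cons e v A R ih1 ih2 => simp [mapEdges, Br.mapE, toBr, ih1, ih2]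

@[simp] lemma stable_toBr {F : Branches ε} : F.toBr.Stable ↔ F.Stable := by
  induction F with
  | nil => rfl
  | cons e v A R ih1 ih2 => cases v <;> simp [Stable, Br.Stable, toBr, ih1, ih2]

lemma simple_toBr (F : Branches ε) : F.toBr.Simple := by
  induction F with
  | nil => trivial
  | cons e v A R ih1 ih2 => exact ⟨by cases v <;> simp, ih1, ih2⟩

lemma ite_mem_toFinset (b : ℕ) (v : Option ℕ) :
    (if b ∈ v.toFinset then 1 else 0) = v.toList.count b := by
  cases v with
  | none => simp
  | some a => by_cases h : a = b <;> simp [h, eq_comm (a := b)]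

@[simp] lemma cnt_toBr (b : ℕ) (F : Branches ε) : F.toBr.cnt b = F.whites.count b := by
  induction F with
  | nil => rfl
  | cons e v A R ih1 ih2 => simp [whites, Br.cnt, toBr, ih1, ih2, ← ite_mem_toFinset, add_assoc]

lemma exists_toBr_eq {F : Br ε} (hF : F.Simple) : ∃ G : Branches ε, G.toBr = F := by
  induction F with
  | nil => exact ⟨.nil, rfl⟩
  | cons e v A R ih1 ih2 =>
    obtain ⟨A', rfl⟩ := ih1 hF.2.1
    obtain ⟨R', rfl⟩ := ih2 hF.2.2
    rcases Nat.le_one_iff_eq_zero_or_eq_one.1 hF.1 with h | h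
    · exact ⟨.cons e none A' R', by simp [toBr, Finset.card_eq_zero.1 h]⟩
    · obtain ⟨a, rfl⟩ := Finset.card_eq_one.1 h
      exact ⟨.cons e (some a) A' R', by simp [toBr]⟩

lemma size_eq_length_edges (F : Branches ε) : F.size = F.edges.length := by
  induction F with
  | nil => rfl
  | cons e v A R ih1 ih2 => simp [size, edges, ih1, ih2]

lemma edges_number (F : Branches ε) (s : ℕ) : (F.number s).edges = List.range' s F.size := by
  induction F generalizing s with
  | nil => rfl
  | cons e v A R ih1 ih2 =>
    rw [number, edges, ih1, ih2, size, List.range'_succ, List.range'_append_1]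

lemma mapEdges_relabel (f : ε → δ) (g : ℕ → ℕ) (F : Branches ε) :
    (F.relabel g).mapEdges f = (F.mapEdges f).relabel g := by
  induction F with
  | nil => rfl
  | cons e v A R ih1 ih2 => simp [mapEdges, relabel, ih1, ih2]

lemma mapEdges_const_number (d : δ) (F : Branches ε) (s : ℕ) :
    (F.number s).mapEdges (fun _ => d) = F.mapEdges fun _ => d := by
  induction F generalizing s with
  | nil => rfl
  | cons e v A R ih1 ih2 => simp [mapEdges, number, ih1, ih2]

lemma mapEdges_congr {f f' : ε → δ} {F : Branches ε} (H : ∀ e ∈ F.edges, f e = f' e) :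
    F.mapEdges f = F.mapEdges f' := by
  induction F with
  | nil => rfl
  | cons e v A R ih1 ih2 =>
    simp only [edges, List.mem_cons, List.mem_append] at H
    simp only [mapEdges, H e (Or.inl rfl), ih1 fun e h => H e (by tauto),
      ih2 fun e h => H e (by tauto)]

lemma edges_relabel (g : ℕ → ℕ) (F : Branches ε) : (F.relabel g).edges = F.edges := by
  induction F with
  | nil => rfl
  | cons e v A R ih1 ih2 => simp [edges, relabel, ih1, ih2]

lemma edges_mapEdges (f : ε → δ) (F : Branches ε) : (F.mapEdges f).edges = F.edges.map f := by
  induction F with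
  | nil => rfl
  | cons e v A R ih1 ih2 => simp [edges, mapEdges, ih1, ih2]

lemma toBr_relabel (g : ℕ → ℕ) (F : Branches ε) :
    F.toBr.op (fun a => {g a}) (fun _ => none) = (∅, (F.relabel g).toBr) := by
  induction F with
  | nil => rfl
  | cons e v A R ih1 ih2 =>
    rw [toBr, Br.op_cons_none rfl, ih1, ih2]
    cases v <;> simp [relabel, toBr]

/-- The numbers of incoming branches of all vertices in `F` add up to `F.size - F.length`, and each
of the `F.size - F.whites.length` black vertices lowers the degree by two. -/
lemma degree_add_length (F : Branches ε) :
    F.degree + F.length = 2 * F.whites.length - F.size := by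
  induction F with
  | nil => rfl
  | cons e v A R ih1 ih2 =>
    cases v <;> simp [degree, length, whites, size, vertexDegree] <;> omega

end Branches

namespace PTree

variable {ε δ γ : Type}

def toTr (T : PTree ε) : Tr ε := (T.root.toFinset, T.branches.toBr)

lemma toTr_injective : Function.Injective (toTr : PTree ε → Tr ε) := by
  rintro ⟨v, F⟩ ⟨v', F'⟩ h
  simp only [toTr, Prod.mk.injEq] at h
  obtain rfl := Branches.toBr_injective h.2
  cases v <;> cases v' <;> simp_all

@[simp] lemma edges_toTr (T : PTree ε) : T.toTr.edges = T.edges := Branches.edges_toBr _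

lemma toTr_mapEdges (f : ε → δ) (T : PTree ε) : (T.mapEdges f).toTr = T.toTr.mapE f := by
  simp [toTr, mapEdges, Tr.mapE, Branches.toBr_mapEdges]

lemma toTr_forget (T : PTree ε) : T.forget.toTr = T.toTr.forget := toTr_mapEdges _ _

lemma cnt_toTr (b : ℕ) (T : PTree ε) : T.toTr.cnt b = T.whites.count b := by
  simp [toTr, Tr.cnt, whites, ← Branches.ite_mem_toFinset]

lemma simple_toTr (T : PTree ε) : T.toTr.Simple :=
  ⟨by cases h : T.root <;> simp [toTr, h], Branches.simple_toBr _⟩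

lemma stable_toTr {T : PTree ε} :
    T.toTr.Stable ↔ (T.root = none → 2 ≤ T.branches.length) ∧ T.branches.Stable := by
  cases h : T.root <;> simp [Tr.Stable, toTr, h]

lemma exists_toTr_eq {S : Tr ε} (hS : S.Simple) : ∃ T : PTree ε, T.toTr = S := by
  obtain ⟨v, F⟩ := S
  obtain ⟨h1, h2⟩ := hS
  obtain ⟨G, rfl⟩ := Branches.exists_toBr_eq h2
  rcases Nat.le_one_iff_eq_zero_or_eq_one.1 h1 with h | h
  · exact ⟨⟨none, G⟩, by simp [toTr]; exact (Finset.card_eq_zero.1 h).symm⟩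
  · obtain ⟨a, h⟩ := Finset.card_eq_one.1 h
    exact ⟨⟨some a, G⟩, by simp [toTr]; exact h.symm⟩

lemma toTr_rot (T : PTree ε) : T.rot.toTr = T.toTr.rot := by
  obtain ⟨v, _ | ⟨e, w, A, R⟩⟩ := T
  · rfl
  · simp [rot, toTr, Branches.toBr]

lemma toTr_relabel (g : ℕ → ℕ) (T : PTree ε) :
    (T.relabel g).toTr = T.toTr.op (fun a => {g a}) fun _ => none := by
  obtain ⟨v, F⟩ := T
  simp only [toTr, relabel, Tr.op, Branches.toBr_relabel]
  cases v <;> simp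

lemma size_eq_length_edges (T : PTree ε) : T.size = T.edges.length :=
  T.branches.size_eq_length_edges

lemma edges_number (T : PTree ε) (s : ℕ) : (T.number s).edges = List.range' s T.size :=
  T.branches.edges_number s

lemma mapEdges_const_number (d : δ) (T : PTree ε) (s : ℕ) :
    (T.number s).mapEdges (fun _ => d) = T.mapEdges fun _ => d := by
  simp [mapEdges, number, Branches.mapEdges_const_number]

lemma mapEdges_congr {f f' : ε → δ} {T : PTree ε} (H : ∀ e ∈ T.edges, f e = f' e) :
    T.mapEdges f = T.mapEdges f' := by
  rw [mapEdges, mapEdges, Branches.mapEdges_congr H]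

lemma mapEdges_relabel (f : ε → δ) (g : ℕ → ℕ) (T : PTree ε) :
    (T.relabel g).mapEdges f = (T.mapEdges f).relabel g := by
  simp [mapEdges, relabel, Branches.mapEdges_relabel]

lemma edges_relabel (g : ℕ → ℕ) (T : PTree ε) : (T.relabel g).edges = T.edges :=
  Branches.edges_relabel _ _

lemma edges_mapEdges (f : ε → δ) (T : PTree ε) : (T.mapEdges f).edges = T.edges.map f :=
  Branches.edges_mapEdges _ _

lemma forget_unit (T : PTree Unit) : T.forget = T := by
  apply toTr_injective
  rw [toTr_forget, Tr.forget, Tr.mapE, show (fun _ : Unit => ()) = id from rfl, Br.mapE_id]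

lemma forget_number (T : PTree Unit) (s : ℕ) : (T.number s).forget = T :=
  (mapEdges_const_number () T s).trans T.forget_unit

lemma listSign_edges_number (T : PTree ε) (s : ℕ) : listSign (T.number s).edges = 1 :=
  listSign_of_sorted (by rw [edges_number]; exact List.pairwise_lt_range')

/-- For fixed `n` the grading thus counts edges: contracting one edge shifts the degree by one, and
the parity of the degree is that of the number of edges. -/
lemma degree_eq {n : ℕ} {T : PTree ε} (hT : T.whites.Perm (List.range n)) :
    T.degree = 2 * n - 2 - T.size := by
  have h := T.branches.degree_add_length
  have h2 := hT.length_eq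
  rw [List.length_range] at h2
  obtain ⟨_ | a, F⟩ := T <;> simp [degree, vertexDegree, size, whites] at * <;> omega

end PTree

/-! ## Coefficients -/

/-- The tree is rooted, with `n` white vertices; see `PTree.IsRooted`. -/
def Tr.IsRooted {ε : Type} (n : ℕ) (S : Tr ε) : Prop :=
  S.Simple ∧ (∀ b, S.cnt b = if b < n then 1 else 0) ∧ S.Stable

lemma Tr.isRooted_mapE {ε δ : Type} {n : ℕ} {S : Tr ε} (f : ε → δ) :
    (S.mapE f).IsRooted n ↔ S.IsRooted n := by
  simp only [Tr.IsRooted, Tr.cnt_mapE, Tr.simple_mapE, Tr.stable_mapE]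

lemma Tr.isRooted_forget {ε : Type} {n : ℕ} {S : Tr ε} : S.forget.IsRooted n ↔ S.IsRooted n :=
  Tr.isRooted_mapE _

lemma PTree.isRooted_toTr {ε : Type} {n : ℕ} {T : PTree ε} : T.toTr.IsRooted n ↔ T.IsRooted n := by
  simp only [Tr.IsRooted, PTree.IsRooted, stable_toTr, simple_toTr, true_and, cnt_toTr,
    List.perm_iff_count]
  refine and_congr_left fun _ => forall_congr' fun b => ?_
  rw [List.nodup_range.count]
  simp

lemma exists_rootedTree {n : ℕ} {S : Tr Unit} (hS : S.IsRooted n) :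
    ∃ T : RootedTree n, T.1.toTr = S := by
  obtain ⟨T, rfl⟩ := PTree.exists_toTr_eq hS.1
  exact ⟨⟨T, PTree.isRooted_toTr.1 hS⟩, rfl⟩

variable {k : Type*} [Field k]

/-- The coefficient of `x` at a tree with named edges, oriented by the order of the names. -/
def ev {n : ℕ} (S : Tr ℕ) : M k n →ₗ[k] k :=
  -- Pushing `x` forward along the injection `toTr` gives a coefficient at every tree with label
  -- sets; it is zero at trees that are not basis trees.
  (listSign S.edges : k) • Finsupp.lapply S.forget ∘ₗ
    Finsupp.lmapDomain k k (fun T : RootedTree n => T.1.toTr)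

lemma toTr_rootedTree_injective (n : ℕ) :
    Function.Injective (fun T : RootedTree n => T.1.toTr) :=
  PTree.toTr_injective.comp Subtype.val_injective

open Classical in
lemma ev_single {n : ℕ} (S : Tr ℕ) (T : RootedTree n) (c : k) :
    ev S (Finsupp.single T c) = if T.1.toTr = S.forget then (listSign S.edges : k) * c else 0 := by
  simp [ev, Finsupp.single_apply]

lemma ev_apply_rootedTree {n : ℕ} (x : M k n) {S : Tr ℕ} {T : RootedTree n}
    (h : S.forget = T.1.toTr) : ev S x = listSign S.edges * x T := by
  simp only [ev, LinearMap.smul_apply, LinearMap.comp_apply, Finsupp.lmapDomain_apply,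
    Finsupp.lapply_apply, h, smul_eq_mul]
  rw [Finsupp.mapDomain_apply (toTr_rootedTree_injective n)]

lemma ev_eq_zero {n : ℕ} (x : M k n) {S : Tr ℕ} (h : ¬ S.IsRooted n) : ev S x = 0 := by
  simp only [ev, LinearMap.smul_apply, LinearMap.comp_apply, Finsupp.lmapDomain_apply,
    Finsupp.lapply_apply, smul_eq_mul]
  rw [Finsupp.mapDomain_of_notMem_range, mul_zero]
  rintro ⟨T, hT⟩
  apply h
  rw [← Tr.isRooted_forget, ← hT]
  exact PTree.isRooted_toTr.2 T.2

lemma isRooted_of_ev_ne_zero {n : ℕ} {x : M k n} {S : Tr ℕ} (h : ev S x ≠ 0) : S.IsRooted n := by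
  by_contra hS; exact h (ev_eq_zero x hS)

lemma listSign_cast_mul_self (l : List ℕ) : (listSign l : k) * listSign l = 1 := by
  exact_mod_cast congrArg (Int.cast : ℤ → k) (listSign_mul_self l)

lemma ev_toTr_number {n : ℕ} (x : M k n) (T : RootedTree n) (s : ℕ) :
    ev (T.1.number s).toTr x = x T := by
  rw [ev_apply_rootedTree x (T := T), PTree.edges_toTr, PTree.listSign_edges_number]
  · simp
  · rw [← PTree.toTr_forget, PTree.forget_number]

lemma nodup_edges_number {ε : Type} (T : PTree ε) (s : ℕ) : (T.number s).toTr.edges.Nodup := by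
  rw [PTree.edges_toTr, PTree.edges_number]; exact List.nodup_range'

/-- At a basis tree whose edges are numbered in planar order, `ev` is the plain coefficient. -/
lemma ev_ext {n : ℕ} {x y : M k n} (h : ∀ S : Tr ℕ, S.edges.Nodup → ev S x = ev S y) : x = y := by
  ext T
  rw [← ev_toTr_number x T 0, ← ev_toTr_number y T 0]
  exact h _ (nodup_edges_number _ _)

lemma ev_mapE {n : ℕ} (x : M k n) {S : Tr ℕ} {f : ℕ → ℕ} :
    ev (S.mapE f) x = listSign (S.edges.map f) * listSign S.edges * ev S x := by
  simp only [ev, LinearMap.smul_apply, Tr.edges_mapE, Tr.forget_mapE, smul_eq_mul]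
  linear_combination -(listSign (S.edges.map f) : k) * (((Finsupp.lapply S.forget ∘ₗ
    Finsupp.lmapDomain k k (fun T : RootedTree n => T.1.toTr)) x : k)) *
    listSign_cast_mul_self (k := k) S.edges

lemma ofOriented_eq_single {n : ℕ} {T : PTree ℕ} {T₀ : RootedTree n} (h : T.forget = T₀.1) :
    ofOriented k n T = Finsupp.single T₀ (listSign T.edges : k) := by
  obtain ⟨_, h₀⟩ := T₀
  subst h
  exact dif_pos h₀

open Classical in
lemma ev_ofOriented {n : ℕ} (T : PTree ℕ) (S : Tr ℕ) :
    ev S (ofOriented k n T) = if S.IsRooted n ∧ T.toTr.forget = S.forget then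
      (listSign T.edges : k) * listSign S.edges else 0 := by
  by_cases hT : T.forget.IsRooted n
  · obtain ⟨T₀, hT₀⟩ : ∃ T₀ : RootedTree n, T.forget = T₀.1 := ⟨⟨_, hT⟩, rfl⟩
    rw [ofOriented_eq_single hT₀, ev_single, ← hT₀, ← PTree.toTr_forget]
    by_cases h : T.forget.toTr = S.forget
    · have : S.IsRooted n := by
        rw [← Tr.isRooted_forget, ← h]; exact PTree.isRooted_toTr.2 hT
      simp [h, this, mul_comm]
    · simp [h]
  · rw [ofOriented, dif_neg hT, map_zero, if_neg]
    rintro ⟨h1, h2⟩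
    rw [← Tr.isRooted_forget, ← h2, ← PTree.toTr_forget] at h1
    exact hT (PTree.isRooted_toTr.1 h1)

/-- Forests of the same shape have their edges matched in planar order; the names in `F` being
distinct, this matching is a function of the names. -/
lemma Br.exists_mapE_eq {ε δ : Type} [DecidableEq ε] [Inhabited δ] {F : Br ε} (hF : F.edges.Nodup)
    {G : Br δ} (h : F.mapE (fun _ => ()) = G.mapE fun _ => ()) : ∃ f : ε → δ, G = F.mapE f := by
  induction F generalizing G with
  | nil =>
    cases G with
    | nil => exact ⟨fun _ => default, rfl⟩
    | cons => simp [Br.mapE] at h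
  | cons e v A R ih1 ih2 =>
    cases G with
    | nil => simp [Br.mapE] at h
    | cons e' v' A' R' =>
      simp only [Br.mapE, Br.cons.injEq, true_and] at h
      obtain ⟨rfl, h1, h2⟩ := h
      simp only [Br.edges, List.nodup_cons, List.nodup_append, List.mem_append] at hF
      obtain ⟨he, hA, hR, hd⟩ := hF
      obtain ⟨f1, rfl⟩ := ih1 hA h1
      obtain ⟨f2, rfl⟩ := ih2 hR h2
      refine ⟨fun a => if a = e then e' else if a ∈ A.edges then f1 a else f2 a, ?_⟩
      simp only [Br.mapE, if_true, Br.cons.injEq, true_and]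
      constructor
      · refine Br.mapE_congr fun a ha => ?_
        rw [if_neg (by rintro rfl; tauto), if_pos ha]
      · refine Br.mapE_congr fun a ha => ?_
        rw [if_neg (by rintro rfl; tauto), if_neg fun h => hd a h a ha rfl]

lemma Tr.exists_mapE_eq {ε δ : Type} [DecidableEq ε] [Inhabited δ] {S : Tr ε} (hS : S.edges.Nodup)
    {R : Tr δ} (h : S.forget = R.forget) : ∃ f : ε → δ, R = S.mapE f := by
  obtain ⟨v, F⟩ := S
  obtain ⟨w, G⟩ := R
  simp only [Tr.forget, Tr.mapE, Prod.mk.injEq] at h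
  obtain ⟨rfl, h⟩ := h
  obtain ⟨f, rfl⟩ := Br.exists_mapE_eq hS h
  exact ⟨f, rfl⟩

lemma Br.edges_eq_of_mapE {ε δ : Type} {f f' : ε → δ} {F : Br ε} (h : F.mapE f = F.mapE f') :
    ∀ e ∈ F.edges, f e = f' e := by
  have := congrArg Br.edges h
  simpa using this

/-! ## Grafting branches and inserting trees -/

lemma nodup_flatMap_of_nodup {α β : Type*} {l : List α} {f : α → List β} (hl : l.Nodup)
    (h1 : ∀ x ∈ l, (f x).Nodup) (h2 : ∀ x ∈ l, ∀ y ∈ l, ∀ a, a ∈ f x → a ∈ f y → x = y) :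
    (l.flatMap f).Nodup := by
  rw [List.nodup_flatMap]
  refine ⟨h1, hl.imp_of_mem fun hx hy hne => ?_⟩
  exact fun a ha hb => hne (h2 _ hx _ hy a ha hb)

namespace Branches

variable {ε δ : Type}

lemma append_left_cancel {X Y Z : Branches ε} (h : X.append Y = X.append Z) : Y = Z := by
  induction X with
  | nil => exact h
  | cons e v A R _ ih => simp only [append, cons.injEq, true_and] at h; exact ih h

lemma mem_cuts {F X Y : Branches ε} : (X, Y) ∈ F.cuts ↔ X.append Y = F := by
  induction F generalizing X with
  | nil => cases X <;> simp [cuts, append]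
  | cons e v A R _ ih =>
    cases X with
    | nil => simp [cuts, append]
    | cons e' v' A' R' =>
      simp only [cuts, List.mem_cons, Prod.mk.injEq, reduceCtorEq, false_and, List.mem_map,
        cons.injEq, Prod.exists, false_or, append]
      constructor
      · rintro ⟨a, b, h, ⟨rfl, rfl, rfl, rfl⟩, rfl⟩; exact ⟨rfl, rfl, rfl, ih.1 h⟩
      · rintro ⟨rfl, rfl, rfl, h⟩; exact ⟨R', Y, ih.2 h, ⟨rfl, rfl, rfl, rfl⟩, rfl⟩

lemma mem_cuts₃ {F X Y Z : Branches ε} :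
    (X, Y, Z) ∈ F.cuts₃ ↔ X.append (Y.append Z) = F := by
  simp only [cuts₃, List.mem_flatMap, List.mem_map, Prod.mk.injEq, Prod.exists]
  constructor
  · rintro ⟨a, b, h, c, d, h', rfl, rfl, rfl⟩
    rw [mem_cuts.1 h', mem_cuts.1 h]
  · rintro rfl
    exact ⟨_, _, mem_cuts.2 rfl, Y, Z, mem_cuts.2 rfl, rfl, rfl, rfl⟩

lemma nodup_cuts (F : Branches ε) : F.cuts.Nodup := by
  induction F with
  | nil => simp [cuts]
  | cons e v A R _ ih =>
    rw [cuts, List.nodup_cons]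
    refine ⟨by simp, ih.map ?_⟩
    rintro ⟨a, b⟩ ⟨c, d⟩ h; simpa using h

lemma nodup_cuts₃ (F : Branches ε) : F.cuts₃.Nodup := by
  refine nodup_flatMap_of_nodup F.nodup_cuts
    (fun p _ => p.2.nodup_cuts.map ?_) ?_
  · rintro ⟨a, b⟩ ⟨c, d⟩ h; simpa using h
  · rintro ⟨a, b⟩ hp ⟨c, d⟩ hq x hx hy
    simp only [List.mem_map] at hx hy
    obtain ⟨_, _, rfl⟩ := hx
    obtain ⟨_, _, h⟩ := hy
    simp only [Prod.mk.injEq] at h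
    obtain ⟨rfl, _⟩ := h
    rw [append_left_cancel ((mem_cuts.1 hp).trans (mem_cuts.1 hq).symm)]

lemma mapEdges_append (f : ε → δ) (F G : Branches ε) :
    (F.append G).mapEdges f = (F.mapEdges f).append (G.mapEdges f) := by
  induction F with
  | nil => rfl
  | cons e v A R _ ih => simp [append, mapEdges, ih]

lemma cuts_mapEdges (f : ε → δ) (F : Branches ε) :
    (F.mapEdges f).cuts = F.cuts.map fun p => (p.1.mapEdges f, p.2.mapEdges f) := by
  induction F with
  | nil => rfl
  | cons e v A R _ ih => simp [cuts, mapEdges, ih, Function.comp_def]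

lemma cuts₃_mapEdges (f : ε → δ) (F : Branches ε) :
    (F.mapEdges f).cuts₃ =
      F.cuts₃.map fun p => (p.1.mapEdges f, p.2.1.mapEdges f, p.2.2.mapEdges f) := by
  simp [cuts₃, cuts_mapEdges, List.flatMap_map, List.map_flatMap, Function.comp_def]

/-- Grafting never inspects the names of edges. The names can therefore be replaced by two colors
that only record the origin of an edge, without changing the list of summands. -/
lemma spread_mapEdges (f : ε → δ) (B G : Branches ε) :
    spread (B.mapEdges f) (G.mapEdges f) = (spread B G).map (mapEdges f) := by
  induction G generalizing B with
  | nil => simp [spread, mapEdges]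
  | cons e v A R ih1 ih2 =>
    simp [spread, mapEdges, cuts₃_mapEdges, List.flatMap_map, List.map_flatMap, Function.comp_def,
      ih1, ih2, mapEdges_append]

lemma insert_mapEdges (f : ε → δ) (i : ℕ) (T : PTree ε) (F : Branches ε) :
    (F.mapEdges f).insert i (T.mapEdges f) = (F.insert i T).map (mapEdges f) := by
  induction F with
  | nil => rfl
  | cons e v A R ih1 ih2 =>
    simp only [mapEdges, insert]
    split_ifs
    · simp [PTree.mapEdges, spread_mapEdges, Function.comp_def, mapEdges]
    · simp [ih1, ih2, List.flatMap_map, List.map_flatMap, Function.comp_def, mapEdges]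

lemma whites_append (F G : Branches ε) : (F.append G).whites = F.whites ++ G.whites := by
  induction F with
  | nil => rfl
  | cons e v A R _ ih => simp [append, whites, ih]

lemma length_append (F G : Branches ε) : (F.append G).length = F.length + G.length := by
  simp [← length_toBr]

lemma stable_append {F G : Branches ε} : (F.append G).Stable ↔ F.Stable ∧ G.Stable := by
  simp [← stable_toBr]

lemma whites_of_mem_spread {B G F : Branches ε} (hF : F ∈ spread B G) :
    (F.whites : Multiset ℕ) = B.whites + G.whites := by
  induction G generalizing B F with
  | nil => simp only [spread, List.mem_singleton] at hF; simp [hF, whites]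
  | cons e v A R ih1 ih2 =>
    simp only [spread, List.mem_flatMap, List.mem_map] at hF
    obtain ⟨⟨X, Y, Z⟩, hp, A', hA, R', hR, rfl⟩ := hF
    rw [mem_cuts₃] at hp
    simp only [← hp, whites_append, whites, ← Multiset.coe_add, ih1 hA, ih2 hR]
    abel

/-- Each branch of `G` still starts at the same vertex after the grafting, so numbers of branches
only grow. -/
lemma stable_of_mem_spread {B G F : Branches ε} (hB : B.Stable) (hG : G.Stable)
    (hF : F ∈ spread B G) : F.Stable ∧ G.length ≤ F.length := by
  induction G generalizing B F with
  | nil => simp only [spread, List.mem_singleton] at hF; simp [hF, hB, length]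
  | cons e v A R ih1 ih2 =>
    simp only [spread, List.mem_flatMap, List.mem_map] at hF
    obtain ⟨⟨X, Y, Z⟩, hp, A', hA, R', hR, rfl⟩ := hF
    rw [mem_cuts₃] at hp
    rw [← hp, stable_append, stable_append] at hB
    have h1 := ih1 hB.2.1 hG.2.1 hA
    have h2 := ih2 hB.2.2 hG.2.2 hR
    refine ⟨stable_append.2 ⟨hB.1, fun hv => (hG.1 hv).trans h1.2, h1.1, h2.1⟩, ?_⟩
    simp only [length_append, length]; omega

/-- The recursion of `insert` combines results from all branches; as a label occurs in one place
only, this lemma removes the trivial factors. -/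
lemma insert_of_notMem {i : ℕ} (T : PTree ε) {H : Branches ε} (h : i ∉ H.whites) :
    H.insert i T = [H] := by
  induction H with
  | nil => rfl
  | cons e v A R ih1 ih2 =>
    simp only [whites, List.mem_append, not_or] at h
    have hv : v ≠ some i := by rintro rfl; simp at h
    simp [insert, hv, ih1 h.2.1, ih2 h.2.2]

lemma count_whites_cons (i : ℕ) (e : ε) (v : Option ℕ) (A R : Branches ε) :
    (cons e v A R).whites.count i =
      (if v = some i then 1 else 0) + A.whites.count i + R.whites.count i := by
  rw [whites, List.count_append, List.count_append, ← add_assoc]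
  congr 2
  cases v with
  | none => simp
  | some a => by_cases h : a = i <;> simp [h]

/-- The three places at which the only vertex with label `i` may be. -/
lemma mem_insert_cons {i : ℕ} {T : PTree ε} {e : ε} {v : Option ℕ} {A R F : Branches ε}
    (hi : (cons e v A R).whites.count i = 1) : F ∈ (cons e v A R).insert i T ↔
      (v = some i ∧ i ∉ A.whites ∧ i ∉ R.whites ∧
        ∃ A' ∈ A.spread T.branches, F = cons e T.root A' R) ∨
      (v ≠ some i ∧ A.whites.count i = 1 ∧ i ∉ R.whites ∧ ∃ A' ∈ A.insert i T, F = cons e v A' R) ∨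
      (v ≠ some i ∧ i ∉ A.whites ∧ R.whites.count i = 1 ∧ ∃ R' ∈ R.insert i T, F = cons e v A R')
      := by
  rw [count_whites_cons] at hi
  simp only [← List.count_eq_zero]
  by_cases hv : v = some i
  · subst hv
    simp only [if_true] at hi
    have h1 : A.whites.count i = 0 := by omega
    have h2 : R.whites.count i = 0 := by omega
    simp [insert, h1, h2, eq_comm]
  · simp only [hv, if_false, zero_add] at hi
    by_cases hA : A.whites.count i = 0
    · have h2 : R.whites.count i = 1 := by omega
      simp [insert, hv, hA, h2, insert_of_notMem T (List.count_eq_zero.1 hA), eq_comm]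
    · have h1 : A.whites.count i = 1 := by omega
      have h2 : R.whites.count i = 0 := by omega
      simp [insert, hv, h1, h2, insert_of_notMem T (List.count_eq_zero.1 h2), eq_comm]

/-- The replaced vertex loses its label. The summand `{i}` on the left avoids a subtraction of
multisets, also when `T` contributes the label `i` anew. -/
lemma whites_of_mem_insert {i : ℕ} {T : PTree ε} {H F : Branches ε} (hi : H.whites.count i = 1)
    (hF : F ∈ H.insert i T) : (F.whites : Multiset ℕ) + {i} = H.whites + T.whites := by
  induction H generalizing F with
  | nil => simp [whites] at hi
  | cons e v A R ih1 ih2 =>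
    rcases (mem_insert_cons hi).1 hF with ⟨rfl, h1, h2, A', hA, rfl⟩ | ⟨hv, h1, h2, A', hA, rfl⟩ |
      ⟨hv, h1, h2, R', hR, rfl⟩
    · simp only [whites, ← Multiset.coe_add, whites_of_mem_spread hA, PTree.whites]
      simp only [Option.toList, Multiset.coe_singleton]
      abel
    · have := ih1 h1 hA
      simp only [whites, ← Multiset.coe_add]
      rw [show (v.toList : Multiset ℕ) + (A'.whites + R.whites) + {i} =
        v.toList + (A'.whites + {i} + R.whites) by abel, this]
      abel
    · have := ih2 h2 hR
      simp only [whites, ← Multiset.coe_add]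
      rw [show (v.toList : Multiset ℕ) + (A.whites + R'.whites) + {i} =
        v.toList + (A.whites + (R'.whites + {i})) by abel, this]
      abel

lemma length_of_mem_insert {i : ℕ} {T : PTree ε} {H F : Branches ε} (hi : H.whites.count i = 1)
    (hF : F ∈ H.insert i T) : F.length = H.length := by
  induction H generalizing F with
  | nil => simp [whites] at hi
  | cons e v A R ih1 ih2 =>
    rcases (mem_insert_cons hi).1 hF with ⟨rfl, h1, h2, A', hA, rfl⟩ | ⟨hv, h1, h2, A', hA, rfl⟩ |
      ⟨hv, h1, h2, R', hR, rfl⟩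
    · rfl
    · rfl
    · simp [length, ih2 h2 hR]

lemma stable_of_mem_insert {i : ℕ} {T : PTree ε} {H F : Branches ε} (hi : H.whites.count i = 1)
    (hH : H.Stable) (hT : (T.root = none → 2 ≤ T.branches.length) ∧ T.branches.Stable)
    (hF : F ∈ H.insert i T) : F.Stable := by
  induction H generalizing F with
  | nil => simp [whites] at hi
  | cons e v A R ih1 ih2 =>
    rcases (mem_insert_cons hi).1 hF with ⟨rfl, h1, h2, A', hA, rfl⟩ | ⟨hv, h1, h2, A', hA, rfl⟩ |
      ⟨hv, h1, h2, R', hR, rfl⟩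
    · have := stable_of_mem_spread hH.2.1 hT.2 hA
      exact ⟨fun h => (hT.1 h).trans this.2, this.1, hH.2.2⟩
    · exact ⟨fun h => length_of_mem_insert h1 hA ▸ hH.1 h, ih1 h1 hH.2.1 hA, hH.2.2⟩
    · exact ⟨hH.1, hH.2.1, ih2 h2 hH.2.2 hR⟩

end Branches

namespace PTree

variable {ε δ : Type}

lemma insert_mapEdges (f : ε → δ) (i : ℕ) (T T' : PTree ε) :
    (T.mapEdges f).insert i (T'.mapEdges f) = (T.insert i T').map (mapEdges f) := by
  simp only [insert, mapEdges, Branches.spread_mapEdges]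
  split_ifs
  · simp only [List.map_map]; rfl
  · have := Branches.insert_mapEdges f i T' T.branches
    simp only [mapEdges] at this
    simp only [this, List.map_map]; rfl

lemma count_whites (i : ℕ) (T : PTree ε) :
    T.whites.count i = (if T.root = some i then 1 else 0) + T.branches.whites.count i := by
  rw [whites, List.count_append]
  congr 1
  cases T.root with
  | none => simp
  | some a => by_cases h : a = i <;> simp [h]

lemma whites_of_mem_insert {i : ℕ} {T T' R : PTree ε} (hi : T.whites.count i = 1)
    (hR : R ∈ T.insert i T') : (R.whites : Multiset ℕ) + {i} = T.whites + T'.whites := by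
  obtain ⟨v, H⟩ := T
  rw [count_whites] at hi
  simp only at hi
  by_cases hv : v = some i
  · subst hv
    simp only [insert, if_true, List.mem_map] at hR
    obtain ⟨F, hF, rfl⟩ := hR
    simp only [whites, ← Multiset.coe_add, Branches.whites_of_mem_spread hF, Option.toList,
      Multiset.coe_singleton]
    abel
  · simp only [insert, hv, if_false, List.mem_map] at hR
    obtain ⟨F, hF, rfl⟩ := hR
    have := Branches.whites_of_mem_insert (by simpa [hv] using hi) hF
    simp only [whites, ← Multiset.coe_add] at this ⊢
    rw [add_assoc, this]; abel

lemma stable_of_mem_insert {i : ℕ} {T T' R : PTree ε} (hi : T.whites.count i = 1)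
    (hT : T.toTr.Stable) (hT' : T'.toTr.Stable) (hR : R ∈ T.insert i T') : R.toTr.Stable := by
  rw [stable_toTr] at *
  obtain ⟨v, H⟩ := T
  rw [count_whites] at hi
  simp only at hi hT
  by_cases hv : v = some i
  · simp only [insert, hv, if_true, List.mem_map] at hR
    obtain ⟨F, hF, rfl⟩ := hR
    have := Branches.stable_of_mem_spread hT.2 hT'.2 hF
    exact ⟨fun h => (hT'.1 h).trans this.2, this.1⟩
  · simp only [insert, hv, if_false, List.mem_map] at hR
    obtain ⟨F, hF, rfl⟩ := hR
    have hi : H.whites.count i = 1 := by simpa [hv] using hi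
    exact ⟨fun h => Branches.length_of_mem_insert hi hF ▸ hT.1 h,
      Branches.stable_of_mem_insert hi hT.2 hT' hF⟩

end PTree

/-! ## Insertions and contractions -/

/-- The label `i` absorbs the labels in the block `i, …, i + m - 1`. -/
def collapseBlock (i m a : ℕ) : Finset ℕ := {if i ≤ a ∧ a < i + m then i else a}

/-- Labels outside the block `i, …, i + m - 1` are removed. -/
def keepBlock (i m a : ℕ) : Finset ℕ := if i ≤ a ∧ a < i + m then {a} else ∅

/-- Contract the edges of color `true`, and mark the vertices obtained in this way by `i`. -/
def contractTrue (i : ℕ) (b : Bool) : Option (Finset ℕ) := if b then some {i} else none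

/-- Contract the edges of color `false`. -/
def contractFalse (b : Bool) : Option (Finset ℕ) := if b then none else some ∅

/-! ### Two-colored forests and the contraction of either color -/

namespace Br

variable {i m : ℕ}

/-- Color `false` is for edges of the host, color `true` for edges of the inserted tree. Each
contracted edge leaves the mark `i`, so the place of the inserted tree stays visible even where all
its vertices are black. -/
abbrev outer (i m : ℕ) (F : Br Bool) : Finset ℕ × Br Bool :=
  F.op (collapseBlock i m) (contractTrue i)

abbrev inner (i m : ℕ) (F : Br Bool) : Finset ℕ × Br Bool :=
  F.op (keepBlock i m) contractFalse

lemma outer_false (v A R) : outer i m (cons false v A R) = ((outer i m R).1,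
    cons false (v.biUnion (collapseBlock i m) ∪ (outer i m A).1) (outer i m A).2 (outer i m R).2) :=
  rfl

lemma outer_true (v A R) : outer i m (cons true v A R) =
    ({i} ∪ (v.biUnion (collapseBlock i m) ∪ (outer i m A).1) ∪ (outer i m R).1,
      (outer i m A).2.app (outer i m R).2) := rfl

lemma outer_app (F G : Br Bool) : outer i m (F.app G) =
    ((outer i m F).1 ∪ (outer i m G).1, (outer i m F).2.app (outer i m G).2) := op_app F G

lemma inner_app (F G : Br Bool) : inner i m (F.app G) =
    ((inner i m F).1 ∪ (inner i m G).1, (inner i m F).2.app (inner i m G).2) := op_app F G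

lemma inner_true (v A R) : inner i m (cons true v A R) = ((inner i m R).1,
    cons true (v.biUnion (keepBlock i m) ∪ (inner i m A).1) (inner i m A).2 (inner i m R).2) :=
  rfl

lemma inner_false (v A R) : inner i m (cons false v A R) =
    (v.biUnion (keepBlock i m) ∪ (inner i m A).1 ∪ (inner i m R).1,
      (inner i m A).2.app (inner i m R).2) := by
  simp [inner, op, contractFalse]

/-- Labels only reach the base along edges of color `true`, and each of these leaves the mark `i`.
-/
lemma outer_fst_eq_empty_or (F : Br Bool) : (outer i m F).1 = ∅ ∨ i ∈ (outer i m F).1 := by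
  induction F with
  | nil => exact Or.inl rfl
  | cons e v A R _ ih =>
    cases e
    · exact ih
    · right; simp [outer_true]

/-- All labels of the block are sent to `i`, so the absence of `i` afterwards means the absence of
the block before. -/
lemma notMem_block {v : Finset ℕ} (h : i ∉ v.biUnion (collapseBlock i m)) :
    v.biUnion (collapseBlock i m) = v ∧ v.biUnion (keepBlock i m) = ∅ := by
  have hb : ∀ a ∈ v, ¬ (i ≤ a ∧ a < i + m) := fun a ha hab => by
    apply h; simp only [collapseBlock, Finset.mem_biUnion]; exact ⟨a, ha, by simp [hab]⟩
  constructor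
  · ext b
    simp only [collapseBlock, Finset.mem_biUnion]
    constructor
    · rintro ⟨a, ha, h⟩; rw [if_neg (hb a ha), Finset.mem_singleton] at h; exact h ▸ ha
    · intro hbv; exact ⟨b, hbv, by simp [hb b hbv]⟩
  · ext b
    simp only [keepBlock, Finset.mem_biUnion, Finset.notMem_empty, iff_false, not_exists, not_and]
    intro a ha
    simp [hb a ha]

lemma biUnion_keepBlock_of_subset (hm : 0 < m) {v : Finset ℕ}
    (h : v.biUnion (collapseBlock i m) ⊆ {i}) : v.biUnion (keepBlock i m) = v := by
  have hb : ∀ a ∈ v, i ≤ a ∧ a < i + m := fun a ha => by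
    by_contra hab
    have : a ∈ v.biUnion (collapseBlock i m) := by
      simp only [collapseBlock, Finset.mem_biUnion]; exact ⟨a, ha, by simp [hab]⟩
    have := Finset.mem_singleton.1 (h this)
    omega
  ext b
  simp only [keepBlock, Finset.mem_biUnion]
  constructor
  · rintro ⟨a, ha, h⟩; rw [if_pos (hb a ha), Finset.mem_singleton] at h; exact h ▸ ha
  · intro hbv; exact ⟨b, hbv, by simp [hb b hbv]⟩

/-- If the label `i` only occurs at the base after the contraction of the edges of color `true`,
there are no such edges except at the base. -/
lemma outer_eq_self {F : Br Bool} (h1 : (outer i m F).2.cnt i = 0) (h2 : i ∉ (outer i m F).1) :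
    outer i m F = (∅, F) ∧ inner i m F = (∅, nil) := by
  induction F with
  | nil => exact ⟨rfl, rfl⟩
  | cons e v A R ih1 ih2 =>
    cases e
    · simp only [outer_false, cnt, Nat.add_eq_zero_iff, ite_eq_right_iff, Finset.mem_union] at h1 h2
      simp only [one_ne_zero, imp_false, not_or] at h1
      obtain ⟨⟨⟨hv, hA⟩, hA'⟩, hR⟩ := h1
      have hA := ih1 hA' hA
      have hR := ih2 hR h2
      have hv := notMem_block hv
      simp [outer_false, inner_false, hA, hR, hv]
    · simp [outer_true] at h2

/-- A label that reaches the base here sits above edges of color `false` only, hence on a vertex of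
the outer forest other than the base, where it would show up as `i`. -/
lemma inner_fst_eq_empty {F : Br Bool} (h1 : (outer i m F).2.cnt i = 0) :
    (inner i m F).1 = ∅ := by
  induction F with
  | nil => rfl
  | cons e v A R ih1 ih2 =>
    cases e
    · simp only [outer_false, cnt, Nat.add_eq_zero_iff, ite_eq_right_iff, Finset.mem_union] at h1
      simp only [one_ne_zero, imp_false, not_or] at h1
      obtain ⟨⟨⟨hv, hA⟩, hA'⟩, hR⟩ := h1
      simp [inner_false, outer_eq_self hA' hA, ih2 hR, notMem_block hv]
    · simp only [outer_true, cnt_app, Nat.add_eq_zero_iff] at h1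
      simp [inner_true, ih2 h1.2]

/-- Without edges of color `true` nothing carries a label to the base. -/
lemma notMem_outer_of_inner {F : Br Bool} (h : inner i m F = (∅, nil)) : i ∉ (outer i m F).1 := by
  induction F with
  | nil => simp
  | cons e v A R ih1 ih2 =>
    cases e
    · rw [inner_false, Prod.mk.injEq, Finset.union_eq_empty] at h
      refine ih2 (Prod.ext h.1.2 ?_)
      have := congrArg length h.2
      rw [length_app] at this
      cases hR : (inner i m R).2 with
      | nil => rfl
      | cons => simp [hR, length] at this
    · simp [inner_true] at h

/-- Split off the branches before the first edge of color `true`. -/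
lemma exists_eq_app {F G₁ G₂ : Br Bool} {v : Finset ℕ} (h1 : (outer i m F).2.cnt i = 0)
    (h2 : inner i m F = (∅, cons true v G₁ G₂)) : ∃ X v' A R, F = X.app (cons true v' A R) ∧
      outer i m X = (∅, X) ∧ inner i m X = (∅, nil) ∧
      inner i m (cons true v' A R) = (∅, cons true v G₁ G₂) := by
  induction F with
  | nil => simp at h2
  | cons e u A R ih1 ih2 =>
    cases e
    · simp only [outer_false, cnt, Nat.add_eq_zero_iff, ite_eq_right_iff, Finset.mem_union] at h1
      simp only [one_ne_zero, imp_false, not_or] at h1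
      obtain ⟨⟨⟨hv, hA⟩, hA'⟩, hR⟩ := h1
      have hA := outer_eq_self hA' hA
      have hv := notMem_block hv
      rw [inner_false, hv.2, hA.2] at h2
      simp only [Finset.empty_union, nil_app] at h2
      obtain ⟨X, v', A', R', rfl, hX, hX', h⟩ := ih2 hR h2
      refine ⟨cons false u A X, v', A', R', rfl, ?_, ?_, h⟩
      · simp [outer_false, hA.1, hX, hv.1]
      · simp [inner_false, hA.2, hX', hv.2]
    · exact ⟨nil, u, A, R, rfl, rfl, rfl, h2⟩

end Br

/-! ### Graftings and insertions recovered from their contractions -/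

namespace Branches

variable {i m : ℕ}

lemma exists_append_of_toBr_eq {ε : Type} {B : Branches ε} {X Y : Br ε} (h : B.toBr = X.app Y) :
    ∃ B₁ B₂ : Branches ε, B = B₁.append B₂ ∧ B₁.toBr = X ∧ B₂.toBr = Y := by
  induction X generalizing B with
  | nil => exact ⟨nil, B, rfl, rfl, h⟩
  | cons e v A R _ ih =>
    cases B with
    | nil => simp [toBr] at h
    | cons e' v' A' R' =>
      simp only [toBr, Br.cons_app, Br.cons.injEq] at h
      obtain ⟨rfl, rfl, rfl, h⟩ := h
      obtain ⟨B₁, B₂, rfl, rfl, rfl⟩ := ih h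
      exact ⟨cons e' v' A' B₁, B₂, rfl, rfl, rfl⟩

/-- All edges have the color `c`, and all labels satisfy `p`. -/
def IsColored (c : Bool) (p : ℕ → Prop) (F : Branches Bool) : Prop :=
  (∀ e ∈ F.edges, e = c) ∧ ∀ a ∈ F.whites, p a

lemma isColored_cons {c : Bool} {p : ℕ → Prop} {e v A R} : IsColored c p (cons e v A R) ↔
    e = c ∧ (∀ a ∈ v, p a) ∧ IsColored c p A ∧ IsColored c p R := by
  simp only [IsColored, edges, whites, List.mem_cons, List.mem_append, Option.mem_toList,
    or_imp, forall_and, Option.mem_def, forall_eq]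
  tauto

/-- All edges have the color `false`, and no label belongs to the block. -/
abbrev IsOuter (i m : ℕ) : Branches Bool → Prop := IsColored false fun a => ¬ (i ≤ a ∧ a < i + m)

/-- All edges have the color `false`, and `i` is the only label that belongs to the block. -/
abbrev IsHost (i m : ℕ) : Branches Bool → Prop :=
  IsColored false fun a => (i ≤ a ∧ a < i + m) → a = i

/-- All edges have the color `true`, and all labels belong to the block. -/
abbrev IsInner (i m : ℕ) : Branches Bool → Prop := IsColored true fun a => i ≤ a ∧ a < i + m

lemma isOuter_append {F G : Branches Bool} :
    IsOuter i m (F.append G) ↔ IsOuter i m F ∧ IsOuter i m G := by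
  induction F with
  | nil => simp [IsColored, append, edges, whites]
  | cons e v A R _ ih => simp only [append, isColored_cons, ih, and_assoc]

lemma isOuter_of_isHost {F : Branches Bool} (h : IsHost i m F) (hi : i ∉ F.whites) :
    IsOuter i m F :=
  ⟨h.1, fun a ha hab => hi (h.2 a ha hab ▸ ha)⟩

lemma biUnion_keepBlock {v : Option ℕ} (h : ∀ a ∈ v, i ≤ a ∧ a < i + m) :
    v.toFinset.biUnion (keepBlock i m) = v.toFinset ∧
      v.toFinset.biUnion (collapseBlock i m) ⊆ {i} := by
  cases v with
  | none => simp
  | some a =>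
    have := h a rfl
    simp [keepBlock, collapseBlock, this]

lemma biUnion_collapseBlock {v : Option ℕ} (h : ∀ a ∈ v, (i ≤ a ∧ a < i + m) → a = i) :
    v.toFinset.biUnion (collapseBlock i m) = v.toFinset := by
  cases v with
  | none => simp
  | some a =>
    have := h a rfl
    by_cases h' : i ≤ a ∧ a < i + m
    · simp [collapseBlock, this h']
    · simp [collapseBlock, h']

lemma biUnion_keepBlock_eq_empty {v : Option ℕ} (h : ∀ a ∈ v, ¬ (i ≤ a ∧ a < i + m)) :
    v.toFinset.biUnion (keepBlock i m) = ∅ := by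
  cases v with
  | none => simp
  | some a => simp [keepBlock, h a rfl]

lemma outer_eq_of_isOuter {F : Branches Bool} (h : IsOuter i m F) :
    Br.outer i m F.toBr = (∅, F.toBr) ∧ Br.inner i m F.toBr = (∅, .nil) := by
  induction F with
  | nil => exact ⟨rfl, rfl⟩
  | cons e v A R ih1 ih2 =>
    obtain ⟨rfl, hv, hA, hR⟩ := isColored_cons.1 h
    simp [toBr, Br.outer_false, Br.inner_false, ih1 hA, ih2 hR, biUnion_keepBlock_eq_empty hv,
      biUnion_collapseBlock fun a ha hab => absurd hab (hv a ha)]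

lemma cnt_eq_zero_of_isOuter (hm : 0 < m) {F : Branches Bool} (h : IsOuter i m F) :
    F.toBr.cnt i = 0 := by
  rw [cnt_toBr, List.count_eq_zero]
  exact fun hi => h.2 i hi ⟨le_rfl, by omega⟩

/-- By induction on `G`: contracting the inserted edges closes the gaps between the pieces of `B`,
and contracting the pieces of `B` restores `G`. What reaches the base is a label of the block or a
mark, hence only `i`. -/
lemma outer_of_mem_spread {B G F : Branches Bool} (hB : IsOuter i m B) (hG : IsInner i m G)
    (hF : F ∈ spread B G) : (Br.outer i m F.toBr).2 = B.toBr ∧ (Br.outer i m F.toBr).1 ⊆ {i} ∧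
      Br.inner i m F.toBr = (∅, G.toBr) := by
  induction G generalizing B F with
  | nil =>
    simp only [spread, List.mem_singleton] at hF
    subst hF
    simp [outer_eq_of_isOuter hB, toBr]
  | cons e v A R ih1 ih2 =>
    simp only [spread, List.mem_flatMap, List.mem_map] at hF
    obtain ⟨⟨X, Y, Z⟩, hp, A', hA, R', hR, rfl⟩ := hF
    rw [mem_cuts₃] at hp
    subst hp
    rw [isOuter_append, isOuter_append] at hB
    obtain ⟨rfl, hv, hA', hR'⟩ := isColored_cons.1 hG
    obtain ⟨a1, a2, a3⟩ := ih1 hB.2.1 hA' hA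
    obtain ⟨r1, r2, r3⟩ := ih2 hB.2.2 hR' hR
    obtain ⟨x1, x2⟩ := outer_eq_of_isOuter hB.1
    obtain ⟨v1, v2⟩ := biUnion_keepBlock hv
    rw [toBr_append, Br.outer_app, Br.inner_app, x1, x2, toBr, Br.outer_true, Br.inner_true, a1,
      a3, r1, r3, v1]
    refine ⟨by simp, ?_, by simp [toBr]⟩
    simp only [Finset.empty_union]
    exact Finset.union_subset (Finset.union_subset subset_rfl (Finset.union_subset v2 a2)) r2

/-- By induction on `G`. The first edge of color `true` at the base cuts `F`; the outer contraction
`B` is thereby cut into the segments before, above and after this edge, which is the cut used in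
`spread`. -/
lemma exists_mem_spread (hm : 0 < m) {B G : Branches Bool} {F : Br Bool} (hB : IsOuter i m B)
    (hG : IsInner i m G) (h1 : (Br.outer i m F).2 = B.toBr) (h2 : (Br.outer i m F).1 ⊆ {i})
    (h3 : Br.inner i m F = (∅, G.toBr)) : ∃ R ∈ B.spread G, R.toBr = F := by
  induction G generalizing B F with
  | nil =>
    refine ⟨B, by simp [spread], ?_⟩
    have := Br.outer_eq_self (h1 ▸ cnt_eq_zero_of_isOuter hm hB) (Br.notMem_outer_of_inner h3)
    rw [← h1, this.1]
  | cons e v A R ih1 ih2 =>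
    obtain ⟨rfl, hv, hA', hR'⟩ := isColored_cons.1 hG
    obtain ⟨X, u, A', R', rfl, hX, hX', h⟩ := Br.exists_eq_app (h1 ▸ cnt_eq_zero_of_isOuter hm hB) h3
    rw [Br.outer_app, Br.outer_true, hX] at h1 h2
    simp only [Finset.empty_union, Finset.union_subset_iff] at h2
    obtain ⟨B₁, B', rfl, rfl, hB'⟩ := exists_append_of_toBr_eq h1.symm
    obtain ⟨B₂, B₃, rfl, hB₂, hB₃⟩ := exists_append_of_toBr_eq hB'
    rw [isOuter_append, isOuter_append] at hB
    rw [Br.inner_true, Prod.mk.injEq, Br.cons.injEq] at h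
    obtain ⟨hR0, -, hv', hA2, hR2⟩ := h
    have hA0 := Br.inner_fst_eq_empty (hB₂ ▸ cnt_eq_zero_of_isOuter hm hB.2.1)
    rw [hA0, Finset.union_empty, Br.biUnion_keepBlock_of_subset hm h2.1.2.1] at hv'
    obtain ⟨A₁, hA₁, rfl⟩ := ih1 hB.2.1 hA' hB₂.symm h2.1.2.2 (Prod.ext hA0 hA2)
    obtain ⟨R₁, hR₁, rfl⟩ := ih2 hB.2.2 hR' hB₃.symm h2.2 (Prod.ext hR0 hR2)
    refine ⟨B₁.append (cons true v A₁ R₁), ?_, by simp [toBr, hv']⟩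
    simp only [spread, List.mem_flatMap, List.mem_map]
    exact ⟨(B₁, B₂, B₃), mem_cuts₃.2 rfl, A₁, hA₁, R₁, hR₁, rfl⟩

/-- The first occurrence of the edge `e₀` at the base marks the place of the cut. -/
lemma append_cons_inj {ε : Type} {e₀ : ε} {X X' A R A' R' : Branches ε} {v v' : Option ℕ}
    (hX : e₀ ∉ X.edges) (hX' : e₀ ∉ X'.edges)
    (h : X.append (cons e₀ v A R) = X'.append (cons e₀ v' A' R')) :
    X = X' ∧ cons e₀ v A R = cons e₀ v' A' R' := by
  induction X generalizing X' with
  | nil =>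
    cases X' with
    | nil => exact ⟨rfl, h⟩
    | cons e' =>
      simp only [append, cons.injEq] at h
      simp [edges, h.1] at hX'
  | cons e _ _ _ _ ih =>
    cases X' with
    | nil =>
      simp only [append, cons.injEq] at h
      simp [edges, h.1] at hX
    | cons e' =>
      simp only [append, cons.injEq] at h
      obtain ⟨rfl, rfl, rfl, h⟩ := h
      simp only [edges, List.mem_cons, List.mem_append, not_or] at hX hX'
      obtain ⟨rfl, hc⟩ := ih hX.2.2 hX'.2.2 h
      exact ⟨rfl, hc⟩

/-- A grafting remembers how it was made: the first inserted edge shows where the first segment of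
`B` ends, and the outer contractions above and after that edge return the other two segments. -/
lemma nodup_spread {B G : Branches Bool} (hB : IsOuter i m B) (hG : IsInner i m G) :
    (B.spread G).Nodup := by
  induction G generalizing B with
  | nil => simp [spread]
  | cons e v A R ih1 ih2 =>
    obtain ⟨rfl, hv, hA, hR⟩ := isColored_cons.1 hG
    have hO : ∀ p ∈ B.cuts₃, IsOuter i m p.1 ∧ IsOuter i m p.2.1 ∧ IsOuter i m p.2.2 := by
      rintro ⟨X, Y, Z⟩ hp
      rw [← mem_cuts₃.1 hp, isOuter_append, isOuter_append] at hB
      exact hB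
    rw [spread]
    refine nodup_flatMap_of_nodup B.nodup_cuts₃ (fun p hp => ?_) ?_
    · refine nodup_flatMap_of_nodup (ih1 (hO p hp).2.1 hA) (fun A' _ => ?_) ?_
      · refine (ih2 (hO p hp).2.2 hR).map fun x y h => ?_
        simpa using append_left_cancel h
      · intro A₁ _ A₂ _ F h₁ h₂
        simp only [List.mem_map] at h₁ h₂
        obtain ⟨_, _, rfl⟩ := h₁
        obtain ⟨_, _, h⟩ := h₂
        have := append_left_cancel h
        simp only [cons.injEq, true_and] at this
        exact this.1.symm
    · rintro ⟨X, Y, Z⟩ hp ⟨X', Y', Z'⟩ hp' F h h'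
      simp only [List.mem_flatMap, List.mem_map] at h h'
      obtain ⟨A₁, hA₁, R₁, hR₁, rfl⟩ := h
      obtain ⟨A₂, hA₂, R₂, hR₂, h⟩ := h'
      have hX := append_cons_inj (fun ht => Bool.noConfusion ((hO _ hp').1.1 _ ht))
        (fun ht => Bool.noConfusion ((hO _ hp).1.1 _ ht)) h
      obtain ⟨rfl, hc⟩ := hX
      simp only [cons.injEq, true_and] at hc
      obtain ⟨rfl, rfl⟩ := hc
      have e1 := (outer_of_mem_spread (hO _ hp).2.1 hA hA₁).1
      rw [(outer_of_mem_spread (hO _ hp').2.1 hA hA₂).1] at e1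
      have e2 := (outer_of_mem_spread (hO _ hp).2.2 hR hR₁).1
      rw [(outer_of_mem_spread (hO _ hp').2.2 hR hR₂).1] at e2
      exact Prod.ext rfl (Prod.ext (toBr_injective e1).symm (toBr_injective e2).symm)

/-- If the root of `T` is white, its label collapses to `i`. If it is black, `T` has an edge, and
the contraction of this edge leaves the mark `i`. -/
lemma outer_root_eq {T : PTree Bool} {B F : Branches Bool} (hm : 0 < m)
    (hv : ∀ a ∈ T.root, i ≤ a ∧ a < i + m) (hT : IsInner i m T.branches)
    (hT0 : T.root = none → T.branches ≠ nil) (hB : IsOuter i m B) (hF : F ∈ B.spread T.branches) :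
    T.root.toFinset.biUnion (collapseBlock i m) ∪ (Br.outer i m F.toBr).1 = {i} := by
  obtain ⟨a1, a2, a3⟩ := outer_of_mem_spread hB hT hF
  refine (Finset.union_subset (biUnion_keepBlock hv).2 a2).antisymm ?_
  rw [Finset.singleton_subset_iff, Finset.mem_union]
  cases hr : T.root with
  | some a => left; simp [collapseBlock, hv a hr]
  | none =>
    right
    refine (Br.outer_fst_eq_empty_or _).resolve_left fun h => hT0 hr (toBr_injective ?_)
    have h1 := (Br.outer_eq_self (a1 ▸ cnt_eq_zero_of_isOuter hm hB) (h ▸ Finset.notMem_empty i)).2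
    rw [h1] at a3
    exact (Prod.mk.inj a3).2.symm

lemma outer_of_mem_insert {T : PTree Bool} {H F : Branches Bool}
    (hH : IsHost i m H) (hi : H.whites.count i = 1) (hm : 0 < m)
    (hv : ∀ a ∈ T.root, i ≤ a ∧ a < i + m) (hT : IsInner i m T.branches)
    (hT0 : T.root = none → T.branches ≠ nil) (hF : F ∈ H.insert i T) :
    Br.outer i m F.toBr = (∅, H.toBr) ∧ Br.inner i m F.toBr = T.toTr := by
  induction H generalizing F with
  | nil => simp [whites] at hi
  | cons e v A R ih1 ih2 =>
    obtain ⟨rfl, hv', hA', hR'⟩ := isColored_cons.1 hH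
    rcases (mem_insert_cons hi).1 hF with ⟨rfl, h1, h2, A', hA, rfl⟩ | ⟨hv, h1, h2, A', hA, rfl⟩ |
      ⟨hv, h1, h2, R', hR, rfl⟩
    · obtain ⟨a1, a2, a3⟩ := outer_of_mem_spread (isOuter_of_isHost hA' h1) hT hA
      obtain ⟨r1, r2⟩ := outer_eq_of_isOuter (isOuter_of_isHost hR' h2)
      obtain ⟨v1, v2⟩ := biUnion_keepBlock hv
      have : T.root.toFinset.biUnion (collapseBlock i m) ∪ (Br.outer i m A'.toBr).1 = {i} := by
        exact outer_root_eq hm hv hT hT0 (isOuter_of_isHost hA' h1) hA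
      rw [toBr, toBr, Br.outer_false, Br.inner_false, r1, r2, a1, a3, v1, this]
      simp [PTree.toTr]
    · obtain ⟨a1, a2⟩ := ih1 hA' h1 hA
      obtain ⟨r1, r2⟩ := outer_eq_of_isOuter (isOuter_of_isHost hR' h2)
      have v1 := biUnion_collapseBlock hv'
      have v2 : v.toFinset.biUnion (keepBlock i m) = ∅ := biUnion_keepBlock_eq_empty
        fun a ha hab => hv (hv' a ha hab ▸ ha)
      rw [toBr, toBr, Br.outer_false, Br.inner_false, r1, r2, a1, a2, v1, v2]
      simp
    · obtain ⟨a1, a2⟩ := ih2 hR' h2 hR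
      obtain ⟨r1, r2⟩ := outer_eq_of_isOuter (isOuter_of_isHost hA' h1)
      have v1 := biUnion_collapseBlock hv'
      have v2 : v.toFinset.biUnion (keepBlock i m) = ∅ := biUnion_keepBlock_eq_empty
        fun a ha hab => hv (hv' a ha hab ▸ ha)
      rw [toBr, toBr, Br.outer_false, Br.inner_false, r1, r2, a1, a2, v1, v2]
      simp

/-- The label `i` occurs once in the outer contraction `H`. Its position tells whether the inserted
tree sits at the first vertex, above it, or in the later branches; the remaining places contain no
inserted edges and agree with `H`. -/
lemma exists_mem_insert (hm : 0 < m) {T : PTree Bool} {H : Branches Bool} {F : Br Bool}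
    (hH : IsHost i m H) (hi : H.whites.count i = 1) (hT : IsInner i m T.branches)
    (h1 : Br.outer i m F = (∅, H.toBr)) (h2 : Br.inner i m F = T.toTr) :
    ∃ R ∈ H.insert i T, R.toBr = F := by
  induction H generalizing F with
  | nil => simp [whites] at hi
  | cons e v A R ih1 ih2 =>
    obtain ⟨rfl, hv', hA', hR'⟩ := isColored_cons.1 hH
    cases F with
    | nil => simp [toBr] at h1
    | cons e u F₁ F₂ =>
      cases e
      swap
      · simp [Br.outer_true] at h1
      rw [Br.outer_false, toBr, Prod.mk.injEq, Br.cons.injEq] at h1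
      obtain ⟨l2, -, hu, b1, b2⟩ := h1
      rw [Br.inner_false] at h2
      have hcnt := count_whites_cons i false v A R
      rw [hi] at hcnt
      by_cases hv : v = some i
      · subst hv
        simp only [if_true] at hcnt
        have hA0 : i ∉ A.whites := List.count_eq_zero.1 (by omega)
        have hR0 : i ∉ R.whites := List.count_eq_zero.1 (by omega)
        have hF₂ := Br.outer_eq_self (F := F₂)
          (b2 ▸ cnt_eq_zero_of_isOuter hm (isOuter_of_isHost hR' hR0)) (l2 ▸ Finset.notMem_empty i)
        have hF₁ := Br.inner_fst_eq_empty (F := F₁)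
          (b1 ▸ cnt_eq_zero_of_isOuter hm (isOuter_of_isHost hA' hA0))
        simp only [Option.toFinset_some] at hu
        have hu' := Finset.union_subset_iff.1 hu.subset
        rw [Br.biUnion_keepBlock_of_subset hm hu'.1, hF₁, hF₂.2] at h2
        simp only [Finset.union_empty, Br.app_nil, PTree.toTr, Prod.mk.injEq] at h2
        obtain ⟨A', hA'', rfl⟩ := exists_mem_spread hm (isOuter_of_isHost hA' hA0) hT b1 hu'.2
          (Prod.ext hF₁ h2.2)
        refine ⟨cons false T.root A' R, (mem_insert_cons hi).2 (Or.inl ⟨rfl, hA0, hR0, A', hA'', rfl⟩),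
          ?_⟩
        rw [hF₂.1] at b2
        rw [toBr, h2.1, ← b2]
      · simp only [hv, if_false, zero_add] at hcnt
        have hvi : i ∉ v.toFinset := by simpa using hv
        rw [← hu, Finset.mem_union, not_or] at hvi
        have hu1 := Br.notMem_block hvi.1
        have hF₁ := (Br.outer_fst_eq_empty_or F₁).resolve_right hvi.2
        rw [hu1.1, hF₁, Finset.union_empty] at hu
        by_cases hA : i ∈ A.whites
        · have hA1 := List.count_pos_iff.2 hA
          have hR0 : i ∉ R.whites := List.count_eq_zero.1 (by omega)
          have hF₂ := Br.outer_eq_self (F := F₂)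
            (b2 ▸ cnt_eq_zero_of_isOuter hm (isOuter_of_isHost hR' hR0))
            (l2 ▸ Finset.notMem_empty i)
          rw [hu1.2, hF₂.2] at h2
          simp only [Finset.empty_union, Finset.union_empty, Br.app_nil] at h2
          obtain ⟨A', hA'', rfl⟩ := ih1 hA' (by omega) (Prod.ext hF₁ b1) h2
          refine ⟨cons false v A' R,
            (mem_insert_cons hi).2 (Or.inr (Or.inl ⟨hv, by omega, hR0, A', hA'', rfl⟩)), ?_⟩
          rw [hF₂.1] at b2
          rw [toBr, hu, ← b2]
        · have hA1 := List.count_eq_zero.2 hA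
          have hF₁' := Br.outer_eq_self (F := F₁)
            (b1 ▸ cnt_eq_zero_of_isOuter hm (isOuter_of_isHost hA' hA)) hvi.2
          rw [hu1.2, hF₁'.2] at h2
          simp only [Finset.empty_union, Br.nil_app] at h2
          obtain ⟨R', hR'', rfl⟩ := ih2 hR' (by omega) (Prod.ext l2 b2) h2
          refine ⟨cons false v A R',
            (mem_insert_cons hi).2 (Or.inr (Or.inr ⟨hv, hA, by omega, R', hR'', rfl⟩)), ?_⟩
          rw [hF₁'.1] at b1
          rw [toBr, hu, ← b1]

lemma nodup_insert {T : PTree Bool} {H : Branches Bool} (hH : IsHost i m H)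
    (hi : H.whites.count i = 1) (hT : IsInner i m T.branches) : (H.insert i T).Nodup := by
  induction H with
  | nil => simp [insert]
  | cons e v A R ih1 ih2 =>
    obtain ⟨rfl, hv', hA', hR'⟩ := isColored_cons.1 hH
    have hcnt := count_whites_cons i false v A R
    rw [hi] at hcnt
    by_cases hv : v = some i
    · simp only [insert, hv, if_true] at hcnt ⊢
      refine (nodup_spread (isOuter_of_isHost hA' (List.count_eq_zero.1 (by omega))) hT).map ?_
      intro x y h; simpa using h
    · simp only [insert, hv, if_false, zero_add] at hcnt ⊢
      by_cases hA : i ∈ A.whites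
      · have hA1 := List.count_pos_iff.2 hA
        have hR0 : i ∉ R.whites := List.count_eq_zero.1 (by omega)
        rw [insert_of_notMem T hR0]
        simp only [List.map_cons, List.map_nil, ← List.map_eq_flatMap]
        refine (ih1 hA' (by omega)).map ?_
        intro x y h; simpa using h
      · have hA1 := List.count_eq_zero.2 hA
        rw [insert_of_notMem T hA]
        simp only [List.flatMap_cons, List.flatMap_nil, List.append_nil]
        refine (ih2 hR' (by omega)).map ?_
        intro x y h; simpa using h

end Branches

/-- A tree arises by inserting `T'` into the vertex `i` of `T` if and only if the contractions of the
edges of `T'` and of `T` give `T` and `T'`. -/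
lemma PTree.mem_insert_iff {i m : ℕ} (hm : 0 < m) {T T' : PTree Bool} {S : Tr Bool}
    (hTv : ∀ a ∈ T.root, (i ≤ a ∧ a < i + m) → a = i) (hT : Branches.IsHost i m T.branches)
    (hi : T.whites.count i = 1) (hTv' : ∀ a ∈ T'.root, i ≤ a ∧ a < i + m)
    (hT' : Branches.IsInner i m T'.branches) (hT0 : T'.root = none → T'.branches ≠ .nil) :
    (∃ R ∈ T.insert i T', R.toTr = S) ↔
      S.op (collapseBlock i m) (contractTrue i) = T.toTr ∧
        S.op (keepBlock i m) contractFalse = T'.toTr := by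
  obtain ⟨v, H⟩ := T
  obtain ⟨u, F⟩ := S
  rw [PTree.count_whites] at hi
  simp only at hi hT hTv
  by_cases hv : v = some i
  · subst hv
    simp only [if_true] at hi
    have hO := Branches.isOuter_of_isHost hT (List.count_eq_zero.1 (by omega))
    have hroot := fun F => Branches.outer_root_eq (F := F) hm hTv' hT' hT0 hO
    simp only [insert, if_true, List.mem_map, exists_exists_and_eq_and, toTr, Prod.mk.injEq,
      Tr.op, Option.toFinset_some]
    constructor
    · rintro ⟨A, hA, rfl, rfl⟩
      obtain ⟨a1, a2, a3⟩ := Branches.outer_of_mem_spread hO hT' hA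
      have h1 := Branches.biUnion_keepBlock hTv'
      refine ⟨⟨hroot A hA, a1⟩, ?_⟩
      simp only [Br.inner] at a3
      rw [a3, h1.1, Finset.union_empty]
      exact ⟨rfl, rfl⟩
    · rintro ⟨⟨h1, h2⟩, h3, h4⟩
      have h1' := Finset.union_subset_iff.1 h1.subset
      have h5 := Br.inner_fst_eq_empty (F := F)
        (h2 ▸ Branches.cnt_eq_zero_of_isOuter hm hO)
      rw [Br.biUnion_keepBlock_of_subset hm h1'.1, h5, Finset.union_empty] at h3
      obtain ⟨R, hR, rfl⟩ := Branches.exists_mem_spread hm hO hT' h2 h1'.2 (Prod.ext h5 h4)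
      exact ⟨R, hR, h3.symm, rfl⟩
  · simp only [hv, if_false, zero_add] at hi
    simp only [insert, hv, if_false, List.mem_map, exists_exists_and_eq_and, toTr, Prod.mk.injEq,
      Tr.op]
    constructor
    · rintro ⟨A, hA, rfl, rfl⟩
      obtain ⟨a1, a2⟩ := Branches.outer_of_mem_insert hT hi hm hTv' hT' hT0 hA
      have h1 := Branches.biUnion_collapseBlock hTv
      have h2 : v.toFinset.biUnion (keepBlock i m) = ∅ := Branches.biUnion_keepBlock_eq_empty
        fun a ha hab => hv (hTv a ha hab ▸ ha)
      simp only [Br.inner, Br.outer] at a1 a2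
      rw [a1, a2, h1, h2]
      simp [toTr]
    · rintro ⟨⟨h1, h2⟩, h3, h4⟩
      have hvi : i ∉ v.toFinset := by simpa using hv
      rw [← h1, Finset.mem_union, not_or] at hvi
      have hu1 := Br.notMem_block hvi.1
      have hF := (Br.outer_fst_eq_empty_or F).resolve_right hvi.2
      rw [hF, hu1.1, Finset.union_empty] at h1
      rw [hu1.2, Finset.empty_union] at h3
      obtain ⟨R, hR, rfl⟩ := Branches.exists_mem_insert hm (T := T') hT hi hT' (Prod.ext hF h2)
        (Prod.ext h3 h4)
      exact ⟨R, hR, h1.symm, rfl⟩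

lemma PTree.nodup_insert {i m : ℕ} {T T' : PTree Bool} (hT : Branches.IsHost i m T.branches)
    (hi : T.whites.count i = 1) (hT' : Branches.IsInner i m T'.branches) :
    (T.insert i T').Nodup := by
  rw [PTree.count_whites] at hi
  by_cases hv : T.root = some i
  · simp only [insert, hv, if_true] at hi ⊢
    refine (Branches.nodup_spread (Branches.isOuter_of_isHost hT
      (List.count_eq_zero.1 (by omega))) hT').map ?_
    intro x y h; simpa using h
  · simp only [insert, hv, if_false, zero_add] at hi ⊢
    refine (Branches.nodup_insert hT hi hT').map ?_
    intro x y h; simpa using h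

/-! ## The coefficients of a composition -/

/-- The new label of the vertex `a`, if the labels `i, …, i + m - 1` are identified. -/
def outerLabel (i m a : ℕ) : ℕ := if a < i then a else if a < i + m then i else a + 1 - m

/-- The new label of the vertex `a`, if only the labels `i, …, i + m - 1` are kept. -/
def innerLabel (i m a : ℕ) : Finset ℕ := if i ≤ a ∧ a < i + m then {a - i} else ∅

/-- Contract the edges in `P` to the vertex `i`. -/
def outerTree (i m : ℕ) (P : Finset ℕ) (S : Tr ℕ) : Tr ℕ :=
  S.op (fun a => {outerLabel i m a}) fun e => if e ∈ P then some {i} else none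

/-- Contract the edges that are not in `P`, and keep the labels `i, …, i + m - 1`. -/
def innerTree (i m : ℕ) (P : Finset ℕ) (S : Tr ℕ) : Tr ℕ :=
  S.op (innerLabel i m) fun e => if e ∈ P then none else some ∅

lemma edges_outerTree (i m : ℕ) (P : Finset ℕ) (S : Tr ℕ) :
    (outerTree i m P S).edges = S.edges.filter fun e => !decide (e ∈ P) := by
  rw [outerTree, Tr.edges_op]
  exact List.filter_congr fun e _ => by by_cases h : e ∈ P <;> simp [h]

lemma edges_innerTree (i m : ℕ) (P : Finset ℕ) (S : Tr ℕ) :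
    (innerTree i m P S).edges = S.edges.filter fun e => decide (e ∈ P) := by
  rw [innerTree, Tr.edges_op]
  exact List.filter_congr fun e _ => by by_cases h : e ∈ P <;> simp [h]

/-- A topmost vertex has no branches above it, so by stability it carries a label. -/
lemma Br.exists_cnt_pos {ε : Type} {F : Br ε} (hF : F.Stable) (h : F ≠ nil) :
    ∃ a, 0 < F.cnt a := by
  induction F with
  | nil => exact absurd rfl h
  | cons e v A R ih _ =>
    by_cases hv : v = ∅
    · obtain ⟨a, ha⟩ := ih hF.2.1 (by rintro rfl; simpa [length] using hF.1 hv)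
      exact ⟨a, by simp only [cnt]; omega⟩
    · obtain ⟨a, ha⟩ := Finset.nonempty_iff_ne_empty.2 hv
      exact ⟨a, by simp [cnt, ha]⟩

/-- Hence `M k 0` has an empty basis. It also follows that the block of labels of an inserted tree
is never empty, as the description by contractions requires. -/
lemma Tr.IsRooted.pos {ε : Type} {n : ℕ} {S : Tr ε} (h : S.IsRooted n) : 0 < n := by
  obtain ⟨-, hc, h0, hS⟩ := h
  have : ∃ a, 0 < S.cnt a := by
    by_cases hv : S.1 = ∅
    · obtain ⟨a, ha⟩ := Br.exists_cnt_pos hS fun h => by simpa [h, Br.length] using h0 hv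
      exact ⟨a, by simp only [cnt]; omega⟩
    · obtain ⟨a, ha⟩ := Finset.nonempty_iff_ne_empty.2 hv
      exact ⟨a, by simp [cnt, ha]⟩
  obtain ⟨a, ha⟩ := this
  rw [hc] at ha
  split_ifs at ha <;> omega

lemma RootedTree.pos {n : ℕ} (T : RootedTree n) : 0 < n := (PTree.isRooted_toTr.2 T.2).pos

/-! ### Edges and labels of an insertion -/

namespace Branches

variable {ε δ : Type}

lemma edges_append (F G : Branches ε) : (F.append G).edges = F.edges ++ G.edges := by
  simp [← edges_toBr]

/-- The planar order of a grafting is a shuffle of the planar orders of its two parts. -/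
lemma edges_of_mem_spread {c : ε → Bool} {B G F : Branches ε} (hB : ∀ e ∈ B.edges, c e = false)
    (hG : ∀ e ∈ G.edges, c e = true) (hF : F ∈ spread B G) :
    F.edges.filter (fun e => !c e) = B.edges ∧ F.edges.filter c = G.edges := by
  induction G generalizing B F with
  | nil =>
    simp only [spread, List.mem_singleton] at hF
    subst hF
    rw [List.filter_eq_self, List.filter_eq_nil_iff.2 fun e he => by simp [hB e he]]
    exact ⟨fun e he => by simp [hB e he], rfl⟩
  | cons e v A R ih1 ih2 =>
    simp only [spread, List.mem_flatMap, List.mem_map] at hF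
    obtain ⟨⟨X, Y, Z⟩, hp, A', hA, R', hR, rfl⟩ := hF
    rw [mem_cuts₃] at hp
    subst hp
    simp only [edges_append, edges, List.mem_append, List.mem_cons] at hB hG
    obtain ⟨a1, a2⟩ := ih1 (fun e h => hB e (by tauto)) (fun e h => hG e (by tauto)) hA
    obtain ⟨r1, r2⟩ := ih2 (fun e h => hB e (by tauto)) (fun e h => hG e (by tauto)) hR
    have x1 : X.edges.filter (fun e => !c e) = X.edges :=
      List.filter_eq_self.2 fun e he => by simp [hB e (Or.inl he)]
    have x2 : X.edges.filter c = [] := List.filter_eq_nil_iff.2 fun e he => by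
      simp [hB e (Or.inl he)]
    simp [edges_append, edges, a1, a2, r1, r2, x1, x2, hG e (Or.inl rfl)]

lemma edges_of_mem_insert {c : ε → Bool} {i : ℕ} {T : PTree ε} {H F : Branches ε}
    (hi : H.whites.count i = 1) (hH : ∀ e ∈ H.edges, c e = false)
    (hT : ∀ e ∈ T.edges, c e = true) (hF : F ∈ H.insert i T) :
    F.edges.filter (fun e => !c e) = H.edges ∧ F.edges.filter c = T.edges := by
  induction H generalizing F with
  | nil => simp [whites] at hi
  | cons e v A R ih1 ih2 =>
    simp only [edges, List.mem_append, List.mem_cons] at hH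
    have hf : ∀ B : Branches ε, (∀ e ∈ B.edges, c e = false) →
        B.edges.filter (fun e => !c e) = B.edges ∧ B.edges.filter c = [] := fun B hB =>
      ⟨List.filter_eq_self.2 fun e he => by simp [hB e he],
        List.filter_eq_nil_iff.2 fun e he => by simp [hB e he]⟩
    have hA0 := hf A fun e h => hH e (by tauto)
    have hR0 := hf R fun e h => hH e (by tauto)
    have he := hH e (Or.inl rfl)
    rcases (mem_insert_cons hi).1 hF with ⟨rfl, h1, h2, A', hA, rfl⟩ | ⟨hv, h1, h2, A', hA, rfl⟩ |
      ⟨hv, h1, h2, R', hR, rfl⟩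
    · obtain ⟨a1, a2⟩ := edges_of_mem_spread (fun e h => hH e (by tauto)) hT hA
      simp [edges, a1, a2, hR0, he, PTree.edges]
    · obtain ⟨a1, a2⟩ := ih1 h1 (fun e h => hH e (by tauto)) hA
      simp [edges, a1, a2, hR0, he]
    · obtain ⟨a1, a2⟩ := ih2 h2 (fun e h => hH e (by tauto)) hR
      simp [edges, a1, a2, hA0, he]

lemma whites_relabel (f : ℕ → ℕ) (F : Branches ε) : (F.relabel f).whites = F.whites.map f := by
  induction F with
  | nil => rfl
  | cons e v A R ih1 ih2 => cases v <;> simp [whites, relabel, ih1, ih2]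

lemma whites_mapEdges (f : ε → δ) (F : Branches ε) : (F.mapEdges f).whites = F.whites := by
  induction F with
  | nil => rfl
  | cons e v A R ih1 ih2 => simp [whites, mapEdges, ih1, ih2]

end Branches

namespace PTree

variable {ε δ : Type}

lemma edges_of_mem_insert {c : ε → Bool} {i : ℕ} {T T' R : PTree ε}
    (hi : T.whites.count i = 1) (hT : ∀ e ∈ T.edges, c e = false)
    (hT' : ∀ e ∈ T'.edges, c e = true) (hR : R ∈ T.insert i T') :
    R.edges.filter (fun e => !c e) = T.edges ∧ R.edges.filter c = T'.edges := by
  rw [count_whites] at hi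
  by_cases hv : T.root = some i
  · simp only [insert, hv, if_true, List.mem_map] at hR
    obtain ⟨F, hF, rfl⟩ := hR
    exact Branches.edges_of_mem_spread hT hT' hF
  · simp only [insert, hv, if_false, List.mem_map, zero_add] at hR hi
    obtain ⟨F, hF, rfl⟩ := hR
    exact Branches.edges_of_mem_insert hi hT hT' hF

lemma whites_relabel (f : ℕ → ℕ) (T : PTree ε) : (T.relabel f).whites = T.whites.map f := by
  cases h : T.root <;> simp [whites, relabel, Branches.whites_relabel, h]

lemma whites_mapEdges (f : ε → δ) (T : PTree ε) : (T.mapEdges f).whites = T.whites := by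
  simp [whites, mapEdges, Branches.whites_mapEdges]

lemma whites_number (T : PTree Unit) (s : ℕ) : (T.number s).whites = T.whites := by
  conv_rhs => rw [← T.forget_number s, forget, whites_mapEdges]

end PTree

lemma outerLabel_outerIndex {i m : ℕ} (hm : 0 < m) (a : ℕ) :
    outerLabel i m (outerIndex i m a) = a := by
  unfold outerLabel outerIndex; split_ifs <;> omega

lemma outerIndex_injective {i m : ℕ} (hm : 0 < m) : Function.Injective (outerIndex i m) :=
  Function.LeftInverse.injective (outerLabel_outerIndex hm)

/-- On the left the label `i` occurs twice, as the label of the replaced vertex and as the first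
label of the block. -/
lemma map_outerIndex_perm {n m l i : ℕ} (h : n + m = l + 1) (hi : i < n) (hm : 0 < m) :
    ((List.range n).map (outerIndex i m) ++ (List.range m).map (fun j => i + j)).Perm
      (i :: List.range l) := by
  -- The labels of the first tree are those below `i`, the label `i`, and `r` further ones.
  obtain ⟨r, rfl⟩ : ∃ r, n = i + (1 + r) := ⟨n - i - 1, by omega⟩
  obtain rfl : l = i + (m + r) := by omega
  have h1 : (List.range i).map (outerIndex i m) = List.range i := by
    conv_rhs => rw [← List.map_id (List.range i)]
    refine List.map_congr_left fun a ha => ?_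
    rw [List.mem_range] at ha
    rw [outerIndex, if_pos ha.le]; rfl
  have h2 : (List.range r).map (fun a => outerIndex i m (i + (1 + a))) =
      (List.range r).map fun a => i + (m + a) := by
    refine List.map_congr_left fun a ha => ?_
    rw [outerIndex, if_neg (by omega)]; omega
  have h3 : outerIndex i m i = i := by simp [outerIndex]
  simp only [List.range_add, List.map_append, List.map_map, Function.comp_def, h1, h2,
    List.range_one, List.map_cons, List.map_nil, Nat.add_zero, h3, List.append_assoc]
  rw [List.perm_iff_count]
  intro b
  simp only [List.count_append, List.count_cons, List.count_nil]
  omega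

/-! ### Renumbered labels and comparison with basis trees -/

section

variable {n m l : ℕ} {i : ℕ} {T T' : PTree Unit}

lemma isRooted_of_mem_insert (h : n + m = l + 1) (hin : i < n) (hm : 0 < m) (hT : T.IsRooted n)
    (hT' : T'.IsRooted m) (s : ℕ) {R : PTree ℕ}
    (hR : R ∈ ((T.number 0).relabel (outerIndex i m)).insert i
      ((T'.number s).relabel fun j => i + j)) : R.toTr.IsRooted l := by
  have hi : ((T.number 0).relabel (outerIndex i m)).whites.count i = 1 := by
    rw [PTree.whites_relabel, PTree.whites_number]
    nth_rw 1 [← show outerIndex i m i = i by simp [outerIndex]]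
    rw [List.count_map_of_injective _ _ (outerIndex_injective hm), hT.1.count_eq,
      List.nodup_range.count]
    simp [hin]
  have hstab : ∀ (T : PTree Unit) (f : ℕ → ℕ) (s : ℕ), T.toTr.Stable →
      ((T.number s).relabel f).toTr.Stable := by
    intro T f s hT
    rw [PTree.toTr_relabel]
    refine Tr.stable_op (fun _ => Finset.singleton_nonempty _) ?_
    rwa [← Tr.stable_forget, ← PTree.toTr_forget, PTree.forget_number]
  refine ⟨PTree.simple_toTr _, fun b => ?_, PTree.stable_of_mem_insert hi
    (hstab _ _ _ (PTree.isRooted_toTr.2 hT).2.2) (hstab _ _ _ (PTree.isRooted_toTr.2 hT').2.2) hR⟩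
  have hw := PTree.whites_of_mem_insert hi hR
  rw [PTree.whites_relabel, PTree.whites_relabel, PTree.whites_number, PTree.whites_number,
    Multiset.coe_add, Multiset.coe_eq_coe.2
      (((hT.1.map _).append (hT'.1.map _)).trans (map_outerIndex_perm h hin hm)),
    ← Multiset.cons_coe, ← Multiset.singleton_add, add_comm, add_left_cancel_iff,
    Multiset.coe_eq_coe] at hw
  rw [PTree.cnt_toTr, hw.count_eq, List.nodup_range.count]
  simp

lemma Tr.mapE_const_eq_iff {ε ε' δ : Type} (d : δ) {X : Tr ε} {Y : Tr ε'} :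
    X.mapE (fun _ => d) = Y.mapE (fun _ => d) ↔ X.forget = Y.forget := by
  constructor
  · intro h
    have := congrArg Tr.forget h
    simpa using this
  · intro h
    have := congrArg (Tr.mapE fun _ => d) h
    simpa [Tr.forget, Function.comp_def] using this

lemma Tr.forget_op {ε : Type} (S : Tr ε) (g : ℕ → Finset ℕ) :
    S.forget.op g (fun _ => none) = (S.op g fun _ => none).forget := by
  rw [forget, op_mapE]; rfl

/-- The insertion criterion collapses the block but keeps the gap in the labels, whereas
coefficients of the host refer to consecutive labels. On collapsed labels `outerLabel` and
`outerIndex` are inverse to each other, and applying them to both sides passes between the two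
conventions. -/
lemma outerTree_forget_eq_iff (hm : 0 < m) (P : Finset ℕ) (S : Tr ℕ) :
    (S.mapE fun e => decide (e ∈ P)).op (collapseBlock i m) (contractTrue i) =
      ((T.relabel (outerIndex i m)).mapEdges fun _ => false).toTr ↔
    (outerTree i m P S).forget = T.toTr := by
  have h1 : (S.mapE fun e => decide (e ∈ P)).op (collapseBlock i m) (contractTrue i) =
      (S.op (collapseBlock i m) fun e => if e ∈ P then some {i} else none).mapE
        fun _ => false := by
    rw [Tr.op_mapE]
    have : contractTrue i ∘ (fun e => decide (e ∈ P)) =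
        fun e => if e ∈ P then some {i} else none := by
      funext e; by_cases he : e ∈ P <;> simp [contractTrue, he]
    rw [this]
    refine Tr.mapE_congr fun e he => ?_
    rw [Tr.edges_op, List.mem_filter] at he
    by_cases hP : e ∈ P <;> simp_all
  rw [h1, PTree.toTr_mapEdges, Tr.mapE_const_eq_iff, ← PTree.toTr_forget, PTree.forget_unit,
    PTree.toTr_relabel]
  constructor
  · intro h
    have := congrArg (Tr.op (fun a => {outerLabel i m a}) fun _ => none) h
    rw [Tr.forget_op, Tr.op_op (g'' := fun a => {outerLabel i m a})
      (h'' := fun e => if e ∈ P then some {i} else none), Tr.op_op (g'' := fun a => {a})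
      (h'' := fun _ => none), Tr.op_id (fun _ _ => rfl)] at this
    · exact this
    · intro a; simp [outerLabel_outerIndex hm]
    · intro e; rfl
    · intro a
      simp only [collapseBlock, Finset.singleton_biUnion, Finset.singleton_inj, outerLabel]
      split_ifs <;> omega
    · intro e; split_ifs <;> simp [outerLabel, hm]
  · intro h
    rw [← h, Tr.forget_op, outerTree, Tr.op_op]
    · intro a
      simp only [collapseBlock, Finset.singleton_biUnion, Finset.singleton_inj, outerLabel,
        outerIndex]
      split_ifs <;> omega
    · intro e; split_ifs <;> simp [outerIndex]

lemma innerTree_forget_eq_iff (hT' : T'.IsRooted m) (P : Finset ℕ) (S : Tr ℕ) :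
    (S.mapE fun e => decide (e ∈ P)).op (keepBlock i m) contractFalse =
      ((T'.relabel fun j => i + j).mapEdges fun _ => true).toTr ↔
    (innerTree i m P S).forget = T'.toTr := by
  have h1 : (S.mapE fun e => decide (e ∈ P)).op (keepBlock i m) contractFalse =
      (S.op (keepBlock i m) fun e => if e ∈ P then none else some ∅).mapE
        fun _ => true := by
    rw [Tr.op_mapE]
    have : contractFalse ∘ (fun e => decide (e ∈ P)) =
        fun e => if e ∈ P then none else some ∅ := by
      funext e; by_cases he : e ∈ P <;> simp [contractFalse, he]
    rw [this]
    refine Tr.mapE_congr fun e he => ?_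
    rw [Tr.edges_op, List.mem_filter] at he
    by_cases hP : e ∈ P <;> simp_all
  rw [h1, PTree.toTr_mapEdges, Tr.mapE_const_eq_iff, ← PTree.toTr_forget, PTree.forget_unit,
    PTree.toTr_relabel]
  constructor
  · intro h
    have := congrArg (Tr.op (innerLabel i m) fun _ => none) h
    rw [Tr.forget_op, Tr.op_op (g'' := innerLabel i m)
      (h'' := fun e => if e ∈ P then none else some ∅), Tr.op_op
      (g'' := fun a => innerLabel i m (i + a)) (h'' := fun _ => none),
      Tr.op_congr (g' := fun a => {a}) (h' := fun _ => none) _ fun _ _ => rfl,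
      Tr.op_id (fun _ _ => rfl)] at this
    · exact this
    -- Only labels below `m` are restored by `innerLabel` after the shift by `i`, but no others
    -- occur in `T'`.
    · intro a ha
      rw [(PTree.isRooted_toTr.2 hT').2.1] at ha
      have : a < m := by split_ifs at ha <;> omega
      simp [innerLabel, this]
    · intro a; simp
    · intro e; rfl
    · intro a
      simp only [keepBlock]
      split_ifs with h <;> simp [innerLabel, h]
    · intro e; split_ifs <;> simp
  · intro h
    rw [← h, Tr.forget_op, innerTree, Tr.op_op]
    · intro a
      simp only [keepBlock, innerLabel]
      split_ifs with h
      · simp [Nat.add_sub_cancel' h.1]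
      · rfl
    · intro e; split_ifs <;> simp

end

section

variable {n m l : ℕ} {i : ℕ} {T T' : PTree Unit}

lemma isHost_relabel (hm : 0 < m) : (∀ a ∈ ((T.relabel (outerIndex i m)).mapEdges fun _ => false).root,
      (i ≤ a ∧ a < i + m) → a = i) ∧
    Branches.IsHost i m ((T.relabel (outerIndex i m)).mapEdges fun _ => false).branches := by
  -- The renumbering leaves room for a block of `m` labels and itself uses only the first of them.
  have key : ∀ j, (i ≤ outerIndex i m j ∧ outerIndex i m j < i + m) → outerIndex i m j = i := by
    intro j; unfold outerIndex; split_ifs <;> omega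
  refine ⟨fun a ha => ?_, fun e he => ?_, fun a ha => ?_⟩
  · simp only [PTree.mapEdges, PTree.relabel, Option.mem_map] at ha
    obtain ⟨j, -, rfl⟩ := ha
    exact key j
  · simp only [PTree.mapEdges, Branches.edges_mapEdges, List.mem_map] at he
    obtain ⟨_, _, rfl⟩ := he; rfl
  · simp only [PTree.mapEdges, PTree.relabel, Branches.whites_mapEdges, Branches.whites_relabel,
      List.mem_map] at ha
    obtain ⟨j, -, rfl⟩ := ha
    exact key j

lemma isInner_relabel (hT' : T'.IsRooted m) :
    (∀ a ∈ ((T'.relabel fun j => i + j).mapEdges fun _ => true).root, i ≤ a ∧ a < i + m) ∧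
    Branches.IsInner i m ((T'.relabel fun j => i + j).mapEdges fun _ => true).branches := by
  have key : ∀ j ∈ T'.whites, i ≤ i + j ∧ i + j < i + m := by
    intro j hj
    have := List.mem_range.1 (hT'.1.mem_iff.1 hj)
    omega
  refine ⟨fun a ha => ?_, fun e he => ?_, fun a ha => ?_⟩
  · simp only [PTree.mapEdges, PTree.relabel, Option.mem_map] at ha
    obtain ⟨j, hj, rfl⟩ := ha
    exact key j (by simp [PTree.whites, Option.mem_def.1 hj])
  · simp only [PTree.mapEdges, Branches.edges_mapEdges, List.mem_map] at he
    obtain ⟨_, _, rfl⟩ := he; rfl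
  · simp only [PTree.mapEdges, PTree.relabel, Branches.whites_mapEdges, Branches.whites_relabel,
      List.mem_map] at ha
    obtain ⟨j, hj, rfl⟩ := ha
    exact key j (by simp [PTree.whites, hj])

lemma count_whites_outerIndex (hin : i < n) (hm : 0 < m) (hT : T.IsRooted n) :
    (T.whites.map (outerIndex i m)).count i = 1 := by
  nth_rw 1 [← show outerIndex i m i = i by simp [outerIndex]]
  rw [List.count_map_of_injective _ _ (outerIndex_injective hm), hT.1.count_eq,
    List.nodup_range.count]
  simp [hin]

/-- The edges of each of the two trees appear in increasing order, and the first tree has the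
smaller names. Thus the only inversions are the pairs with an edge of the second tree before one of
the first. -/
lemma listSign_of_mem_insert (hin : i < n) (hm : 0 < m) (hT : T.IsRooted n) {R : PTree ℕ}
    (hR : R ∈ ((T.number 0).relabel (outerIndex i m)).insert i
      ((T'.number T.size).relabel fun j => i + j)) :
    listSign R.edges = colorSign (R.edges.map fun a => decide (T.size ≤ a)) := by
  have hi : ((T.number 0).relabel (outerIndex i m)).whites.count i = 1 := by
    rw [PTree.whites_relabel, PTree.whites_number, count_whites_outerIndex hin hm hT]
  obtain ⟨h1, h2⟩ := PTree.edges_of_mem_insert (c := fun a => decide (T.size ≤ a)) hi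
    (fun e he => by
      rw [PTree.edges_relabel, PTree.edges_number, List.mem_range'_1] at he
      simp; omega)
    (fun e he => by
      rw [PTree.edges_relabel, PTree.edges_number, List.mem_range'_1] at he
      simp; omega) hR
  rw [PTree.edges_relabel, PTree.edges_number] at h1 h2
  have hnd : R.edges.Nodup := by
    have := (List.filter_append_perm (fun a => decide (T.size ≤ a)) R.edges).symm
    rw [this.nodup_iff, h1, h2, List.nodup_append]
    refine ⟨List.nodup_range', List.nodup_range', ?_⟩
    intro a ha b hb
    rw [List.mem_range'_1] at ha hb; omega
  have h := colorSign_mul_listSign hnd fun a => decide (T.size ≤ a)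
  rw [h1, h2, listSign_of_sorted List.pairwise_lt_range', listSign_of_sorted List.pairwise_lt_range',
    show shuffleSign _ _ = 1 from Finset.prod_eq_one fun a ha => Finset.prod_eq_one fun b hb => by
      simp only [Finset.mem_filter, decide_eq_true_eq, decide_eq_false_iff_not] at ha hb
      unfold pairSign; rw [if_neg (by omega)]] at h
  linear_combination colorSign (R.edges.map fun a => decide (T.size ≤ a)) *
    listSign_mul_self R.edges - listSign R.edges * h

variable {k : Type*} [Field k]

/-- Sums over a list of colored versions of a tree are sums over colorings of its edges. -/
lemma sum_map_eq_sum_colorings {δ ι : Type} [Inhabited δ] {L : List (PTree δ)} (hL : L.Nodup)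
    {S : Tr ℕ} (hS : S.edges.Nodup) (g : Tr δ → k) (I : Finset ι) (χ : ι → ℕ → δ)
    (hinj : ∀ i ∈ I, ∀ j ∈ I, (∀ e ∈ S.edges, χ i e = χ j e) → i = j)
    (hsurj : ∀ R ∈ L, ∀ f, R.toTr = S.mapE f → ∃ i ∈ I, ∀ e ∈ S.edges, f e = χ i e)
    [DecidableEq (Tr Unit)] [∀ X : Tr δ, Decidable (∃ R ∈ L, R.toTr = X)] :
    (L.map fun R => if R.toTr.forget = S.forget then g R.toTr else 0).sum =
      ∑ i ∈ I, if ∃ R ∈ L, R.toTr = S.mapE (χ i) then g (S.mapE (χ i)) else 0 := by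
  classical
  rw [← List.sum_toFinset _ hL, ← Finset.sum_filter, ← Finset.sum_filter]
  symm
  have hex : ∀ i, ∃ R : PTree δ, (∃ R ∈ L, R.toTr = S.mapE (χ i)) →
      R ∈ L ∧ R.toTr = S.mapE (χ i) := by
    intro i
    by_cases h : ∃ R ∈ L, R.toTr = S.mapE (χ i)
    · obtain ⟨R, hR⟩ := h
      exact ⟨R, fun _ => hR⟩
    -- An arbitrary value for colorings that do not come from the list; they are filtered out of the
    -- sum.
    · exact ⟨⟨none, .nil⟩, fun h' => absurd h' h⟩
  choose ρ hρ using hex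
  refine Finset.sum_nbij ρ ?_ ?_ ?_ ?_
  · intro i hi
    rw [Finset.mem_filter] at hi ⊢
    obtain ⟨h1, h2⟩ := hρ i hi.2
    exact ⟨List.mem_toFinset.2 h1, by rw [h2, Tr.forget_mapE]⟩
  · intro i hi j hj h
    rw [Finset.mem_coe, Finset.mem_filter] at hi hj
    have h' : S.mapE (χ i) = S.mapE (χ j) := by
      rw [← (hρ i hi.2).2, ← (hρ j hj.2).2, h]
    exact hinj i hi.1 j hj.1 (Br.edges_eq_of_mapE (congrArg Prod.snd h'))
  · intro R hR
    rw [Finset.mem_coe, Finset.mem_filter, List.mem_toFinset] at hR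
    obtain ⟨f, hf⟩ := Tr.exists_mapE_eq hS hR.2.symm
    obtain ⟨i, hi, hfi⟩ := hsurj R hR.1 f hf
    have hf' : R.toTr = S.mapE (χ i) := hf.trans (Tr.mapE_congr hfi)
    have hex : ∃ R ∈ L, R.toTr = S.mapE (χ i) := ⟨R, hR.1, hf'⟩
    refine ⟨i, ?_, ?_⟩
    · rw [Finset.mem_coe, Finset.mem_filter]
      exact ⟨hi, hex⟩
    · exact PTree.toTr_injective ((hρ _ hex).2.trans hf'.symm)
  · intro i hi
    rw [Finset.mem_filter] at hi
    rw [(hρ i hi.2).2]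

/-- The coefficient of a composition of basis trees. -/
lemma ev_sum_insert (h : n + m = l + 1) (hin : i < n) (T : RootedTree n) (T' : RootedTree m)
    {S : Tr ℕ} (hS : S.edges.Nodup) :
    ev S ((((T.1.number 0).relabel (outerIndex i m)).insert i
        ((T'.1.number T.1.size).relabel fun j => i + j)).map (ofOriented k l)).sum =
      ∑ P ∈ S.edges.toFinset.powerset, (shuffleSign (S.edges.toFinset \ P) P : k) *
        (ev (outerTree i m P S) (Finsupp.single T 1 : M k n) *
          ev (innerTree i m P S) (Finsupp.single T' 1 : M k m)) := by
  classical
  have hm := T'.pos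
  set L := ((T.1.number 0).relabel (outerIndex i m)).insert i
        ((T'.1.number T.1.size).relabel fun j => i + j) with hL
  set c : ℕ → Bool := fun a => decide (T.1.size ≤ a) with hc
  set T₁ := (T.1.relabel (outerIndex i m)).mapEdges fun _ => false with hT₁
  set T₂ := (T'.1.relabel fun j => i + j).mapEdges fun _ => true with hT₂
  -- Naming each edge by its origin gives the insertions of two-colored trees, to which the
  -- criterion by contractions applies.
  have hLc : L.map (PTree.mapEdges c) = T₁.insert i T₂ := by
    rw [hL, ← PTree.insert_mapEdges, PTree.mapEdges_relabel, PTree.mapEdges_relabel, hT₁, hT₂,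
      PTree.mapEdges_relabel, PTree.mapEdges_relabel, ← PTree.mapEdges_const_number false T.1 0,
      ← PTree.mapEdges_const_number true T'.1 T.1.size]
    congr 2
    · refine PTree.mapEdges_congr fun e he => ?_
      rw [PTree.edges_number, List.mem_range'_1] at he
      simp [hc]; omega
    · refine PTree.mapEdges_congr fun e he => ?_
      rw [PTree.edges_number, List.mem_range'_1] at he
      simp [hc]; omega
  have hi : T₁.whites.count i = 1 := by
    rw [hT₁, PTree.whites_mapEdges, PTree.whites_relabel, count_whites_outerIndex hin hm T.2]
  have hT1 := isHost_relabel (i := i) (T := T.1) hm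
  have hT2 := isInner_relabel (i := i) T'.2
  rw [← hT₁] at hT1
  rw [← hT₂] at hT2
  -- By stability the inserted tree is not a single black vertex.
  have hT20 : T₂.root = none → T₂.branches ≠ .nil := by
    intro h0 h1
    have hr : T'.1.root = none := by simpa [hT₂, PTree.mapEdges, PTree.relabel] using h0
    have := congrArg Branches.length h1
    have h2 := T'.2.2.1 hr
    have h3 : T₂.branches.length = T'.1.branches.length := by
      rw [hT₂, ← Branches.length_toBr, PTree.mapEdges, Branches.toBr_mapEdges, Br.length_mapE,
        PTree.relabel]
      have := congrArg Br.length (congrArg Prod.snd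
        (Branches.toBr_relabel (fun j => i + j) T'.1.branches))
      simp only at this
      rw [← this, ← Branches.length_toBr]
      have hlen : ∀ F : Br Unit, (F.op (fun a => {i + a}) fun _ => none).2.length = F.length := by
        intro F
        induction F with
        | nil => rfl
        | cons e v A R _ ih => rw [Br.op_cons_none rfl]; simp [Br.length, ih]
      rw [hlen]
    rw [← h3, this] at h2
    simp [Branches.length] at h2
  have hnd : (T₁.insert i T₂).Nodup := PTree.nodup_insert hT1.2 hi hT2.2
  have hmem := fun X : Tr Bool => PTree.mem_insert_iff (S := X) hm hT1.1 hT1.2 hi hT2.1 hT2.2 hT20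
  -- The sign of a summand depends on the colors only, so the sum can be indexed by colorings of the
  -- edges of `S`, that is, by sets of edges.
  have h1 : ev S (L.map (ofOriented k l)).sum = ((T₁.insert i T₂).map fun R : PTree Bool =>
      if R.toTr.forget = S.forget then (colorSign R.toTr.edges : k) * listSign S.edges
        else 0).sum := by
    rw [map_list_sum, ← hLc, List.map_map, List.map_map]
    congr 1
    refine List.map_congr_left fun R hR => ?_
    have hrt := isRooted_of_mem_insert h hin hm T.2 T'.2 _ hR
    rw [Function.comp_apply, ev_ofOriented, Function.comp_apply, PTree.toTr_mapEdges,
      Tr.forget_mapE, Tr.edges_mapE, PTree.edges_toTr, listSign_of_mem_insert hin hm T.2 hR]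
    by_cases hf : R.toTr.forget = S.forget
    · have : S.IsRooted l := by rwa [← Tr.isRooted_forget, ← hf, Tr.isRooted_forget]
      simp [hf, this, hc]
    · simp [hf]
  rw [h1, sum_map_eq_sum_colorings hnd hS (fun X => (colorSign X.edges : k) * listSign S.edges)
    S.edges.toFinset.powerset fun P e => decide (e ∈ P)]
  rotate_left
  · intro P hP Q hQ h
    rw [Finset.mem_powerset] at hP hQ
    ext e
    constructor
    · intro he
      simpa [he] using h e (List.mem_toFinset.1 (hP he))
    · intro he
      simpa [he] using h e (List.mem_toFinset.1 (hQ he))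
  · intro R hR f hf
    refine ⟨S.edges.toFinset.filter fun e => f e = true,
      Finset.mem_powerset.2 (Finset.filter_subset _ _), fun e he => ?_⟩
    cases h : f e <;> simp [h, he]
  refine Finset.sum_congr rfl fun P hP => ?_
  rw [Finset.mem_powerset] at hP
  have hiff := (hmem (S.mapE fun e => decide (e ∈ P))).trans (and_congr
    (outerTree_forget_eq_iff hm P S) (innerTree_forget_eq_iff T'.2 P S))
  simp only [hiff, ev_single]
  by_cases ha : (outerTree i m P S).forget = T.1.toTr
  · by_cases hb : (innerTree i m P S).forget = T'.1.toTr
    · simp only [ha, hb, true_and, if_true, mul_one, Tr.edges_mapE, edges_outerTree,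
        edges_innerTree]
      -- The edges of `S` in `P` and those outside `P` are listed in the planar orders of the two
      -- contracted trees.
      have := colorSign_mul_listSign hS fun e => decide (e ∈ P)
      have e1 : S.edges.toFinset.filter (fun e => decide (e ∈ P) = false) = S.edges.toFinset \ P := by
        ext; simp
      have e2 : S.edges.toFinset.filter (fun e => decide (e ∈ P) = true) = P := by
        ext e
        simp only [Finset.mem_filter, decide_eq_true_eq, and_iff_right_iff_imp]
        exact fun he => hP he
      rw [e1, e2] at this
      exact_mod_cast congrArg (Int.cast : ℤ → k) this
    · simp [ha, hb, Ne.symm hb]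
  · simp [ha, Ne.symm ha]

/-- The coefficients of a composition. -/
theorem ev_comp (h : n + m = l + 1) (i : Fin n) (x : M k n) (y : M k m) {S : Tr ℕ}
    (hS : S.edges.Nodup) :
    ev S ((minimalOperad k).comp h i x y) =
      ∑ P ∈ S.edges.toFinset.powerset, (shuffleSign (S.edges.toFinset \ P) P : k) *
        (ev (outerTree i m P S) x * ev (innerTree i m P S) y) := by
  induction x using Finsupp.induction_linear with
  | zero => simp
  | add x x' hx hx' =>
    rw [map_add, LinearMap.add_apply, map_add, hx, hx', ← Finset.sum_add_distrib]
    refine Finset.sum_congr rfl fun P _ => ?_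
    rw [map_add]; ring
  | single T a =>
    induction y using Finsupp.induction_linear with
    | zero => simp
    | add y y' hy hy' =>
      rw [map_add, map_add, hy, hy', ← Finset.sum_add_distrib]
      refine Finset.sum_congr rfl fun P _ => ?_
      rw [map_add]; ring
    | single T' b =>
      have : (minimalOperad k).comp h i (Finsupp.single T a) (Finsupp.single T' b) =
          (a * b) • ((((T.1.number 0).relabel (outerIndex i m)).insert i
            ((T'.1.number T.1.size).relabel fun j => i + j)).map (ofOriented k l)).sum := by
        simp only [minimalOperad, Finsupp.linearCombination_single, LinearMap.smul_apply, mul_smul]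
      rw [this, map_smul, ev_sum_insert h i.2 T T' hS, Finset.smul_sum]
      refine Finset.sum_congr rfl fun P _ => ?_
      rw [show (Finsupp.single T a : M k n) = a • Finsupp.single T 1 by simp,
        show (Finsupp.single T' b : M k m) = b • Finsupp.single T' 1 by simp, map_smul, map_smul]
      simp only [smul_eq_mul]; ring

end

/-! ## The coefficients of the differential -/

/-- Contract the edges named `e`. -/
def contractOnly (e e' : ℕ) : Option (Finset ℕ) := if e' = e then some ∅ else none

lemma contractOnly_self (e : ℕ) : contractOnly e e = some ∅ := if_pos rfl

lemma contractOnly_of_ne {e e' : ℕ} (h : e' ≠ e) : contractOnly e e' = none := if_neg h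

/-! ### Contracting the new edge of a splitting -/

namespace Br

/-- Contract the edges named `0`. -/
def contr (F : Br ℕ) : Finset ℕ × Br ℕ := op (fun a => {a}) (contractOnly 0) F

/-- One of the branches starts with an edge named `0`. -/
def ZeroBase : Br ℕ → Prop
  | nil => False
  | cons e _ _ R => e = 0 ∨ R.ZeroBase

lemma contr_of_notMem {F : Br ℕ} (h : 0 ∉ F.edges) : contr F = (∅, F) :=
  op_id fun e he => if_neg (by rintro rfl; exact h he)

lemma contr_cons_zero (v A R) : contr (cons 0 v A R) =
    (v ∪ (contr A).1 ∪ (contr R).1, (contr A).2.app (contr R).2) := by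
  rw [contr, op_cons_some (contractOnly_self 0)]; simp [contr]

lemma contr_cons {e : ℕ} (he : e ≠ 0) (v A R) : contr (cons e v A R) =
    ((contr R).1, cons e (v ∪ (contr A).1) (contr A).2 (contr R).2) := by
  rw [contr, op_cons_none (contractOnly_of_ne he)]; simp [contr]

lemma contr_app (F G : Br ℕ) :
    contr (F.app G) = ((contr F).1 ∪ (contr G).1, (contr F).2.app (contr G).2) := op_app F G

lemma zeroBase_app {F G : Br ℕ} : (F.app G).ZeroBase ↔ F.ZeroBase ∨ G.ZeroBase := by
  induction F with
  | nil => simp [ZeroBase]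
  | cons e v A R _ ih => simp [ZeroBase, ih, or_assoc]

lemma zeroBase_of_notMem {F : Br ℕ} (h : 0 ∉ F.edges) : ¬ F.ZeroBase := by
  induction F with
  | nil => exact id
  | cons e v A R _ ih =>
    simp only [edges, List.mem_cons, List.mem_append, not_or] at h
    rintro (h0 | h0)
    · exact h.1 h0.symm
    · exact ih h.2.2 h0

lemma contr_fst_eq_empty {F : Br ℕ} (h : ¬ F.ZeroBase) : (contr F).1 = ∅ := by
  induction F with
  | nil => rfl
  | cons e v A R _ ih =>
    simp only [ZeroBase, not_or] at h
    rw [contr_cons h.1]; exact ih h.2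

lemma exists_of_zeroBase {F : Br ℕ} (h : F.ZeroBase) (h1 : F.edges.count 0 = 1) :
    ∃ (X : Br ℕ) (w : Finset ℕ) (Y Z : Br ℕ), F = X.app (cons 0 w Y Z) ∧ 0 ∉ X.edges ∧ 0 ∉ Y.edges ∧ 0 ∉ Z.edges := by
  induction F with
  | nil => exact h.elim
  | cons e v A R _ ih =>
    simp only [edges, List.count_cons, List.count_append, beq_iff_eq] at h1
    by_cases he : e = 0
    · subst he
      refine ⟨nil, v, A, R, rfl, by simp [edges], ?_, ?_⟩ <;>
      · rw [← List.count_eq_zero]; simp only [if_true] at h1; omega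
    · have hR : R.ZeroBase := h.resolve_left he
      have hA : A.edges.count 0 = 0 := by
        by_contra hA
        have : 0 ∉ R.edges := by rw [← List.count_eq_zero]; omega
        exact zeroBase_of_notMem this hR
      obtain ⟨X, w, Y, Z, rfl, h1, h2, h3⟩ := ih hR (by simp only [he, if_false] at h1; omega)
      refine ⟨cons e v A X, w, Y, Z, rfl, ?_, h2, h3⟩
      simp only [edges, List.mem_cons, List.mem_append, not_or]
      exact ⟨Ne.symm he, List.count_eq_zero.1 hA, h1⟩

end Br

lemma mem_vertexSplits {v : Option ℕ} {A : Branches ℕ} {p : Option ℕ × Branches ℕ} :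
    p ∈ vertexSplits v A ↔ ∃ X Y Z : Branches ℕ, X.append (Y.append Z) = A ∧
      (p = (v, X.append (.cons 0 none Y Z)) ∨ v ≠ none ∧ p = (none, X.append (.cons 0 v Y Z))) := by
  simp only [vertexSplits, List.mem_append, List.mem_map, Prod.exists, Branches.mem_cuts₃]
  constructor
  · rintro (⟨X, Y, Z, h, rfl⟩ | h)
    · exact ⟨X, Y, Z, h, Or.inl rfl⟩
    · split_ifs at h with hv
      · simp at h
      · simp only [List.mem_map, Prod.exists, Branches.mem_cuts₃] at h
        obtain ⟨X, Y, Z, h, rfl⟩ := h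
        exact ⟨X, Y, Z, h, Or.inr ⟨hv, rfl⟩⟩
  · rintro ⟨X, Y, Z, h, rfl | ⟨hv, rfl⟩⟩
    · exact Or.inl ⟨X, Y, Z, h, rfl⟩
    · right
      simp only [hv, if_false, List.mem_map, Prod.exists, Branches.mem_cuts₃]
      exact ⟨X, Y, Z, h, rfl⟩

/-- The new edge shows the cut. The two kinds of splitting are told apart by the vertex with the
outgoing flag, which is black in the second kind; this kind occurs for white vertices only. -/
lemma nodup_vertexSplits (v : Option ℕ) {A : Branches ℕ} (hA : 0 ∉ A.edges) :
    (vertexSplits v A).Nodup := by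
  have key : ∀ u w : Option ℕ, (A.cuts₃.map fun p =>
      (u, p.1.append (.cons 0 w p.2.1 p.2.2))).Nodup := by
    intro u w
    refine A.nodup_cuts₃.map_on ?_
    rintro ⟨X, Y, Z⟩ hp ⟨X', Y', Z'⟩ hp' h
    rw [Branches.mem_cuts₃] at hp hp'
    have h1 : 0 ∉ X.edges := fun h => hA (by rw [← hp, Branches.edges_append]; simp [h])
    have h2 : 0 ∉ X'.edges := fun h => hA (by rw [← hp', Branches.edges_append]; simp [h])
    obtain ⟨rfl, h3⟩ := Branches.append_cons_inj h1 h2 (congrArg Prod.snd h)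
    simp at h3
    simp [h3]
  rw [vertexSplits]
  split_ifs with hv
  · simpa using key v none
  · refine List.nodup_append.2 ⟨key _ _, key _ _, ?_⟩
    rintro a ha b hb rfl
    simp only [List.mem_map] at ha hb
    obtain ⟨_, _, rfl⟩ := ha
    obtain ⟨_, _, h⟩ := hb
    exact hv (congrArg Prod.fst h).symm

lemma vertexSplits_mapEdges {f : ℕ → ℕ} (hf : f 0 = 0) (v : Option ℕ) (A : Branches ℕ) :
    vertexSplits v (A.mapEdges f) = (vertexSplits v A).map fun p => (p.1, p.2.mapEdges f) := by
  simp only [vertexSplits, Branches.cuts₃_mapEdges, List.map_map, List.map_append]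
  congr 1
  · simp [Function.comp_def, Branches.mapEdges_append, Branches.mapEdges, hf]
  · split_ifs
    · rfl
    · simp [Function.comp_def, Branches.mapEdges_append, Branches.mapEdges, hf]

/-- The properties of a vertex after splitting off a black vertex. -/
lemma of_mem_vertexSplits {v : Option ℕ} {A : Branches ℕ} (hA : 0 ∉ A.edges)
    {p : Option ℕ × Branches ℕ} (hp : p ∈ vertexSplits v A) :
    p.2.edges.filter (fun e => !decide (e = 0)) = A.edges ∧ p.2.edges.count 0 = 1 ∧
      p.2.toBr.ZeroBase ∧ p.1.toFinset ∪ (Br.contr p.2.toBr).1 = v.toFinset ∧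
      (Br.contr p.2.toBr).2 = A.toBr ∧
      ((p.1.toList ++ p.2.whites : List ℕ) : Multiset ℕ) = (v.toList ++ A.whites : List ℕ) := by
  obtain ⟨X, Y, Z, rfl, h⟩ := mem_vertexSplits.1 hp
  simp only [Branches.edges_append, List.mem_append, not_or] at hA
  have hf : ∀ B : Branches ℕ, 0 ∉ B.edges → B.edges.filter (fun e => !decide (e = 0)) = B.edges ∧
      B.edges.count 0 = 0 ∧ Br.contr B.toBr = (∅, B.toBr) := fun B hB =>
    ⟨List.filter_eq_self.2 fun e he => by simp; rintro rfl; exact hB he, List.count_eq_zero.2 hB,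
      Br.contr_of_notMem (by simpa using hB)⟩
  obtain ⟨x1, x2, x3⟩ := hf X hA.1
  obtain ⟨y1, y2, y3⟩ := hf Y hA.2.1
  obtain ⟨z1, z2, z3⟩ := hf Z hA.2.2
  rcases h with rfl | ⟨-, rfl⟩
  · refine ⟨?_, ?_, ?_, ?_, ?_, ?_⟩
    · simp [Branches.edges_append, Branches.edges, x1, y1, z1]
    · simp [Branches.edges_append, Branches.edges, x2, y2, z2]
    · simp [Branches.toBr, Br.zeroBase_app, Br.ZeroBase]
    · simp [Branches.toBr, Br.contr_app, x3, y3, z3, Br.contr_cons_zero]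
    · simp [Branches.toBr, Br.contr_app, x3, y3, z3, Br.contr_cons_zero]
    · simp [Branches.whites_append, Branches.whites]
  · refine ⟨?_, ?_, ?_, ?_, ?_, ?_⟩
    · simp [Branches.edges_append, Branches.edges, x1, y1, z1]
    · simp [Branches.edges_append, Branches.edges, x2, y2, z2]
    · simp [Branches.toBr, Br.zeroBase_app, Br.ZeroBase]
    · simp [Branches.toBr, Br.contr_app, x3, y3, z3, Br.contr_cons_zero]
    · simp [Branches.toBr, Br.contr_app, x3, y3, z3, Br.contr_cons_zero]
    · simp only [Branches.whites_append, Branches.whites, ← Multiset.coe_add, Option.toList_none,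
        Multiset.coe_nil]
      abel

/-- The contracted vertex has at most one label and the two ends of the new edge share none, so one
of them is black. Which one decides between the two kinds of splitting. -/
lemma exists_mem_vertexSplits {v : Option ℕ} {A : Branches ℕ} {u : Finset ℕ} {F : Br ℕ}
    (h1 : F.edges.count 0 = 1) (hF : F.ZeroBase) (hs : ∀ b ∈ u, F.cnt b = 0)
    (hv : u ∪ (Br.contr F).1 = v.toFinset) (hA : (Br.contr F).2 = A.toBr) :
    ∃ p ∈ vertexSplits v A, p.1.toFinset = u ∧ p.2.toBr = F := by
  obtain ⟨X, w, Y, Z, rfl, hX, hY, hZ⟩ := Br.exists_of_zeroBase hF h1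
  have hw : Disjoint u w := Finset.disjoint_left.2 fun b hb hb' => by
    have := hs b hb
    simp [Br.cnt, hb'] at this
  rw [Br.contr_app, Br.contr_cons_zero,
    Br.contr_of_notMem hX, Br.contr_of_notMem hY, Br.contr_of_notMem hZ] at hv hA
  simp only [Finset.empty_union, Finset.union_empty] at hv hA
  obtain ⟨X', B, rfl, rfl, hB⟩ := Branches.exists_append_of_toBr_eq hA.symm
  obtain ⟨Y', Z', rfl, rfl, rfl⟩ := Branches.exists_append_of_toBr_eq hB
  have hcases : (u = v.toFinset ∧ w = ∅) ∨ v ≠ none ∧ u = ∅ ∧ w = v.toFinset := by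
    cases v with
    | none =>
      rw [Option.toFinset_none, Finset.union_eq_empty] at hv
      exact Or.inl ⟨by simpa using hv.1, hv.2⟩
    | some a =>
      simp only [Option.toFinset_some] at hv ⊢
      have hu : u ⊆ {a} := hv ▸ Finset.subset_union_left
      rcases Finset.subset_singleton_iff.1 hu with rfl | rfl
      · exact Or.inr ⟨by simp, rfl, by simpa using hv⟩
      · left
        refine ⟨rfl, ?_⟩
        have hw' : w ⊆ {a} := hv ▸ Finset.subset_union_right
        rcases Finset.subset_singleton_iff.1 hw' with rfl | rfl
        · rfl
        · simp at hw
  rcases hcases with ⟨rfl, rfl⟩ | ⟨hv0, rfl, rfl⟩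
  · exact ⟨_, mem_vertexSplits.2 ⟨X', Y', Z', rfl, Or.inl rfl⟩, rfl, by simp [Branches.toBr]⟩
  · exact ⟨_, mem_vertexSplits.2 ⟨X', Y', Z', rfl, Or.inr ⟨hv0, rfl⟩⟩, rfl, by simp [Branches.toBr]⟩

namespace Branches

lemma blowups_mapEdges {f : ℕ → ℕ} (hf : f 0 = 0) (A : Branches ℕ) :
    (A.mapEdges f).blowups = A.blowups.map (mapEdges f) := by
  induction A with
  | nil => rfl
  | cons e v A R ih1 ih2 =>
    simp [blowups, mapEdges, ih1, ih2, vertexSplits_mapEdges hf, Function.comp_def]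

lemma of_mem_blowups {A R : Branches ℕ} (hA : 0 ∉ A.edges) (hR : R ∈ A.blowups) :
    R.edges.filter (fun e => !decide (e = 0)) = A.edges ∧ R.edges.count 0 = 1 ∧
      ¬ R.toBr.ZeroBase ∧ Br.contr R.toBr = (∅, A.toBr) ∧
      (R.whites : Multiset ℕ) = A.whites := by
  induction A generalizing R with
  | nil => simp [blowups] at hR
  | cons e v A B ih1 ih2 =>
    simp only [edges, List.mem_cons, List.mem_append, not_or] at hA
    obtain ⟨he, hA, hB⟩ := hA
    have he' : e ≠ 0 := Ne.symm he
    have hf : ∀ B : Branches ℕ, 0 ∉ B.edges → B.edges.filter (fun e => !decide (e = 0)) = B.edges ∧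
        B.edges.count 0 = 0 ∧ Br.contr B.toBr = (∅, B.toBr) ∧ ¬ B.toBr.ZeroBase := fun B hB =>
      ⟨List.filter_eq_self.2 fun e he => by simp; rintro rfl; exact hB he, List.count_eq_zero.2 hB,
        Br.contr_of_notMem (by simpa using hB), Br.zeroBase_of_notMem (by simpa using hB)⟩
    obtain ⟨a1, a2, a3, -⟩ := hf A hA
    obtain ⟨b1, b2, b3, b4⟩ := hf B hB
    simp only [blowups, List.mem_append, List.mem_map] at hR
    rcases hR with ⟨p, hp, rfl⟩ | ⟨A', hA', rfl⟩ | ⟨B', hB', rfl⟩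
    · obtain ⟨p1, p2, -, p4, p5, p6⟩ := of_mem_vertexSplits hA hp
      refine ⟨by simpa [edges, he', b1] using p1, by simp [edges, he', p2, b2], ?_, ?_, ?_⟩
      · rintro (h | h)
        · exact he' h
        · exact b4 h
      · rw [toBr, Br.contr_cons he', b3, p4, p5]; rfl
      · simp only [whites, ← Multiset.coe_add, ← add_assoc] at p6 ⊢
        rw [p6]
    · obtain ⟨p1, p2, -, p4, p6⟩ := ih1 hA hA'
      refine ⟨by simpa [edges, he', b1] using p1, by simp [edges, he', p2, b2], ?_, ?_, ?_⟩
      · rintro (h | h)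
        · exact he' h
        · exact b4 h
      · rw [toBr, Br.contr_cons he', b3, p4]; simp [toBr]
      · simp only [whites, ← Multiset.coe_add, p6]
    · obtain ⟨p1, p2, p3, p4, p6⟩ := ih2 hB hB'
      refine ⟨by simpa [edges, he', a1] using p1, by simp [edges, he', p2, a2], ?_, ?_, ?_⟩
      · rintro (h | h)
        · exact he' h
        · exact p3 h
      · rw [toBr, Br.contr_cons he', a3, p4]; simp [toBr]
      · simp only [whites, ← Multiset.coe_add, p6]

/-- The edge `0` is either in the later branches, or starts at the first vertex, or lies higher up;
these are the three kinds of summands of the recursion. If it started at the base it would belong to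
a splitting of the vertex below. -/
lemma exists_mem_blowups {A : Branches ℕ} {F : Br ℕ} (h1 : F.edges.count 0 = 1)
    (hF : ¬ F.ZeroBase) (hs : ∀ b, F.cnt b ≤ 1) (hA : Br.contr F = (∅, A.toBr)) :
    ∃ R ∈ A.blowups, R.toBr = F := by
  induction F generalizing A with
  | nil => simp [Br.edges] at h1
  | cons e u FA FR ih1 ih2 =>
    simp only [Br.ZeroBase, not_or] at hF
    simp only [Br.edges, List.count_cons, List.count_append, beq_iff_eq, hF.1, if_false,
      add_zero] at h1
    rw [Br.contr_cons hF.1] at hA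
    rcases A with _ | ⟨e', v, A, R⟩
    · simp [toBr] at hA
    simp only [toBr, Prod.mk.injEq, Br.cons.injEq] at hA
    obtain ⟨hR1, rfl, hv, hA, hR⟩ := hA
    simp only [blowups, List.mem_append, List.mem_map]
    by_cases h0 : FR.edges.count 0 = 0
    · rw [Br.contr_of_notMem (List.count_eq_zero.1 h0)] at hR
      simp only at hR
      subst hR
      by_cases hb : FA.ZeroBase
      · obtain ⟨p, hp, rfl, rfl⟩ := exists_mem_vertexSplits (by omega) hb (fun b hb => by
          have := hs b
          simp only [Br.cnt, hb, if_true] at this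
          omega) hv hA
        exact ⟨_, Or.inl ⟨p, hp, rfl⟩, rfl⟩
      · have hc := Br.contr_fst_eq_empty hb
        obtain ⟨A', hA', rfl⟩ := ih1 (A := A) (by omega) hb (fun b => by
          have := hs b; simp only [Br.cnt] at this; omega) (Prod.ext hc hA)
        rw [hc, Finset.union_empty] at hv
        subst hv
        exact ⟨_, Or.inr (Or.inl ⟨A', hA', rfl⟩), rfl⟩
    · have h2 : 0 ∉ FA.edges := List.count_eq_zero.1 (by omega)
      rw [Br.contr_of_notMem h2] at hA hv
      simp only [Finset.union_empty] at hA hv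
      subst hA hv
      obtain ⟨R', hR', rfl⟩ := ih2 (A := R) (by omega) hF.2 (fun b => by
          have := hs b; simp only [Br.cnt] at this; omega) (Prod.ext hR1 hR)
      exact ⟨_, Or.inr (Or.inr ⟨R', hR', rfl⟩), rfl⟩

lemma nodup_blowups {A : Branches ℕ} (hA : 0 ∉ A.edges) : A.blowups.Nodup := by
  induction A with
  | nil => simp [blowups]
  | cons e v A B ih1 ih2 =>
    simp only [edges, List.mem_cons, List.mem_append, not_or] at hA
    obtain ⟨he, hA, hB⟩ := hA
    rw [blowups, List.nodup_append, List.nodup_append]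
    refine ⟨(nodup_vertexSplits v hA).map ?_, ⟨(ih1 hA).map ?_, (ih2 hB).map ?_, ?_⟩, ?_⟩
    · rintro ⟨a, b⟩ ⟨c, d⟩ h; simpa using h
    · rintro a b h; simpa using h
    · rintro a b h; simpa using h
    · intro x hx y hy hxy
      subst hxy
      simp only [List.mem_map] at hx hy
      obtain ⟨A', -, rfl⟩ := hx
      obtain ⟨B', hB', h⟩ := hy
      simp only [cons.injEq, true_and] at h
      obtain ⟨-, rfl⟩ := h
      have := (of_mem_blowups hB hB').2.1
      rw [List.count_eq_zero.2 hB] at this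
      omega
    · intro x hx y hy hxy
      subst hxy
      simp only [List.mem_map, List.mem_append] at hx hy
      obtain ⟨p, hp, rfl⟩ := hx
      rcases hy with ⟨A', hA', h⟩ | ⟨B', hB', h⟩
      · simp only [cons.injEq, true_and, and_true] at h
        obtain ⟨-, rfl⟩ := h
        exact (of_mem_blowups hA hA').2.2.1 (of_mem_vertexSplits hA hp).2.2.1
      · simp only [cons.injEq, true_and] at h
        obtain ⟨-, -, rfl⟩ := h
        have := (of_mem_blowups hB hB').2.1
        rw [List.count_eq_zero.2 hB] at this
        omega

end Branches

namespace PTree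

lemma blowups_mapEdges {f : ℕ → ℕ} (hf : f 0 = 0) (T : PTree ℕ) :
    (T.mapEdges f).blowups = T.blowups.map (mapEdges f) := by
  simp [blowups, mapEdges, vertexSplits_mapEdges hf, Branches.blowups_mapEdges hf,
    Function.comp_def]

lemma of_mem_blowups {T R : PTree ℕ} (hT : 0 ∉ T.edges) (hR : R ∈ T.blowups) :
    R.edges.filter (fun e => !decide (e = 0)) = T.edges ∧ R.edges.count 0 = 1 ∧
      R.toTr.op (fun a => {a}) (contractOnly 0) = T.toTr ∧
      (R.whites : Multiset ℕ) = T.whites := by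
  simp only [blowups, List.mem_append, List.mem_map] at hR
  rcases hR with ⟨p, hp, rfl⟩ | ⟨F, hF, rfl⟩
  · obtain ⟨h1, h2, -, h4, h5, h6⟩ := of_mem_vertexSplits hT hp
    exact ⟨h1, h2, by simpa [Tr.op, toTr] using ⟨h4, h5⟩, h6⟩
  · obtain ⟨h1, h2, -, h4, h5⟩ := Branches.of_mem_blowups hT hF
    refine ⟨h1, h2, ?_, ?_⟩
    · rw [Tr.op, toTr, ← Br.contr.eq_1]; simp [h4, toTr]
    · simp only [whites, ← Multiset.coe_add, h5]

lemma exists_mem_blowups {T : PTree ℕ} {S : Tr ℕ} (h1 : S.edges.count 0 = 1)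
    (hs : ∀ b, S.cnt b ≤ 1) (hT : S.op (fun a => {a}) (contractOnly 0) = T.toTr) :
    ∃ R ∈ T.blowups, R.toTr = S := by
  obtain ⟨u, F⟩ := S
  obtain ⟨v, A⟩ := T
  rw [Tr.op, ← Br.contr.eq_1] at hT
  simp only [toTr, Finset.biUnion_singleton_eq_self, Prod.mk.injEq] at hT
  simp only [blowups, List.mem_append, List.mem_map]
  by_cases hb : F.ZeroBase
  · obtain ⟨p, hp, rfl, rfl⟩ := exists_mem_vertexSplits h1 hb (fun b hb => by
      have h : (if b ∈ u then 1 else 0) + F.cnt b ≤ 1 := hs b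
      rw [if_pos hb] at h
      change F.cnt b = 0
      omega) hT.1 hT.2
    exact ⟨_, Or.inl ⟨p, hp, rfl⟩, rfl⟩
  · have hc := Br.contr_fst_eq_empty hb
    obtain ⟨R, hR, rfl⟩ := Branches.exists_mem_blowups h1 hb (fun b => by
      exact (Nat.le_add_left _ _).trans (hs b)) (Prod.ext hc hT.2)
    rw [hc, Finset.union_empty] at hT
    exact ⟨_, Or.inr ⟨R, hR, rfl⟩, by rw [hT.1]; rfl⟩

lemma nodup_blowups {T : PTree ℕ} (hT : 0 ∉ T.edges) : T.blowups.Nodup := by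
  rw [blowups, List.nodup_append]
  refine ⟨(nodup_vertexSplits _ hT).map ?_, (Branches.nodup_blowups hT).map ?_, ?_⟩
  · rintro ⟨a, b⟩ ⟨c, d⟩ h; simpa using h
  · rintro a b h; simpa using h
  · intro x hx y hy hxy
    subst hxy
    simp only [List.mem_map] at hx hy
    obtain ⟨p, hp, rfl⟩ := hx
    obtain ⟨F, hF, h⟩ := hy
    simp only [mk.injEq] at h
    obtain ⟨-, rfl⟩ := h
    exact (Branches.of_mem_blowups hT hF).2.2.1 (of_mem_vertexSplits hT hp).2.2.1

end PTree

/-! ### From splittings to edge contractions -/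

section

variable {n : ℕ}

/-- No two vertices carry the same label. -/
def Tr.Separated {ε : Type} (S : Tr ε) : Prop := ∀ b, S.cnt b ≤ 1

/-- Contract the edge `e`. -/
def contractEdge (e : ℕ) (S : Tr ℕ) : Tr ℕ :=
  S.op (fun a => {a}) (contractOnly e)

lemma edges_contractEdge (e : ℕ) (S : Tr ℕ) :
    (contractEdge e S).edges = S.edges.filter fun e' => decide (e' ≠ e) := by
  rw [contractEdge, Tr.edges_op]
  exact List.filter_congr fun e' _ => by by_cases h : e' = e <;> simp [contractOnly, h]

lemma contractEdge_forget_eq_iff (T : PTree Unit) (e : ℕ) (S : Tr ℕ) :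
    (S.mapE fun e' => if e' = e then 0 else 1).op (fun a => {a}) (contractOnly 0) =
      (T.mapEdges fun _ => 1).toTr ↔ (contractEdge e S).forget = T.toTr := by
  have h1 : (S.mapE fun e' => if e' = e then 0 else 1).op (fun a => {a}) (contractOnly 0) =
      (contractEdge e S).mapE fun _ => 1 := by
    rw [Tr.op_mapE, contractEdge]
    have : (contractOnly 0) ∘ (fun e' => if e' = e then 0 else 1) =
        contractOnly e := by
      funext e'; by_cases he : e' = e <;> simp [contractOnly, he]
    rw [this]
    refine Tr.mapE_congr fun e' he => ?_
    rw [Tr.edges_op, List.mem_filter] at he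
    by_cases h : e' = e <;> simp_all [contractOnly]
  rw [h1, PTree.toTr_mapEdges, Tr.mapE_const_eq_iff, ← PTree.toTr_forget, PTree.forget_unit]

/-- The new edge has the smallest name and the old edges stay in increasing order, so the inversions
are the old edges preceding the new one. -/
lemma listSign_of_mem_blowups (T : PTree Unit) {R : PTree ℕ} (hR : R ∈ (T.number 1).blowups) :
    listSign R.edges = colorSign (R.edges.map fun a => !decide (a = 0)) := by
  have h0 : 0 ∉ (T.number 1).edges := by
    rw [PTree.edges_number, List.mem_range'_1]; omega
  obtain ⟨h1, h2, -⟩ := PTree.of_mem_blowups h0 hR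
  rw [PTree.edges_number] at h1
  have h3 : R.edges.filter (fun a => !!decide (a = 0)) = [0] := by
    have : R.edges.filter (fun a => !!decide (a = 0)) = R.edges.filter (· == 0) :=
      List.filter_congr fun a _ => by by_cases h : a = 0 <;> simp [h]
    rw [this, List.filter_beq, h2]; rfl
  have hnd : R.edges.Nodup := by
    have := (List.filter_append_perm (fun a => !decide (a = 0)) R.edges).symm
    rw [this.nodup_iff, h1, h3, List.nodup_append]
    refine ⟨List.nodup_range', by simp, ?_⟩
    intro a ha b hb
    rw [List.mem_range'_1] at ha; simp at hb; omega
  have h := colorSign_mul_listSign hnd fun a => !decide (a = 0)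
  rw [h1, h3, listSign_of_sorted List.pairwise_lt_range', listSign_of_sorted (List.pairwise_singleton _ _),
    show shuffleSign _ _ = 1 from Finset.prod_eq_one fun a ha => Finset.prod_eq_one fun b hb => by
      simp only [Finset.mem_filter] at ha hb
      have : a = 0 := by simpa using ha.2
      unfold pairSign; rw [if_neg (by omega)]] at h
  linear_combination colorSign (R.edges.map fun a => !decide (a = 0)) *
    listSign_mul_self R.edges - listSign R.edges * h

variable {k : Type*} [Field k]

/-- The splittings of `T` with underlying tree `S` correspond to the edges of `S` whose contraction
gives `T`. A label on both ends of an edge could not be produced by a splitting, which is why `S`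
has to be separated; stability ensures that the splittings counted here are not discarded as
unstable. -/
lemma ev_sum_blowups (T : RootedTree n) {S : Tr ℕ} (hS : S.edges.Nodup) (hs : S.Separated)
    (hst : S.Stable) :
    ev S (((T.1.number 1).blowups.map (ofOriented k n)).sum) =
      ∑ e ∈ S.edges.toFinset, (shuffleSign {e} (S.edges.toFinset.erase e) : k) *
        ev (contractEdge e S) (Finsupp.single T 1 : M k n) := by
  classical
  have h0 : 0 ∉ (T.1.number 1).edges := by
    rw [PTree.edges_number, List.mem_range'_1]; omega
  have h0' : 0 ∉ (T.1.mapEdges fun _ => (1 : ℕ)).edges := by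
    rw [PTree.edges_mapEdges]; simp
  set c : ℕ → ℕ := fun a => if a = 0 then 0 else 1 with hc
  have hLc : (T.1.number 1).blowups.map (PTree.mapEdges c) =
      (T.1.mapEdges fun _ => 1).blowups := by
    rw [← PTree.blowups_mapEdges rfl, ← PTree.mapEdges_const_number 1 T.1 1]
    congr 1
    refine PTree.mapEdges_congr fun e he => ?_
    rw [PTree.edges_number, List.mem_range'_1] at he
    simp [hc]; omega
  have h1 : ev S (((T.1.number 1).blowups.map (ofOriented k n)).sum) =
      ((T.1.mapEdges fun _ => 1).blowups.map fun R : PTree ℕ =>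
      if R.toTr.forget = S.forget then
        (colorSign (R.toTr.edges.map fun a => !decide (a = 0)) : k) * listSign S.edges
        else 0).sum := by
    rw [map_list_sum, ← hLc, List.map_map, List.map_map]
    congr 1
    refine List.map_congr_left fun R hR => ?_
    rw [Function.comp_apply, ev_ofOriented, Function.comp_apply, PTree.toTr_mapEdges,
      Tr.forget_mapE, Tr.edges_mapE, PTree.edges_toTr, listSign_of_mem_blowups T.1 hR]
    by_cases hf : R.toTr.forget = S.forget
    · have hrt : R.toTr.IsRooted n := by
        refine ⟨PTree.simple_toTr _, fun b => ?_, by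
          rwa [← Tr.stable_forget, hf, Tr.stable_forget]⟩
        have hw := (PTree.of_mem_blowups h0 hR).2.2.2
        rw [PTree.whites_number, Multiset.coe_eq_coe] at hw
        rw [PTree.cnt_toTr, hw.count_eq, T.2.1.count_eq, List.nodup_range.count]
        simp
      have : S.IsRooted n := by rwa [← Tr.isRooted_forget, ← hf, Tr.isRooted_forget]
      have hcc : ∀ l : List ℕ, (l.map c).map (fun a => !decide (a = 0)) =
          l.map fun a => !decide (a = 0) := fun l => by
        rw [List.map_map]
        refine List.map_congr_left fun a _ => ?_
        by_cases h : a = 0 <;> simp [hc, h]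
      simp only [hf, this, hcc, true_and, if_true]
    · simp [hf]
  have hnd : (T.1.mapEdges fun _ => (1 : ℕ)).blowups.Nodup := PTree.nodup_blowups h0'
  rw [h1, sum_map_eq_sum_colorings hnd hS (fun X : Tr ℕ =>
      (colorSign (X.edges.map fun a => !decide (a = 0)) : k) * listSign S.edges)
    S.edges.toFinset fun e e' => if e' = e then 0 else 1]
  rotate_left
  · intro e he e' _ h
    have := h e (List.mem_toFinset.1 he)
    by_contra hne
    simp [hne] at this
  -- The name `0` occurs once in `R`; the edge of `S` at this place is the one to be contracted.
  · intro R hR f hf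
    obtain ⟨h1, h2, -⟩ := PTree.of_mem_blowups h0' hR
    have hRe : R.edges = S.edges.map f := by
      rw [← PTree.edges_toTr, hf, Tr.edges_mapE]
    rw [hRe, List.count, List.countP_map, List.countP_eq_length_filter,
      List.length_eq_one_iff] at h2
    obtain ⟨e, he⟩ := h2
    have hmem : ∀ a, (a ∈ S.edges ∧ f a = 0) ↔ a = e := fun a => by
      have : a ∈ S.edges.filter ((· == 0) ∘ f) ↔ a ∈ [e] := by rw [he]
      simpa using this
    refine ⟨e, List.mem_toFinset.2 ((hmem e).2 rfl).1, fun a ha => ?_⟩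
    by_cases hae : a = e
    · rw [if_pos hae, ((hmem a).2 hae).2]
    · rw [if_neg hae]
      have hfa : f a ≠ 0 := fun h => hae ((hmem a).1 ⟨ha, h⟩)
      have : f a ∈ R.edges.filter fun e => !decide (e = 0) := by
        rw [hRe, List.mem_filter]
        exact ⟨List.mem_map_of_mem ha, by simp [hfa]⟩
      rw [h1, PTree.edges_mapEdges, List.mem_map] at this
      obtain ⟨_, -, h⟩ := this
      exact h.symm
  refine Finset.sum_congr rfl fun e he => ?_
  have he' := List.mem_toFinset.1 he
  have hiff : (∃ R ∈ (T.1.mapEdges fun _ => (1 : ℕ)).blowups,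
      R.toTr = S.mapE fun e' => if e' = e then 0 else 1) ↔
      (contractEdge e S).forget = T.1.toTr := by
    rw [← contractEdge_forget_eq_iff]
    constructor
    · rintro ⟨R, hR, h⟩
      rw [← h]
      exact (PTree.of_mem_blowups h0' hR).2.2.1
    · refine PTree.exists_mem_blowups ?_ fun b => ?_
      · rw [Tr.edges_mapE, List.count, List.countP_map]
        refine Eq.trans ?_ (List.count_eq_one_of_mem hS he')
        refine List.countP_congr fun a _ => ?_
        simp only [Function.comp_apply, beq_iff_eq]
        by_cases h : a = e <;> simp [h]
      · rw [Tr.cnt_mapE]; exact hs b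
  simp only [hiff, ev_single]
  by_cases hf : (contractEdge e S).forget = T.1.toTr
  · simp only [hf, if_true, mul_one, Tr.edges_mapE, edges_contractEdge]
    have hsg := colorSign_mul_listSign hS fun a => decide (a ≠ e)
    have e1 : S.edges.toFinset.filter (fun a => decide (a ≠ e) = false) = {e} := by
      ext a; simp only [Finset.mem_filter, Finset.mem_singleton]
      constructor
      · rintro ⟨-, h⟩; simpa using h
      · rintro rfl; exact ⟨he, by simp⟩
    have e2 : S.edges.toFinset.filter (fun a => decide (a ≠ e) = true) =
        S.edges.toFinset.erase e := by
      ext a; simp [and_comm]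
    have e3 : S.edges.filter (fun a => !decide (a ≠ e)) = [e] := by
      have : S.edges.filter (fun a => !decide (a ≠ e)) = S.edges.filter (· == e) :=
        List.filter_congr fun a _ => by by_cases h : a = e <;> simp [h]
      rw [this, List.filter_beq, List.count_eq_one_of_mem hS he']; rfl
    rw [e1, e2, e3, listSign_of_sorted (List.pairwise_singleton _ _), one_mul] at hsg
    have e4 : (S.edges.map fun e' => if e' = e then 0 else 1).map (fun a => !decide (a = 0)) =
        S.edges.map fun a => decide (a ≠ e) := by
      rw [List.map_map]
      refine List.map_congr_left fun a _ => ?_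
      by_cases h : a = e <;> simp [h]
    rw [e4]
    exact_mod_cast congrArg (Int.cast : ℤ → k) hsg
  · simp [hf, Ne.symm hf]

/-- The coefficients of the differential. -/
theorem ev_d (x : M k n) {S : Tr ℕ} (hS : S.edges.Nodup) (hs : S.Separated) (hst : S.Stable) :
    ev S ((minimalOperad k).d n x) =
      ∑ e ∈ S.edges.toFinset, (shuffleSign {e} (S.edges.toFinset.erase e) : k) *
        ev (contractEdge e S) x := by
  induction x using Finsupp.induction_linear with
  | zero => simp
  | add x x' hx hx' =>
    rw [map_add, map_add, hx, hx', ← Finset.sum_add_distrib]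
    refine Finset.sum_congr rfl fun e _ => ?_
    rw [map_add]; ring
  | single T a =>
    have : (minimalOperad k).d n (Finsupp.single T a) =
        a • ((T.1.number 1).blowups.map (ofOriented k n)).sum := by
      simp only [minimalOperad, Finsupp.linearCombination_single]
    rw [this, map_smul, ev_sum_blowups T hS hs hst, Finset.smul_sum]
    refine Finset.sum_congr rfl fun e _ => ?_
    rw [show (Finsupp.single T a : M k n) = a • Finsupp.single T 1 by simp, map_smul]
    simp only [smul_eq_mul]; ring

end

/-! ## Edges with labels on both sides -/

namespace Br

variable {ε : Type} {g : ℕ → Finset ℕ} {h : ε → Option (Finset ℕ)}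

lemma eq_nil_of_edges {F : Br ε} (hF : F.edges = []) : F = nil := by
  cases F with
  | nil => rfl
  | cons => simp [edges] at hF

/-- Together with `of_mem_op` this traces labels through a contraction: none disappears before it is
relabeled, and none appears without a source. -/
lemma mem_op_or {F : Br ε} {a b : ℕ} (ha : 0 < F.cnt a) (hb : b ∈ g a) :
    b ∈ (op g h F).1 ∨ 0 < (op g h F).2.cnt b := by
  induction F with
  | nil => simp [cnt] at ha
  | cons e v A R ih1 ih2 =>
    have hv : a ∈ v → b ∈ v.biUnion g := fun hv => Finset.mem_biUnion.2 ⟨a, hv, hb⟩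
    simp only [cnt] at ha
    have : a ∈ v ∨ 0 < A.cnt a ∨ 0 < R.cnt a := by
      by_cases h : a ∈ v
      · exact Or.inl h
      · simp only [h, if_false] at ha; omega
    cases he : h e with
    | none =>
      rw [op_cons_none he]
      simp only [cnt, Finset.mem_union]
      rcases this with h1 | h1 | h1
      · right; simp only [hv h1, true_or, if_true]; omega
      · right
        rcases ih1 h1 with h2 | h2
        · simp only [h2, or_true, if_true]; omega
        · omega
      · rcases ih2 h1 with h2 | h2
        · exact Or.inl h2
        · right; omega
    | some l =>
      rw [op_cons_some he]
      simp only [cnt_app, Finset.mem_union]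
      rcases this with h1 | h1 | h1
      · exact Or.inl (Or.inl (Or.inr (Or.inl (hv h1))))
      · rcases ih1 h1 with h2 | h2
        · exact Or.inl (Or.inl (Or.inr (Or.inr h2)))
        · right; omega
      · rcases ih2 h1 with h2 | h2
        · exact Or.inl (Or.inr h2)
        · right; omega

lemma of_mem_op {F : Br ε} {b : ℕ} (hb : b ∈ (op g h F).1 ∨ 0 < (op g h F).2.cnt b) :
    (∃ a, 0 < F.cnt a ∧ b ∈ g a) ∨ ∃ e ∈ F.edges, ∃ l, h e = some l ∧ b ∈ l := by
  induction F with
  | nil => simp [cnt] at hb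
  | cons e v A R ih1 ih2 =>
    have hA : (b ∈ (op g h A).1 ∨ 0 < (op g h A).2.cnt b) →
        (∃ a, 0 < (cons e v A R).cnt a ∧ b ∈ g a) ∨
          ∃ e' ∈ (cons e v A R).edges, ∃ l, h e' = some l ∧ b ∈ l := fun h => by
      rcases ih1 h with ⟨a, ha, h'⟩ | ⟨e', he', h'⟩
      · exact Or.inl ⟨a, by simp only [cnt]; omega, h'⟩
      · exact Or.inr ⟨e', by simp [edges, he'], h'⟩
    have hR : (b ∈ (op g h R).1 ∨ 0 < (op g h R).2.cnt b) →
        (∃ a, 0 < (cons e v A R).cnt a ∧ b ∈ g a) ∨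
          ∃ e' ∈ (cons e v A R).edges, ∃ l, h e' = some l ∧ b ∈ l := fun h => by
      rcases ih2 h with ⟨a, ha, h'⟩ | ⟨e', he', h'⟩
      · exact Or.inl ⟨a, by simp only [cnt]; omega, h'⟩
      · exact Or.inr ⟨e', by simp [edges, he'], h'⟩
    have hv : b ∈ v.biUnion g → ∃ a, 0 < (cons e v A R).cnt a ∧ b ∈ g a := fun hv => by
      obtain ⟨a, ha, hb⟩ := Finset.mem_biUnion.1 hv
      exact ⟨a, by simp [cnt, ha], hb⟩
    cases he : h e with
    | none =>
      rw [op_cons_none he] at hb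
      simp only [cnt, Finset.mem_union] at hb
      by_cases h1 : b ∈ v.biUnion g
      · exact Or.inl (hv h1)
      by_cases h2 : b ∈ (op g h A).1
      · exact hA (Or.inl h2)
      simp only [h1, h2, or_self, if_false, zero_add] at hb
      rcases hb with hb | hb
      · exact hR (Or.inl hb)
      · by_cases h3 : 0 < (op g h A).2.cnt b
        · exact hA (Or.inr h3)
        · exact hR (Or.inr (by omega))
    | some l =>
      rw [op_cons_some he] at hb
      simp only [cnt_app, Finset.mem_union] at hb
      rcases hb with ((hb | hb | hb) | hb) | hb
      · exact Or.inr ⟨e, by simp [edges], l, he, hb⟩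
      · exact Or.inl (hv hb)
      · exact hA (Or.inl hb)
      · exact hR (Or.inl hb)
      · by_cases h3 : 0 < (op g h A).2.cnt b
        · exact hA (Or.inr h3)
        · exact hR (Or.inr (by omega))

end Br

/-- Both the root vertex and the branches at the root carry labels. -/
def Tr.TwoSided {ε : Type} (S : Tr ε) : Prop := S.1.Nonempty ∧ ∃ b, 0 < S.2.cnt b

/-- Contract all edges except for `e`. -/
def isolateEdge (e : ℕ) (e' : ℕ) : Option (Finset ℕ) := if e' = e then none else some ∅

section

variable {g : ℕ → Finset ℕ} {e : ℕ}

lemma Br.op_isolateEdge {F : Br ℕ} (he : e ∉ F.edges) : (op g (isolateEdge e) F).2 = nil := by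
  apply eq_nil_of_edges
  rw [edges_op, List.filter_eq_nil_iff]
  intro e' he'
  rw [isolateEdge, if_neg (by rintro rfl; exact he he')]; simp

lemma Br.op_isolateEdge_nonempty {F : Br ℕ} (he : e ∉ F.edges) :
    (op g (isolateEdge e) F).1.Nonempty ↔ ∃ a, 0 < F.cnt a ∧ (g a).Nonempty := by
  constructor
  · rintro ⟨b, hb⟩
    rcases of_mem_op (Or.inl hb) with ⟨a, ha, h⟩ | ⟨e', -, l, h, hl⟩
    · exact ⟨a, ha, b, h⟩
    · rw [isolateEdge] at h
      split_ifs at h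
      simp only [Option.some.injEq] at h
      simp [← h] at hl
  · rintro ⟨a, ha, b, hb⟩
    rcases mem_op_or (h := isolateEdge e) ha hb with h | h
    · exact ⟨b, h⟩
    · simp [op_isolateEdge he, cnt] at h

/-- For the first edge after the root the two sides can be read off: `v` with `R`, and `w` with `A`.
The general case is reduced to this one by `Tr.rot_induction`. -/
lemma twoSided_cons {v w : Finset ℕ} {A R : Br ℕ} (hA : e ∉ A.edges) (hR : e ∉ R.edges) :
    (Tr.op g (isolateEdge e) (v, .cons e w A R)).TwoSided ↔
      (∃ a, (a ∈ v ∨ 0 < R.cnt a) ∧ (g a).Nonempty) ∧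
        ∃ a, (a ∈ w ∨ 0 < A.cnt a) ∧ (g a).Nonempty := by
  have hn : isolateEdge e e = none := if_pos rfl
  have key : ∀ (v : Finset ℕ) (F : Br ℕ), e ∉ F.edges →
      ((v.biUnion g ∪ (Br.op g (isolateEdge e) F).1).Nonempty ↔
        ∃ a, (a ∈ v ∨ 0 < F.cnt a) ∧ (g a).Nonempty) := fun v F hF => by
    rw [Finset.union_nonempty, Br.op_isolateEdge_nonempty hF, Finset.biUnion_nonempty]
    constructor
    · rintro (⟨a, ha, h⟩ | ⟨a, ha, h⟩)
      · exact ⟨a, Or.inl ha, h⟩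
      · exact ⟨a, Or.inr ha, h⟩
    · rintro ⟨a, ha | ha, h⟩
      · exact Or.inl ⟨a, ha, h⟩
      · exact Or.inr ⟨a, ha, h⟩
  rw [Tr.op, Br.op_cons_none hn, Br.op_isolateEdge hA, Br.op_isolateEdge hR, Tr.TwoSided]
  refine and_congr (key v R hR) (Iff.trans ?_ (key w A hA))
  refine exists_congr fun b => ?_
  simp [Br.cnt]
  split_ifs with h <;> simp_all

/-- After the other edges are contracted at most one edge is left, and moving the root can only
exchange its ends. -/
lemma twoSided_rot {S : Tr ℕ} (hS : S.edges.Nodup) :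
    (S.rot.op g (isolateEdge e)).TwoSided ↔ (S.op g (isolateEdge e)).TwoSided := by
  rcases Tr.op_rot (g := g) (h := isolateEdge e) S with h | h
  · rw [h]
    have hl : (S.op g (isolateEdge e)).edges.length ≤ 1 := by
      rw [Tr.edges_op]
      have : S.edges.filter (fun e' => (isolateEdge e e').isNone) = S.edges.filter (· == e) :=
        List.filter_congr fun e' _ => by by_cases h : e' = e <;> simp [isolateEdge, h]
      rw [this, List.filter_beq, List.length_replicate]
      exact List.nodup_iff_count_le_one.1 hS e
    generalize S.op g (isolateEdge e) = U at hl
    rcases U with ⟨v, _ | ⟨e', w, A, R⟩⟩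
    · rfl
    · change (e' :: (A.edges ++ R.edges)).length ≤ 1 at hl
      simp only [List.length_cons, List.length_append] at hl
      obtain rfl : A = .nil := Br.eq_nil_of_edges (List.length_eq_zero_iff.1 (by omega))
      obtain rfl : R = .nil := Br.eq_nil_of_edges (List.length_eq_zero_iff.1 (by omega))
      simp only [Tr.rot_cons, Tr.TwoSided, Br.cnt, Br.nil_app]
      have : ∀ v : Finset ℕ, (∃ b, 0 < (if b ∈ v then 1 else 0) + 0 + 0) ↔ v.Nonempty := fun v =>
        exists_congr fun b => by split_ifs with h <;> simp [h]
      rw [this, this, and_comm]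
  · rw [h]

/-- In a stable tree, every edge has labels on both sides. -/
lemma Tr.Stable.twoSided {S : Tr ℕ} (hst : S.Stable) (hS : S.edges.Nodup) (he : e ∈ S.edges) :
    (S.op (fun a => {a}) (isolateEdge e)).TwoSided := by
  obtain ⟨v, F⟩ := S
  obtain ⟨h0, hF⟩ := hst
  change e ∈ F.edges at he
  change F.edges.Nodup at hS
  have hvert : ∀ (w : Finset ℕ) (A : Br ℕ), (w = ∅ → 2 ≤ A.length) → A.Stable →
      ∃ a, a ∈ w ∨ 0 < A.cnt a := fun w A hw hA => by
    by_cases hwe : w = ∅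
    · obtain ⟨a, ha⟩ := Br.exists_cnt_pos hA (by rintro rfl; simpa [Br.length] using hw hwe)
      exact ⟨a, Or.inr ha⟩
    · obtain ⟨a, ha⟩ := Finset.nonempty_iff_ne_empty.2 hwe
      exact ⟨a, Or.inl ha⟩
  constructor
  · rw [op, Finset.union_nonempty, Finset.biUnion_singleton_eq_self]
    -- A black root vertex has at least two branches, so there are branches that avoid `e`, and by
    -- stability they carry labels.
    by_cases hv : v = ∅
    · right
      have hl := h0 hv
      rcases F with _ | ⟨e', w, A, R⟩
      · simp [Br.length] at hl
      simp only [Br.length] at hl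
      simp only [Br.edges, List.nodup_cons, List.nodup_append, List.mem_append, List.mem_cons] at he hS
      by_cases hR : e ∈ R.edges
      · have hA : e ∉ A.edges := fun h => hS.2.2.2 e h e hR rfl
        have hne : e' ≠ e := by rintro rfl; tauto
        rw [Br.op_cons_some (show isolateEdge e e' = some ∅ from if_neg hne)]
        obtain ⟨a, ha | ha⟩ := hvert w A hF.1 hF.2.1
        · exact ⟨a, by simp [ha]⟩
        · obtain ⟨b, hb⟩ := (Br.op_isolateEdge_nonempty (g := fun a => {a}) hA).2 ⟨a, ha, by simp⟩
          exact ⟨b, by simp [hb]⟩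
      · obtain ⟨a, ha⟩ := Br.exists_cnt_pos hF.2.2 (by rintro rfl; simp [Br.length] at hl)
        obtain ⟨b, hb⟩ := (Br.op_isolateEdge_nonempty (g := fun a => {a}) hR).2 ⟨a, ha, by simp⟩
        refine ⟨b, ?_⟩
        cases hx : isolateEdge e e' with
        | none => rw [Br.op_cons_none hx]; exact hb
        | some l => rw [Br.op_cons_some hx]; simp [hb]
    · exact Or.inl (Finset.nonempty_iff_ne_empty.2 hv)
  · change ∃ b, 0 < (F.op (fun a => {a}) (isolateEdge e)).2.cnt b
    -- The condition on the root vertex would not survive the induction over the branches.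
    clear h0
    induction F with
    | nil => simp [Br.edges] at he
    | cons e' w A R ih1 ih2 =>
      simp only [Br.edges, List.nodup_cons, List.nodup_append, List.mem_append, List.mem_cons] at he hS
      by_cases hne : e' = e
      · subst hne
        have hA : e' ∉ A.edges := fun h => hS.1 (Or.inl h)
        rw [Br.op_cons_none (show isolateEdge e' e' = none from if_pos rfl)]
        simp only [Br.cnt, Finset.biUnion_singleton_eq_self]
        obtain ⟨a, ha | ha⟩ := hvert w A hF.1 hF.2.1
        · exact ⟨a, by simp [ha]⟩
        · obtain ⟨b, hb⟩ := (Br.op_isolateEdge_nonempty (g := fun a => {a}) hA).2 ⟨a, ha, by simp⟩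
          exact ⟨b, by simp [hb]⟩
      · rw [Br.op_cons_some (show isolateEdge e e' = some ∅ from if_neg hne)]
        simp only [Br.cnt_app]
        rcases he with he | he | he
        · exact absurd he.symm hne
        · obtain ⟨b, hb⟩ := ih1 hF.2.1 he hS.2.1
          exact ⟨b, by omega⟩
        · obtain ⟨b, hb⟩ := ih2 hF.2.2 he hS.2.2.1
          exact ⟨b, by omega⟩

end

/-! ## The differential at unstable trees -/

namespace Br

/-- The edge `e` ends at a vertex without labels whose only branch starts with the edge `f`. -/
def Bivalent (e f : ℕ) : Br ℕ → Prop
  | nil => False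
  | cons e' v A R => (e' = e ∧ v = ∅ ∧ ∃ u B, A = cons f u B nil) ∨ A.Bivalent e f ∨ R.Bivalent e f

variable {e f e₀ : ℕ}

lemma bivalent_app {F G : Br ℕ} : (F.app G).Bivalent e f ↔ F.Bivalent e f ∨ G.Bivalent e f := by
  induction F with
  | nil => simp [Bivalent]
  | cons e' v A R _ ih => simp only [cons_app, Bivalent, ih, or_assoc]

lemma Bivalent.not_stable {F : Br ℕ} (h : F.Bivalent e f) : ¬ F.Stable := by
  induction F with
  | nil => exact h.elim
  | cons e' v A R ih1 ih2 =>
    rintro ⟨h1, h2, h3⟩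
    rcases h with ⟨-, hv, u, B, rfl⟩ | h | h
    · simpa [length] using h1 hv
    · exact ih1 h h2
    · exact ih2 h h3

lemma Bivalent.contractEdge {F : Br ℕ} (h : F.Bivalent e f) (he : e₀ ≠ e) (hf : e₀ ≠ f) :
    (F.op (fun a => {a}) (contractOnly e₀)).2.Bivalent e f := by
  induction F with
  | nil => exact h.elim
  | cons e' v A R ih1 ih2 =>
    by_cases hx : e' = e₀
    · subst hx
      rw [op_cons_some (contractOnly_self _), bivalent_app]
      rcases h with ⟨h, -⟩ | h | h
      · exact absurd h he
      · exact Or.inl (ih1 h)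
      · exact Or.inr (ih2 h)
    · rw [op_cons_none (contractOnly_of_ne hx)]
      rcases h with ⟨h, rfl, u, B, rfl⟩ | h | h
      · left
        rw [op_cons_none (contractOnly_of_ne (Ne.symm hf))]
        exact ⟨h, by simp, _, _, rfl⟩
      · exact Or.inr (Or.inl (ih1 h))
      · exact Or.inr (Or.inr (ih2 h))

/-- Contracting either of the edges at a bivalent vertex gives the same tree, up to the names of the
edges. -/
lemma Bivalent.exists_eq {F : Br ℕ} (h : F.Bivalent e f) (hF : F.edges.Nodup) :
    ∃ (G : Br ℕ) (l₁ l₂ : List ℕ), F.edges = l₁ ++ e :: f :: l₂ ∧ G.edges = l₁ ++ f :: l₂ ∧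
      F.op (fun a => {a}) (contractOnly e) = (∅, G) ∧
      F.op (fun a => {a}) (contractOnly f) =
        (∅, G.mapE fun e' => if e' = f then e else e') := by
  induction F with
  | nil => exact h.elim
  | cons e' v A R ih1 ih2 =>
    have hid : ∀ (x : ℕ) (F : Br ℕ), x ∉ F.edges →
        F.op (fun a => {a}) (contractOnly x) = (∅, F) := fun x F hx =>
      op_id fun y hy => contractOnly_of_ne (by rintro rfl; exact hx hy)
    have hmap : ∀ F : Br ℕ, f ∉ F.edges → (F.mapE fun e' => if e' = f then e else e') = F :=
      fun F hx => by
        conv_rhs => rw [← mapE_id F]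
        exact mapE_congr fun y hy => if_neg (by rintro rfl; exact hx hy)
    have hmem : ∀ {F : Br ℕ} {l₁ l₂ : List ℕ}, F.edges = l₁ ++ e :: f :: l₂ →
      e ∈ F.edges ∧ f ∈ F.edges := fun h => by simp [h]
    simp only [edges, List.nodup_cons, List.nodup_append, List.mem_append, not_or] at hF
    obtain ⟨⟨hA0, hR0⟩, hA, hR, hAR⟩ := hF
    rcases h with ⟨rfl, rfl, u, B, rfl⟩ | h | h
    · simp only [edges, List.append_nil, List.nodup_cons, List.mem_cons, not_or] at hA hA0 hAR
      have hfR : f ∉ R.edges := fun h => hAR f (Or.inl rfl) f h rfl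
      refine ⟨cons f u B R, [], B.edges ++ R.edges, by simp [edges], by simp [edges], ?_, ?_⟩
      · rw [op_cons_some (contractOnly_self _), op_cons_none (contractOnly_of_ne (Ne.symm hA0.1)), hid _ _ hA0.2,
          hid _ _ hR0]
        simp
      · rw [op_cons_none (contractOnly_of_ne hA0.1), op_cons_some (contractOnly_self _), hid _ _ hA.1, hid _ _ hfR]
        simp [mapE, hmap _ hA.1, hmap _ hfR]
    · obtain ⟨G, l₁, l₂, h1, h2, h3, h4⟩ := ih1 h hA
      obtain ⟨he, hf⟩ := hmem h1
      have hne : e' ≠ e := by rintro rfl; exact hA0 he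
      have hnf : e' ≠ f := by rintro rfl; exact hA0 hf
      have heR : e ∉ R.edges := fun h => hAR e he e h rfl
      have hfR : f ∉ R.edges := fun h => hAR f hf f h rfl
      refine ⟨cons e' v G R, e' :: l₁, l₂ ++ R.edges, by simp [edges, h1], by simp [edges, h2], ?_, ?_⟩
      · rw [op_cons_none (contractOnly_of_ne hne), h3, hid _ _ heR]; simp
      · rw [op_cons_none (contractOnly_of_ne hnf), h4, hid _ _ hfR]; simp [mapE, hnf, hmap _ hfR]
    · obtain ⟨G, l₁, l₂, h1, h2, h3, h4⟩ := ih2 h hR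
      obtain ⟨he, hf⟩ := hmem h1
      have hne : e' ≠ e := by rintro rfl; exact hR0 he
      have hnf : e' ≠ f := by rintro rfl; exact hR0 hf
      have heA : e ∉ A.edges := fun h => hAR e h e he rfl
      have hfA : f ∉ A.edges := fun h => hAR f h f hf rfl
      refine ⟨cons e' v A G, e' :: (A.edges ++ l₁), l₂, by simp [edges, h1], by simp [edges, h2], ?_, ?_⟩
      · rw [op_cons_none (contractOnly_of_ne hne), h3, hid _ _ heA]; simp
      · rw [op_cons_none (contractOnly_of_ne hnf), h4, hid _ _ hfA]; simp [mapE, hnf, hmap _ hfA]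

/-- If every edge has labels above it, then the instability of a tree is due to a bivalent vertex. -/
lemma exists_bivalent {F : Br ℕ} (hst : ¬ F.Stable) (hF : F.edges.Nodup)
    (h : ∀ e ∈ F.edges, ∃ b, 0 < (F.op (fun a => {a}) (isolateEdge e)).2.cnt b) :
    ∃ e f, F.Bivalent e f := by
  induction F with
  | nil => simp [Stable] at hst
  | cons e' v A R ih1 ih2 =>
    simp only [edges, List.nodup_cons, List.nodup_append, List.mem_append, not_or] at hF
    obtain ⟨⟨hA0, hR0⟩, hA, hR, hAR⟩ := hF
    by_cases hsA : A.Stable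
    · by_cases hsR : R.Stable
      · have : v = ∅ ∧ A.length < 2 := by
          by_contra hc
          exact hst ⟨fun hv => by by_contra hl; exact hc ⟨hv, by omega⟩, hsA, hsR⟩
        obtain ⟨rfl, hl⟩ := this
        rcases A with _ | ⟨f, u, B, _ | ⟨f', u', B', A'⟩⟩
        · obtain ⟨b, hb⟩ := h e' (by simp [edges])
          rw [op_cons_none (show isolateEdge e' e' = none from if_pos rfl)] at hb
          simp [cnt, op_isolateEdge hR0] at hb
        · exact ⟨e', f, Or.inl ⟨rfl, rfl, u, B, rfl⟩⟩
        · simp [length] at hl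
      · obtain ⟨e, f, hb⟩ := ih2 hsR hR fun e he => by
          obtain ⟨b, hb⟩ := h e (by simp [edges, he])
          have hne : e' ≠ e := by rintro rfl; exact hR0 he
          have heA : e ∉ A.edges := fun h => hAR e h e he rfl
          rw [op_cons_some (show isolateEdge e e' = some ∅ from if_neg hne), op_isolateEdge heA] at hb
          exact ⟨b, hb⟩
        exact ⟨e, f, Or.inr (Or.inr hb)⟩
    · obtain ⟨e, f, hb⟩ := ih1 hsA hA fun e he => by
        obtain ⟨b, hb⟩ := h e (by simp [edges, he])
        have hne : e' ≠ e := by rintro rfl; exact hA0 he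
        have heR : e ∉ R.edges := fun h => hAR e he e h rfl
        rw [op_cons_some (show isolateEdge e e' = some ∅ from if_neg hne), op_isolateEdge heR] at hb
        exact ⟨b, by simpa using hb⟩
      exact ⟨e, f, Or.inr (Or.inl hb)⟩

end Br

lemma shuffleSign_singleton_mul_listSign (e : ℕ) {l : List ℕ} (hl : l.Nodup) :
    shuffleSign {e} l.toFinset * listSign l = listSign (e :: l) := by
  rw [listSign_cons, shuffleSign, Finset.prod_singleton, List.prod_toFinset _ hl]

lemma toFinset_edges_contractEdge (e : ℕ) (S : Tr ℕ) :
    (contractEdge e S).edges.toFinset = S.edges.toFinset.erase e := by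
  rw [edges_contractEdge]
  ext a; simp [and_comm]

lemma nodup_edges_contractEdge (e : ℕ) {S : Tr ℕ} (hS : S.edges.Nodup) :
    (contractEdge e S).edges.Nodup := by
  rw [edges_contractEdge]; exact hS.filter _

lemma contractEdge_isolateEdge {g : ℕ → Finset ℕ} {e e₀ : ℕ} (h : e ≠ e₀) (S : Tr ℕ) :
    (contractEdge e S).op g (isolateEdge e₀) = S.op g (isolateEdge e₀) := by
  rw [contractEdge, Tr.op_op]
  · simp
  · intro e'
    by_cases he : e' = e
    · simp [he, isolateEdge, h, contractOnly]
    · simp [he, contractOnly]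

section

variable {n : ℕ} {k : Type*} [Field k]

/-- Both contractions give the same planar tree. The surviving edge is called `f` in one and `e` in
the other, so the two orientations, with the contracted edge in front, differ by the transposition
of `e` and `f`. -/
lemma ev_contractEdge_add_eq_zero (x : M k n) {e f : ℕ} {S : Tr ℕ} (hS : S.edges.Nodup)
    (h : S.2.Bivalent e f) :
    (shuffleSign {e} (S.edges.toFinset.erase e) : k) * ev (contractEdge e S) x +
      (shuffleSign {f} (S.edges.toFinset.erase f) : k) * ev (contractEdge f S) x = 0 := by
  obtain ⟨v, F⟩ := S
  obtain ⟨G, l₁, l₂, h1, h2, h3, h4⟩ := Br.Bivalent.exists_eq h hS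
  change F.edges.Nodup at hS
  rw [h1] at hS
  have hndd := hS
  rw [List.nodup_append, List.nodup_cons, List.nodup_cons, List.mem_cons, not_or] at hS
  obtain ⟨d1, ⟨⟨hef, d2⟩, d3, d4⟩, d5⟩ := hS
  have he1 : e ∉ l₁ := fun h => d5 e h e (by simp) rfl
  have hf1 : f ∉ l₁ := fun h => d5 f h f (by simp) rfl
  have c1 : contractEdge e (v, F) = (v, G) := by
    rw [contractEdge, Tr.op]
    simp only [h3, Finset.biUnion_singleton_eq_self, Finset.union_empty]
  have c2 : contractEdge f (v, F) = Tr.mapE (fun e' => if e' = f then e else e') (v, G) := by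
    rw [contractEdge, Tr.op]
    simp only [h4, Finset.biUnion_singleton_eq_self, Finset.union_empty, Tr.mapE]
  have hmap : (l₁ ++ f :: l₂).map (fun e' => if e' = f then e else e') = l₁ ++ e :: l₂ := by
    rw [List.map_append, List.map_cons, if_pos rfl]
    congr 1
    · conv_rhs => rw [← List.map_id l₁]
      exact List.map_congr_left fun a ha => if_neg (by rintro rfl; exact hf1 ha)
    · congr 1
      conv_rhs => rw [← List.map_id l₂]
      exact List.map_congr_left fun a ha => if_neg (by rintro rfl; exact d3 ha)
  have n1 : (l₁ ++ f :: l₂).Nodup := by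
    refine List.nodup_append.2 ⟨d1, List.nodup_cons.2 ⟨d3, d4⟩, fun a ha b hb => d5 a ha b ?_⟩
    exact List.mem_cons_of_mem _ hb
  have n2 : (l₁ ++ e :: l₂).Nodup := by
    refine List.nodup_append.2 ⟨d1, List.nodup_cons.2 ⟨d2, d4⟩, fun a ha b hb => d5 a ha b ?_⟩
    simp only [List.mem_cons] at hb ⊢
    tauto
  have s1 := shuffleSign_singleton_mul_listSign e n1
  have s2 := shuffleSign_singleton_mul_listSign f n2
  have s3 := listSign_swap (b := e) (a := f) (l₁ := l₁) (Ne.symm hef) hf1 he1 l₂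
  have f1 : (l₁ ++ f :: l₂).toFinset = (Tr.edges (v, F)).toFinset.erase e := by
    rw [← toFinset_edges_contractEdge, c1]; exact congrArg List.toFinset h2.symm
  have f2 : (l₁ ++ e :: l₂).toFinset = (Tr.edges (v, F)).toFinset.erase f := by
    rw [← toFinset_edges_contractEdge, c2, Tr.edges_mapE]
    exact congrArg List.toFinset (by rw [← hmap, ← h2]; rfl)
  rw [f1] at s1
  rw [f2] at s2
  have hedg : Tr.edges (v, G) = l₁ ++ f :: l₂ := h2
  rw [c1, c2, ev_mapE, hedg, hmap]
  generalize ev (v, G) x = c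
  have s1' := congrArg (Int.cast : ℤ → k) s1
  have s2' := congrArg (Int.cast : ℤ → k) s2
  have s3' := congrArg (Int.cast : ℤ → k) s3
  push_cast at s1' s2' s3'
  have q := listSign_cast_mul_self (k := k) (l₁ ++ f :: l₂)
  linear_combination (c * listSign (l₁ ++ f :: l₂)) * (s1' + s2' + s3') -
    (c * shuffleSign {e} ((Tr.edges (v, F)).toFinset.erase e)) * q

open Classical in
/-- The coefficients of the differential, at a tree that may be unstable. -/
theorem ev_d_of_separated (x : M k n) {S : Tr ℕ} (hS : S.edges.Nodup) (hs : S.Separated) :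
    ev S ((minimalOperad k).d n x) =
      ∑ e ∈ S.edges.toFinset, if (S.op (fun a => {a}) (isolateEdge e)).TwoSided then
        (shuffleSign {e} (S.edges.toFinset.erase e) : k) * ev (contractEdge e S) x else 0 := by
  by_cases he : S.edges = []
  · have hd : ev S ((minimalOperad k).d n x) = 0 := by
      by_cases hst : S.Stable
      · rw [ev_d x hS hs hst]; simp [he]
      · exact ev_eq_zero _ fun h => hst h.2.2
    simp [hd, he]
  -- At a stable tree every edge has labels on both sides and the condition is void. At an unstable
  -- tree the left side is zero, and the sum on the right has to vanish.
  by_cases hst : S.Stable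
  · rw [ev_d x hS hs hst]
    exact Finset.sum_congr rfl fun e he =>
      (if_pos (hst.twoSided hS (List.mem_toFinset.1 he))).symm
  rw [ev_eq_zero _ fun h => hst h.2.2]
  symm
  by_cases hall : ∀ e ∈ S.edges, (S.op (fun a => {a}) (isolateEdge e)).TwoSided
  -- The root vertex is not to blame: if it were unlabeled with a single branch, the edge of this
  -- branch would lack labels on one side.
  · have hbr : ¬ S.2.Stable := by
      intro hbr
      apply hst
      refine ⟨fun hv => ?_, hbr⟩
      by_contra hl
      obtain ⟨v, F⟩ := S
      simp only at hv hl hbr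
      subst hv
      rcases F with _ | ⟨e, u, A, _ | ⟨e', u', A', R⟩⟩
      · exact he rfl
      · simp only [Tr.edges, Br.edges, List.append_nil, List.nodup_cons] at hS
        have := hall e (by simp [Tr.edges, Br.edges])
        rw [twoSided_cons hS.1 (by simp [Br.edges])] at this
        simp [Br.cnt] at this
      · simp [Br.length] at hl
    obtain ⟨e, f, hef⟩ := Br.exists_bivalent hbr hS fun e he => (hall e he).2
    obtain ⟨-, l₁, l₂, hl, -⟩ := hef.exists_eq hS
    have hl : S.edges = l₁ ++ e :: f :: l₂ := hl
    have he : e ∈ S.edges := by simp [hl]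
    have hf : f ∈ S.edges := by simp [hl]
    have hne : e ≠ f := by
      rintro rfl
      rw [hl] at hS
      simp [List.nodup_append] at hS
    rw [Finset.sum_eq_add_of_mem e f (List.mem_toFinset.2 he) (List.mem_toFinset.2 hf) hne,
      if_pos (hall e he), if_pos (hall f hf), ev_contractEdge_add_eq_zero x hS hef]
    -- The terms of the two edges at the bivalent vertex have cancelled; contracting any other edge
    -- keeps that vertex, hence gives an unstable tree.
    intro e₀ _ h
    split_ifs
    · rw [ev_eq_zero, mul_zero]
      exact fun hr => (hef.contractEdge h.1 h.2).not_stable hr.2.2.2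
    · rfl
  -- The term of `e₀` is excluded by the condition. After contracting any other edge, `e₀` still
  -- lacks labels on one side, so that the result is unstable.
  · push Not at hall
    obtain ⟨e₀, he₀, h0⟩ := hall
    refine Finset.sum_eq_zero fun e he => ?_
    split_ifs with h
    · rw [ev_eq_zero, mul_zero]
      intro hr
      have hne : e ≠ e₀ := by rintro rfl; exact h0 h
      have := hr.2.2.twoSided (e := e₀) (nodup_edges_contractEdge e hS) (by
        rw [edges_contractEdge, List.mem_filter]; exact ⟨he₀, by simp [hne.symm]⟩)
      rw [contractEdge_isolateEdge hne] at this
      exact h0 this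
    · rfl

end

/-! ## Degrees -/

section

variable {n : ℕ} {k : Type*} [Field k]

lemma RootedTree.degree_eq (T : RootedTree n) (s : ℕ) :
    T.1.degree = 2 * n - 2 - ((T.1.number s).toTr.edges.length : ℤ) := by
  rw [PTree.degree_eq T.2.1, PTree.edges_toTr, PTree.edges_number, List.length_range']

/-- By the degree formula, homogeneity is a condition on the number of edges of the trees with
nonzero coefficient. -/
lemma mem_gr_iff {e : ℤ} {x : M k n} : x ∈ (minimalOperad k).gr n e ↔
    ∀ S : Tr ℕ, S.edges.Nodup → ev S x ≠ 0 → (S.edges.length : ℤ) = 2 * n - 2 - e := by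
  change x ∈ Finsupp.supported k k {T : RootedTree n | T.1.degree = e} ↔ _
  rw [Finsupp.mem_supported']
  constructor
  · intro h S hS hx
    obtain ⟨T, hT⟩ := exists_rootedTree (Tr.isRooted_forget.2 (isRooted_of_ev_ne_zero hx))
    rw [ev_apply_rootedTree x hT.symm] at hx
    have hd : T.1.degree = e := by
      by_contra hd; exact hx (by rw [h T hd, mul_zero])
    rw [PTree.degree_eq T.2.1, PTree.size_eq_length_edges, ← PTree.edges_toTr, hT, Tr.forget,
      Tr.edges_mapE, List.length_map] at hd
    omega
  · intro h T hT
    by_contra hx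
    rw [← ev_toTr_number x T 0] at hx
    have := h _ (nodup_edges_number _ _) hx
    have hd := T.degree_eq 0
    exact hT (by change T.1.degree = e; omega)

end

/-! ## The differential is a derivation -/

/-- A power of `rot` is the identity, with an exponent that depends on the number of edges only. -/
lemma Tr.rot_injective {ε : Type} : Function.Injective (rot : Tr ε → Tr ε) := by
  intro S S' h
  have hl : S.edges.length = S'.edges.length := by
    rw [← S.edges_rot.length_eq, h, S'.edges_rot.length_eq]
  cases hN : S.edges.length with
  | zero =>
    have hrot : ∀ S : Tr ε, S.edges.length = 0 → S.rot = S := by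
      rintro ⟨v, F⟩ hF
      obtain rfl := Br.eq_nil_of_edges (List.length_eq_zero_iff.1 hF)
      rfl
    rwa [hrot S hN, hrot S' (hl ▸ hN)] at h
  | succ N =>
    have h1 := S.iterate_rot_self
    have h2 := S'.iterate_rot_self
    rw [← hl, hN, Nat.mul_succ, Function.iterate_succ_apply] at h2
    rw [hN, Nat.mul_succ, Function.iterate_succ_apply, h, h2] at h1
    exact h1.symm

/-- The two contractions concern the same edges and differ only in marks. If the first edge
survives, `rot` can be cancelled; if it is contracted, moving the root along it changes neither
result. -/
lemma Tr.op_eq_of_rot {ε : Type} {g : ℕ → Finset ℕ} {h h' : ε → Option (Finset ℕ)}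
    (hh : ∀ e, h e = none ↔ h' e = none) {S : Tr ε} (hS : S.rot.op g h = S.rot.op g h') :
    S.op g h = S.op g h' := by
  obtain ⟨v, _ | ⟨e, w, A, R⟩⟩ := S
  · exact hS
  · cases he : h e with
    | none =>
      have he' := (hh e).1 he
      apply Tr.rot_injective
      simpa [op, Br.op_app, Br.op_cons_none he, Br.op_cons_none he', Br.op_nil] using hS
    | some l =>
      cases he' : h' e with
      | none => rw [(hh e).2 he'] at he; simp at he
      | some l' =>
        simp only [op, rot_cons, Br.op_app, Br.op_cons_some he, Br.op_cons_some he', Br.op_nil,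
          Br.app_nil, Prod.mk.injEq, Finset.union_empty] at hS ⊢
        refine ⟨?_, hS.2⟩
        convert hS.1 using 1 <;> ac_rfl

/-- Contract the edge `e`, and add the label `i` to the vertex obtained in this way. -/
def markEdge (i e : ℕ) (S : Tr ℕ) : Tr ℕ :=
  S.op (fun a => {a}) fun e' => if e' = e then some {i} else none

/-- Keep only the label `i`. -/
def keepLabel (i a : ℕ) : Finset ℕ := if a = i then {i} else ∅

lemma keepLabel_nonempty {i a : ℕ} : (keepLabel i a).Nonempty ↔ a = i := by
  unfold keepLabel; split_ifs with h <;> simp [h]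

/-! ### Contracting an edge versus marking it -/

section

variable {i e : ℕ}

lemma contractEdge_cons {v w : Finset ℕ} {A R : Br ℕ} (hA : e ∉ A.edges) (hR : e ∉ R.edges) :
    contractEdge e (v, .cons e w A R) = (v ∪ w, A.app R) := by
  have hid : ∀ F : Br ℕ, e ∉ F.edges → F.op (fun a => {a}) (contractOnly e) = (∅, F) :=
    fun F hF => Br.op_id fun y hy => contractOnly_of_ne (by rintro rfl; exact hF hy)
  rw [contractEdge, Tr.op, Br.op_cons_some (contractOnly_self e), hid A hA, hid R hR]
  simp

lemma markEdge_cons {v w : Finset ℕ} {A R : Br ℕ} (hA : e ∉ A.edges) (hR : e ∉ R.edges) :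
    markEdge i e (v, .cons e w A R) = (v ∪ ({i} ∪ w), A.app R) := by
  have hid : ∀ F : Br ℕ, e ∉ F.edges → F.op (fun a => {a})
      (fun e' => if e' = e then some {i} else none) = (∅, F) :=
    fun F hF => Br.op_id fun y hy => if_neg (by rintro rfl; exact hF hy)
  rw [markEdge, Tr.op, Br.op_cons_some (l := {i}) (h := fun e' => if e' = e then some {i} else none)
    (if_pos rfl), hid A hA, hid R hR]
  simp

lemma not_mem_of_nodup_cons {v w : Finset ℕ} {A R : Br ℕ}
    (hS : (Tr.edges (v, .cons e w A R)).Nodup) :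
    e ∉ A.edges ∧ e ∉ R.edges ∧ ∀ x ∈ A.edges, x ∉ R.edges := by
  simp only [Tr.edges, Br.edges, List.nodup_cons, List.nodup_append, List.mem_append, not_or] at hS
  exact ⟨hS.1.1, hS.1.2, fun x hx hx' => hS.2.2.2 x hx x hx' rfl⟩

/-- If an end of `e` carries `i`, the contracted vertex has this label anyway and the mark adds
nothing. Otherwise the occurrences of `i` on the two sides lie away from `e` and stay distinct, so
neither contraction is a basis tree. -/
lemma contractEdge_or_markEdge {S : Tr ℕ} (hS : S.edges.Nodup) (he : e ∈ S.edges)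
    (h : (S.op (keepLabel i) (isolateEdge e)).TwoSided) :
    2 ≤ S.cnt i ∧ (contractEdge e S = markEdge i e S ∨
      2 ≤ (contractEdge e S).cnt i ∧ 2 ≤ (markEdge i e S).cnt i) := by
  revert hS h
  refine Tr.rot_induction (e := e) (Φ := fun S => S.edges.Nodup →
    (S.op (keepLabel i) (isolateEdge e)).TwoSided → 2 ≤ S.cnt i ∧
      (contractEdge e S = markEdge i e S ∨
        2 ≤ (contractEdge e S).cnt i ∧ 2 ≤ (markEdge i e S).cnt i)) ?_ ?_ S he
  · intro S hΦ hS h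
    obtain ⟨h1, h2⟩ := hΦ (S.edges_rot.nodup_iff.2 hS) ((twoSided_rot hS).2 h)
    rw [Tr.cnt_rot] at h1
    have hcnt : ∀ (g : ℕ → Finset ℕ) (h : ℕ → Option (Finset ℕ)),
        (S.rot.op g h).cnt i = (S.op g h).cnt i := fun g h => by
      rcases Tr.op_rot (g := g) (h := h) S with h' | h' <;> rw [h']
      exact Tr.cnt_rot _ _
    refine ⟨h1, h2.imp (fun h => Tr.op_eq_of_rot (fun e' => ?_) h) fun h => ?_⟩
    · simp only [contractOnly]; split_ifs <;> simp
    · simp only [contractEdge, markEdge, hcnt] at h ⊢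
      exact h
  · intro v w A R hS h
    obtain ⟨hA, hR, -⟩ := not_mem_of_nodup_cons hS
    rw [twoSided_cons hA hR] at h
    simp only [keepLabel_nonempty, exists_eq_right] at h
    rw [contractEdge_cons hA hR, markEdge_cons hA hR]
    simp only [Tr.cnt, Br.cnt, Br.cnt_app, Finset.mem_union, Finset.mem_singleton, true_or, or_true,
      if_true, Prod.mk.injEq, and_true]
    by_cases hv : i ∈ v <;> by_cases hw : i ∈ w
    · refine ⟨by simp only [hv, hw, if_true]; omega, Or.inl ?_⟩
      ext b; simp only [Finset.mem_union, Finset.mem_singleton]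
      constructor
      · tauto
      · rintro (h | rfl | h) <;> tauto
    · simp only [hw, false_or] at h
      refine ⟨by simp only [hv, hw, if_true, if_false]; omega, Or.inl ?_⟩
      ext b; simp only [Finset.mem_union, Finset.mem_singleton]
      constructor
      · tauto
      · rintro (h | rfl | h) <;> tauto
    · simp only [hv, false_or] at h
      refine ⟨by simp only [hv, hw, if_true, if_false]; omega, Or.inl ?_⟩
      ext b; simp only [Finset.mem_union, Finset.mem_singleton]
      constructor
      · tauto
      · rintro (h | rfl | h) <;> tauto
    · simp only [hv, hw, false_or] at h
      exact ⟨by omega, Or.inr ⟨by omega, by omega⟩⟩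

/-- The number of occurrences of `i` drops only if both ends of `e` carry this label. -/
lemma cnt_le_cnt_contractEdge {S : Tr ℕ} (hS : S.edges.Nodup) (he : e ∈ S.edges)
    (h : ¬ (S.op (keepLabel i) (isolateEdge e)).TwoSided) :
    S.cnt i ≤ (contractEdge e S).cnt i := by
  revert hS h
  refine Tr.rot_induction (e := e) (Φ := fun S => S.edges.Nodup →
    ¬ (S.op (keepLabel i) (isolateEdge e)).TwoSided →
      S.cnt i ≤ (contractEdge e S).cnt i) ?_ ?_ S he
  · intro S hΦ hS h
    have := hΦ (S.edges_rot.nodup_iff.2 hS) (mt (twoSided_rot hS).1 h)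
    rw [Tr.cnt_rot] at this
    rcases Tr.op_rot (g := fun a => {a}) (h := contractOnly e) S with h' | h'
    · rwa [contractEdge, h', Tr.cnt_rot] at this
    · rwa [contractEdge, h'] at this
  · intro v w A R hS h
    obtain ⟨hA, hR, -⟩ := not_mem_of_nodup_cons hS
    rw [twoSided_cons hA hR] at h
    simp only [keepLabel_nonempty, exists_eq_right] at h
    rw [contractEdge_cons hA hR]
    simp only [Tr.cnt, Br.cnt, Br.cnt_app, Finset.mem_union]
    by_cases hv : i ∈ v <;> by_cases hw : i ∈ w <;> simp_all

end

/-! ### Edge contractions of outer and inner trees -/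

section

variable {i m e : ℕ} {P : Finset ℕ} {S : Tr ℕ}

lemma outerLabel_eq_iff {a : ℕ} : i ∈ ({outerLabel i m a} : Finset ℕ) ↔ i ≤ a ∧ a < i + m := by
  rw [Finset.mem_singleton, outerLabel]; split_ifs <;> omega

lemma innerLabel_nonempty {a : ℕ} : (innerLabel i m a).Nonempty ↔ i ≤ a ∧ a < i + m := by
  unfold innerLabel; split_ifs with h <;> simp [h]

/-- If the edges in `P` have labels in the block `i, …, i + m - 1` on both sides, then an edge
that is not in `P` has such labels on both sides if and only if it has the label `i` on both sides
after the contraction of the block. -/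
lemma twoSided_outerTree (hS : S.edges.Nodup) (he : e ∈ S.edges) (heP : e ∉ P) :
    ((S.op (innerLabel i m) (isolateEdge e)).TwoSided →
      ((outerTree i m P S).op (keepLabel i) (isolateEdge e)).TwoSided) ∧
    ((∀ f ∈ P, f ∈ S.edges → (S.op (innerLabel i m) (isolateEdge f)).TwoSided) →
      ((outerTree i m P S).op (keepLabel i) (isolateEdge e)).TwoSided →
      (S.op (innerLabel i m) (isolateEdge e)).TwoSided) := by
  revert hS
  refine Tr.rot_induction (e := e) (Φ := fun S => S.edges.Nodup →
    ((S.op (innerLabel i m) (isolateEdge e)).TwoSided →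
      ((outerTree i m P S).op (keepLabel i) (isolateEdge e)).TwoSided) ∧
    ((∀ f ∈ P, f ∈ S.edges → (S.op (innerLabel i m) (isolateEdge f)).TwoSided) →
      ((outerTree i m P S).op (keepLabel i) (isolateEdge e)).TwoSided →
      (S.op (innerLabel i m) (isolateEdge e)).TwoSided)) ?_ ?_ S he
  · intro S hΦ hS
    have h := hΦ (S.edges_rot.nodup_iff.2 hS)
    have hn : (outerTree i m P S).edges.Nodup := by rw [edges_outerTree]; exact hS.filter _
    have hout : ((outerTree i m P S.rot).op (keepLabel i) (isolateEdge e)).TwoSided ↔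
        ((outerTree i m P S).op (keepLabel i) (isolateEdge e)).TwoSided := by
      rw [outerTree]
      rcases Tr.op_rot (g := fun a => {outerLabel i m a})
        (h := fun e => if e ∈ P then some {i} else none) S with h' | h'
      · rw [h', ← outerTree, twoSided_rot hn]
      · rw [h', ← outerTree]
    have hin : ∀ f, (S.rot.op (innerLabel i m) (isolateEdge f)).TwoSided ↔
        (S.op (innerLabel i m) (isolateEdge f)).TwoSided := fun f => twoSided_rot hS
    simpa only [hout, hin, S.edges_rot.mem_iff] using h
  · intro v w A R hS
    obtain ⟨hA, hR, hAR⟩ := not_mem_of_nodup_cons hS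
    set h : ℕ → Option (Finset ℕ) := fun e => if e ∈ P then some {i} else none with hh
    have he0 : h e = none := if_neg heP
    set g : ℕ → Finset ℕ := fun a => {outerLabel i m a} with hg
    have hW : outerTree i m P (v, .cons e w A R) = (v.biUnion g ∪ (R.op g h).1,
        .cons e (w.biUnion g ∪ (A.op g h).1) (A.op g h).2 (R.op g h).2) := by
      rw [outerTree, Tr.op, Br.op_cons_none he0]
    have hA' : e ∉ (A.op g h).2.edges := by
      rw [Br.edges_op, List.mem_filter]; exact fun h => hA h.1
    have hR' : e ∉ (R.op g h).2.edges := by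
      rw [Br.edges_op, List.mem_filter]; exact fun h => hR h.1
    rw [hW, twoSided_cons hA hR, twoSided_cons hA' hR']
    simp only [keepLabel_nonempty, exists_eq_right]
    have key1 : ∀ (v : Finset ℕ) (F : Br ℕ),
        (∃ a, (a ∈ v ∨ 0 < F.cnt a) ∧ (innerLabel i m a).Nonempty) →
        i ∈ v.biUnion g ∪ (F.op g h).1 ∨ 0 < (F.op g h).2.cnt i := by
      rintro v F ⟨a, ha, hi⟩
      rw [innerLabel_nonempty, ← outerLabel_eq_iff] at hi
      rw [Finset.mem_union]
      rcases ha with ha | ha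
      · exact Or.inl (Or.inl (Finset.mem_biUnion.2 ⟨a, ha, hi⟩))
      · rcases Br.mem_op_or (g := g) (h := h) ha hi with h' | h'
        · exact Or.inl (Or.inr h')
        · exact Or.inr h'
    -- A mark `i` that was left by the contraction of an edge `f` in `P` is replaced by a label of
    -- the block on the side of `f` away from `e`.
    have key2 : ∀ (v : Finset ℕ) (F : Br ℕ),
        (∀ f ∈ P, f ∈ F.edges → ∃ a, 0 < F.cnt a ∧ (innerLabel i m a).Nonempty) →
        (i ∈ v.biUnion g ∪ (F.op g h).1 ∨ 0 < (F.op g h).2.cnt i) →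
        ∃ a, (a ∈ v ∨ 0 < F.cnt a) ∧ (innerLabel i m a).Nonempty := by
      intro v F hF hi
      rw [Finset.mem_union, Finset.mem_biUnion, or_assoc] at hi
      rcases hi with ⟨a, ha, hi⟩ | hi
      · exact ⟨a, Or.inl ha, innerLabel_nonempty.2 (outerLabel_eq_iff.1 hi)⟩
      · rcases Br.of_mem_op hi with ⟨a, ha, hi⟩ | ⟨f, hf, l, hl, -⟩
        · exact ⟨a, Or.inr ha, innerLabel_nonempty.2 (outerLabel_eq_iff.1 hi)⟩
        · have hfP : f ∈ P := by
            by_contra hfP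
            simp [hh, hfP] at hl
          obtain ⟨a, ha, h'⟩ := hF f hfP hf
          exact ⟨a, Or.inr ha, h'⟩
    have key3 : ∀ (F : Br ℕ) (f : ℕ),
        (∃ b, 0 < (F.op (innerLabel i m) (isolateEdge f)).2.cnt b) →
        ∃ a, 0 < F.cnt a ∧ (innerLabel i m a).Nonempty := by
      rintro F f ⟨b, hb⟩
      rcases Br.of_mem_op (Or.inr hb) with ⟨a, ha, h'⟩ | ⟨f', -, l, hl, hbl⟩
      · exact ⟨a, ha, b, h'⟩
      · rw [isolateEdge] at hl
        split_ifs at hl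
        simp only [Option.some.injEq] at hl
        simp [← hl] at hbl
    refine ⟨fun h' => ⟨key1 _ _ h'.1, key1 _ _ h'.2⟩, fun hP h' =>
      ⟨key2 _ _ (fun f hf hfR => ?_) h'.1, key2 _ _ (fun f hf hfA => ?_) h'.2⟩⟩
    · have hfe : e ≠ f := by rintro rfl; exact heP hf
      have hfA : f ∉ A.edges := fun h => hAR f h hfR
      have := (hP f hf (by simp [Tr.edges, Br.edges, hfR])).2
      rw [Tr.op, Br.op_cons_some (show isolateEdge f e = some ∅ from if_neg hfe),
        Br.op_isolateEdge hfA] at this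
      exact key3 _ _ this
    · have hfe : e ≠ f := by rintro rfl; exact heP hf
      have hfR : f ∉ R.edges := fun h => hAR f hfA h
      have := (hP f hf (by simp [Tr.edges, Br.edges, hfA])).2
      rw [Tr.op, Br.op_cons_some (show isolateEdge f e = some ∅ from if_neg hfe),
        Br.op_isolateEdge hfR] at this
      exact key3 _ _ (by simpa using this)

lemma contractEdge_innerTree (heP : e ∈ P) :
    contractEdge e (innerTree i m P S) = innerTree i m (P.erase e) S := by
  rw [contractEdge, innerTree, innerTree, Tr.op_op]
  · simp
  · intro e'
    by_cases h : e' = e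
    · simp [h, heP, contractOnly]
    · by_cases h' : e' ∈ P <;> simp [h, h', contractOnly]

lemma innerTree_contractEdge (heP : e ∉ P) :
    innerTree i m P (contractEdge e S) = innerTree i m P S := by
  rw [contractEdge, innerTree, innerTree, Tr.op_op]
  · simp
  · intro e'
    by_cases h : e' = e
    · simp [h, heP, contractOnly]
    · by_cases h' : e' ∈ P <;> simp [h, h', contractOnly]

lemma outerTree_contractEdge (heP : e ∉ P) :
    outerTree i m P (contractEdge e S) = contractEdge e (outerTree i m P S) := by
  rw [contractEdge, outerTree, outerTree, contractEdge, Tr.op_op (h'' := fun e' =>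
    if e' = e then some ∅ else if e' ∈ P then some {i} else none)
    (g'' := fun a => {outerLabel i m a}), Tr.op_op]
  · simp
  · intro e'
    by_cases h : e' = e
    · simp [h, heP, contractOnly]
    · by_cases h' : e' ∈ P <;> simp [h, h', contractOnly]
  · simp
  · intro e'
    by_cases h : e' = e
    · simp [h, contractOnly]
    · by_cases h' : e' ∈ P <;> simp [h, h', contractOnly]

lemma markEdge_outerTree :
    markEdge i e (outerTree i m P S) = outerTree i m (insert e P) S := by
  rw [markEdge, outerTree, outerTree, Tr.op_op]
  · simp
  · intro e'
    by_cases h : e' = e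
    · by_cases h' : e ∈ P <;> simp [h, h']
    · by_cases h' : e' ∈ P <;> simp [h, h']

lemma innerTree_isolateEdge (heP : e ∈ P) :
    (innerTree i m P S).op (fun a => {a}) (isolateEdge e) =
      S.op (innerLabel i m) (isolateEdge e) := by
  rw [innerTree, Tr.op_op]
  · simp
  · intro e'
    by_cases h : e' = e
    · simp [h, heP, isolateEdge]
    · by_cases h' : e' ∈ P <;> simp [h, h', isolateEdge]

lemma nodup_edges_outerTree (hS : S.edges.Nodup) : (outerTree i m P S).edges.Nodup := by
  rw [edges_outerTree]; exact hS.filter _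

lemma nodup_edges_innerTree (hS : S.edges.Nodup) : (innerTree i m P S).edges.Nodup := by
  rw [edges_innerTree]; exact hS.filter _

lemma toFinset_edges_outerTree : (outerTree i m P S).edges.toFinset = S.edges.toFinset \ P := by
  rw [edges_outerTree]; ext; simp

lemma toFinset_edges_innerTree (hP : P ⊆ S.edges.toFinset) :
    (innerTree i m P S).edges.toFinset = P := by
  rw [edges_innerTree]; ext a
  simp only [List.mem_toFinset, List.mem_filter, decide_eq_true_eq, and_iff_right_iff_imp]
  exact fun ha => List.mem_toFinset.1 (hP ha)

lemma separated_innerTree (hs : S.Separated) : (innerTree i m P S).Separated := by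
  intro b
  refine (Tr.cnt_op_le (a := b + i) ?_ ?_ S).trans (hs _)
  · intro a h
    unfold innerLabel at h
    split_ifs at h
    · simp only [Finset.mem_singleton] at h; omega
    · simp at h
  · intro e l h
    split_ifs at h
    simp only [Option.some.injEq] at h
    simp [← h]

/-- The label `i` is exempt, since it stands for a whole block and for the marks, and may occur at
several vertices. -/
lemma cnt_outerTree_le (hm : 0 < m) (hs : S.Separated) {b : ℕ} (hb : b ≠ i) :
    (outerTree i m P S).cnt b ≤ 1 := by
  refine (Tr.cnt_op_le (a := outerIndex i m b) ?_ ?_ S).trans (hs _)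
  · intro a h
    rw [Finset.mem_singleton] at h
    subst h
    unfold outerLabel outerIndex at *
    split_ifs at * <;> omega
  · intro e l h
    split_ifs at h
    simp only [Option.some.injEq] at h
    simp [← h, hb]

lemma stable_outerTree (hst : S.Stable) : (outerTree i m P S).Stable :=
  Tr.stable_op (fun _ => Finset.singleton_nonempty _) hst

end

section

variable {k : Type*} [Field k] {n m l : ℕ}

lemma sum_powerset_sum_sdiff (E : Finset ℕ) (F : ℕ → Finset ℕ → k) :
    ∑ P ∈ E.powerset, ∑ e ∈ E \ P, F e P = ∑ e ∈ E, ∑ P ∈ (E.erase e).powerset, F e P := by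
  refine Finset.sum_comm' fun P e => ?_
  simp only [Finset.mem_powerset, Finset.mem_sdiff, Finset.subset_erase]
  tauto

lemma sum_powerset_sum_mem (E : Finset ℕ) (F : ℕ → Finset ℕ → k) :
    ∑ P ∈ E.powerset, ∑ e ∈ P, F e P =
      ∑ e ∈ E, ∑ P ∈ (E.erase e).powerset, F e (insert e P) := by
  rw [Finset.sum_sigma', Finset.sum_sigma']
  refine Finset.sum_bij' (fun p _ => ⟨p.2, p.1.erase p.2⟩) (fun q _ => ⟨insert q.1 q.2, q.1⟩)
    ?_ ?_ ?_ ?_ ?_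
  · rintro ⟨P, e⟩ h
    simp only [Finset.mem_sigma, Finset.mem_powerset] at h ⊢
    exact ⟨h.1 h.2, Finset.erase_subset_erase _ h.1⟩
  · rintro ⟨e, P⟩ h
    simp only [Finset.mem_sigma, Finset.mem_powerset] at h ⊢
    exact ⟨Finset.insert_subset h.1 (h.2.trans (Finset.erase_subset _ _)),
      Finset.mem_insert_self _ _⟩
  · rintro ⟨P, e⟩ h
    simp only [Finset.mem_sigma] at h
    simp [Finset.insert_erase h.2]
  · rintro ⟨e, P⟩ h
    simp only [Finset.mem_sigma, Finset.mem_powerset, Finset.subset_erase] at h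
    simp [Finset.erase_insert h.2.2]
  · rintro ⟨P, e⟩ h
    simp only [Finset.mem_sigma] at h
    simp [Finset.insert_erase h.2]

open Classical in
/-- The terms in the differential of a composition. -/
lemma ev_mul_ev_eq (i : Fin n) (x : M k n) (y : M k m) {S : Tr ℕ} (hS : S.edges.Nodup)
    (hs : S.Separated) {P : Finset ℕ} {e : ℕ} (he : e ∈ S.edges)
    (heP : e ∉ P) :
    ev (contractEdge e (outerTree i m P S)) x * ev (innerTree i m P S) y =
      (if (outerTree i m P S).Separated then ev (contractEdge e (outerTree i m P S)) x else 0) *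
        ev (innerTree i m P S) y +
      (if (S.op (innerLabel i m) (isolateEdge e)).TwoSided then
        ev (outerTree i m (insert e P) S) x else 0) * ev (innerTree i m P S) y := by
  by_cases hy : ev (innerTree i m P S) y = 0
  · simp [hy]
  have hY := isRooted_of_ev_ne_zero hy
  have hm := hY.pos
  -- As the coefficient of `y` is nonzero, the inner tree is stable, and its edges have labels of
  -- the block on both sides.
  have hP2 : ∀ f ∈ P, f ∈ S.edges → (S.op (innerLabel i m) (isolateEdge f)).TwoSided := by
    intro f hf hfS
    rw [← innerTree_isolateEdge hf]
    exact hY.2.2.twoSided (nodup_edges_innerTree hS) (by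
      rw [edges_innerTree, List.mem_filter]; exact ⟨hfS, by simpa using hf⟩)
  have hWn := nodup_edges_outerTree (i := i) (m := m) (P := P) hS
  have heW : e ∈ (outerTree i m P S).edges := by
    rw [edges_outerTree, List.mem_filter]; exact ⟨he, by simpa using heP⟩
  obtain ⟨t1, t2⟩ := twoSided_outerTree (i := i) (m := m) hS he heP
  have hcnt : ∀ {U : Tr ℕ}, 2 ≤ U.cnt i → ev U x = 0 := fun {U} hU => ev_eq_zero x fun h => by
    rw [h.2.1] at hU
    split_ifs at hU <;> omega
  -- If labels of the block lie on both sides of `e`, then `i` occurs twice in the outer tree, and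
  -- `e` is an edge of the inner tree contracted in a term of `x ∘ d y`. Otherwise `i` occurs once
  -- wherever the coefficient of `x` is nonzero, and the term belongs to `d x ∘ y`.
  by_cases hN : (S.op (innerLabel i m) (isolateEdge e)).TwoSided
  · obtain ⟨h1, h2⟩ := contractEdge_or_markEdge hWn heW (t1 hN)
    rw [markEdge_outerTree] at h2
    have hWs : ¬ (outerTree i m P S).Separated := fun h => by
      have := h i; omega
    rw [if_pos hN, if_neg hWs]
    rcases h2 with h2 | ⟨h2, h3⟩
    · rw [h2]; ring
    · rw [hcnt h2, hcnt h3]; ring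
  · rw [if_neg hN, zero_mul, add_zero]
    have h1 := cnt_le_cnt_contractEdge hWn heW (mt (t2 hP2) hN)
    by_cases hx : ev (contractEdge e (outerTree i m P S)) x = 0
    · simp [hx]
    rw [if_pos]
    intro b
    by_cases hb : b = i
    · subst hb
      refine h1.trans ?_
      rw [(isRooted_of_ev_ne_zero hx).2.1]
      split_ifs <;> omega
    · exact cnt_outerTree_le hm hs hb

theorem minimalOperad_d_comp (h : n + m = l + 1) (i : Fin n) (e : ℤ) (x : M k n)
    (hx : x ∈ (minimalOperad k).gr n e) (y : M k m) :
    (minimalOperad k).d l ((minimalOperad k).comp h i x y) =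
      (minimalOperad k).comp h i ((minimalOperad k).d n x) y +
        (e.negOnePow : ℤ) • (minimalOperad k).comp h i x ((minimalOperad k).d m y) := by
  classical
  refine ev_ext fun S hS => ?_
  by_cases hr : S.IsRooted l
  swap
  · rw [ev_eq_zero _ hr, ev_eq_zero _ hr]
  have hs : S.Separated := fun b => by rw [hr.2.1]; split_ifs <;> omega
  have hst := hr.2.2
  set E := S.edges.toFinset with hE
  rw [ev_d _ hS hs hst, map_add, map_zsmul, ev_comp h i _ _ hS, ev_comp h i _ _ hS]
  have hL : ∀ f ∈ E, ev (contractEdge f S) ((minimalOperad k).comp h i x y) =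
      ∑ P ∈ (E.erase f).powerset, (shuffleSign (E.erase f \ P) P : k) *
        (ev (contractEdge f (outerTree i m P S)) x * ev (innerTree i m P S) y) := fun f hf => by
    rw [ev_comp h i _ _ (nodup_edges_contractEdge f hS), toFinset_edges_contractEdge]
    refine Finset.sum_congr rfl fun P hP => ?_
    have hfP : f ∉ P := fun hfP => by simpa using Finset.mem_powerset.1 hP hfP
    rw [outerTree_contractEdge hfP, innerTree_contractEdge hfP]
  have hR1 : ∀ P ∈ E.powerset, (shuffleSign (E \ P) P : k) *
      (ev (outerTree i m P S) ((minimalOperad k).d n x) * ev (innerTree i m P S) y) =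
      ∑ f ∈ E \ P, (shuffleSign (E \ P) P : k) * (shuffleSign {f} ((E \ P).erase f) *
        ((if (outerTree i m P S).Separated then ev (contractEdge f (outerTree i m P S)) x else 0) *
        ev (innerTree i m P S) y)) := fun P hP => by
    rw [← Finset.mul_sum]
    congr 1
    by_cases hW : (outerTree i m P S).Separated
    · rw [ev_d _ (nodup_edges_outerTree hS) hW (stable_outerTree hst), toFinset_edges_outerTree,
        Finset.sum_mul]
      refine Finset.sum_congr rfl fun f _ => ?_
      rw [if_pos hW, mul_assoc]
    · rw [ev_eq_zero, zero_mul]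
      · simp [hW]
      · intro h
        refine hW fun b => ?_
        rw [h.2.1]; split_ifs <;> omega
  have hR2 : ∀ P ∈ E.powerset, (shuffleSign (E \ P) P : k) *
      (ev (outerTree i m P S) x * ev (innerTree i m P S) ((minimalOperad k).d m y)) =
      ∑ f ∈ P, (shuffleSign (E \ P) P : k) * (shuffleSign {f} (P.erase f) *
        ((if (S.op (innerLabel i m) (isolateEdge f)).TwoSided then
          ev (outerTree i m P S) x else 0) * ev (innerTree i m (P.erase f) S) y)) := fun P hP => by
    rw [← Finset.mul_sum]
    congr 1
    -- The inner tree has lost the labels outside the block and may be unstable.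
    rw [ev_d_of_separated _ (nodup_edges_innerTree hS) (separated_innerTree hs),
      toFinset_edges_innerTree (Finset.mem_powerset.1 hP), Finset.mul_sum]
    refine Finset.sum_congr rfl fun f hf => ?_
    rw [innerTree_isolateEdge hf, contractEdge_innerTree hf]
    split_ifs <;> ring
  -- Both sides become sums over an edge `f`, the one contracted by the differential, and a set `P`
  -- of edges without `f`.
  rw [Finset.sum_congr rfl hR1, Finset.sum_congr rfl hR2, sum_powerset_sum_sdiff,
    sum_powerset_sum_mem, Finset.smul_sum, ← Finset.sum_add_distrib]
  refine Finset.sum_congr rfl fun f hf => ?_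
  rw [hL f hf, Finset.mul_sum, Finset.smul_sum, ← Finset.sum_add_distrib]
  refine Finset.sum_congr rfl fun P hP => ?_
  have hP' := Finset.subset_erase.1 (Finset.mem_powerset.1 hP)
  have hfP := hP'.2
  rw [ev_mul_ev_eq i x y hS hs (List.mem_toFinset.1 hf) hfP, Finset.erase_insert hfP]
  set Q := E.erase f \ P with hQ
  have e1 : (E \ P).erase f = Q := by rw [hQ, Finset.erase_sdiff_comm]
  have e2 : E \ insert f P = Q := by rw [Finset.sdiff_insert, e1]
  have e3 : E.erase f = Q ∪ P := by rw [hQ, Finset.sdiff_union_of_subset (Finset.mem_powerset.1 hP)]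
  have e4 : E \ P = {f} ∪ Q := by
    rw [← e1, ← Finset.insert_eq, Finset.insert_erase (Finset.mem_sdiff.2 ⟨hf, hfP⟩)]
  have hfQ : f ∉ Q := by rw [← e1]; simp
  have hQP : Disjoint Q P := by rw [hQ]; exact Finset.sdiff_disjoint
  rw [e1, e2, e3, e4, Finset.insert_eq, shuffleSign_union_left _ (by simpa using hfQ),
    shuffleSign_union_right _ hQP, shuffleSign_union_right _ (by simpa using hfP),
    shuffleSign_swap (A := {f}) (B := Q) (by simpa using hfQ), Finset.card_singleton, one_mul]
  -- Moving `f` past the outer edges `Q` costs the sign `(-1) ^ Q.card`. By the degree formula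
  -- `Q.card` has the parity of the degree of `x`.
  have key : (e.negOnePow : ℤ) • (((-1) ^ Q.card : ℤ) : k) * ev (outerTree i m ({f} ∪ P) S) x =
      ev (outerTree i m ({f} ∪ P) S) x := by
    by_cases hx0 : ev (outerTree i m ({f} ∪ P) S) x = 0
    · rw [hx0, mul_zero]
    have hdeg := mem_gr_iff.1 hx _ (nodup_edges_outerTree hS) hx0
    rw [← List.toFinset_card_of_nodup (nodup_edges_outerTree hS), toFinset_edges_outerTree,
      ← Finset.insert_eq, ← hE, e2] at hdeg
    have he : e = 2 * n - 2 - Q.card := by omega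
    have : (e.negOnePow : ℤ) * (-1) ^ Q.card = 1 := by
      rw [he, Int.negOnePow_sub, show (2 * (n : ℤ) - 2) = 2 * (n - 1) by ring,
        Int.negOnePow_two_mul, one_mul, Int.coe_negOnePow_natCast, ← mul_pow]
      simp
    rw [zsmul_eq_mul, ← Int.cast_mul, this]; simp
  rw [zsmul_eq_mul] at key
  simp only [zsmul_eq_mul]
  push_cast at key ⊢
  split_ifs
  · linear_combination (-(shuffleSign {f} Q * shuffleSign Q P * shuffleSign {f} P *
      ev (innerTree i m P S) y : k)) * key
  · ring
  · linear_combination (-(shuffleSign {f} Q * shuffleSign Q P * shuffleSign {f} P *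
      ev (innerTree i m P S) y : k)) * key
  · ring

end

/-! ## The symmetric group actions and the unit -/

section

variable {n : ℕ}

lemma permFun_of_lt (σ : Equiv.Perm (Fin n)) {a : ℕ} (h : a < n) : permFun σ a = σ ⟨a, h⟩ :=
  dif_pos h

lemma permFun_of_le (σ : Equiv.Perm (Fin n)) {a : ℕ} (h : n ≤ a) : permFun σ a = a :=
  dif_neg (by omega)

lemma permFun_fin (σ : Equiv.Perm (Fin n)) (a : Fin n) : permFun σ a = σ a :=
  permFun_of_lt σ a.2

lemma permFun_mul (σ τ : Equiv.Perm (Fin n)) (a : ℕ) :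
    permFun (σ * τ) a = permFun σ (permFun τ a) := by
  by_cases h : a < n
  · rw [permFun_of_lt _ h, permFun_of_lt τ h, permFun_fin]; rfl
  · rw [permFun_of_le _ (by omega), permFun_of_le τ (by omega), permFun_of_le _ (by omega)]

lemma permFun_one (a : ℕ) : permFun (1 : Equiv.Perm (Fin n)) a = a := by
  unfold permFun; split_ifs <;> rfl

lemma permFun_inv_permFun (σ : Equiv.Perm (Fin n)) (a : ℕ) :
    permFun σ⁻¹ (permFun σ a) = a := by
  rw [← permFun_mul, inv_mul_cancel, permFun_one]

lemma permFun_permFun_inv (σ : Equiv.Perm (Fin n)) (a : ℕ) :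
    permFun σ (permFun σ⁻¹ a) = a := by
  rw [← permFun_mul, mul_inv_cancel, permFun_one]

/-- Relabel the vertices of a tree. -/
def relabelTree (f : ℕ → ℕ) (S : Tr ℕ) : Tr ℕ := S.op (fun a => {f a}) fun _ => none

lemma edges_relabelTree (f : ℕ → ℕ) (S : Tr ℕ) : (relabelTree f S).edges = S.edges := by
  rw [relabelTree, Tr.edges_op]; simp

lemma isRooted_relabel {T : PTree Unit} (hT : T.IsRooted n) (σ : Equiv.Perm (Fin n)) :
    (T.relabel (permFun σ)).IsRooted n := by
  have hst : (T.relabel (permFun σ)).toTr.Stable := by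
    rw [PTree.toTr_relabel]
    exact Tr.stable_op (fun _ => Finset.singleton_nonempty _) (PTree.isRooted_toTr.2 hT).2.2
  refine ⟨?_, PTree.stable_toTr.1 hst⟩
  rw [PTree.whites_relabel]
  refine (hT.1.map _).trans ?_
  rw [List.perm_ext_iff_of_nodup (List.nodup_range.map
    (Function.LeftInverse.injective (permFun_inv_permFun σ))) List.nodup_range]
  intro a
  simp only [List.mem_map, List.mem_range]
  constructor
  · rintro ⟨b, hb, rfl⟩
    rw [permFun_of_lt σ hb]; exact (σ ⟨b, hb⟩).2
  · intro ha
    exact ⟨permFun σ⁻¹ a, by rw [permFun_of_lt _ ha]; exact (σ⁻¹ ⟨a, ha⟩).2,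
      permFun_permFun_inv σ a⟩

lemma separated_relabelTree (σ : Equiv.Perm (Fin n)) {S : Tr ℕ} (hs : S.Separated) :
    (relabelTree (permFun σ) S).Separated := fun b => by
  refine (Tr.cnt_op_le (a := permFun σ⁻¹ b) (fun a h => ?_) (fun _ _ h => by simp at h) S).trans
    (hs _)
  rw [Finset.mem_singleton.1 h, permFun_inv_permFun]

lemma contractEdge_relabelTree (f : ℕ → ℕ) (e : ℕ) (S : Tr ℕ) :
    contractEdge e (relabelTree f S) = relabelTree f (contractEdge e S) := by
  rw [contractEdge, relabelTree, relabelTree, contractEdge, Tr.op_op (g'' := fun a => {f a})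
    (h'' := contractOnly e), Tr.op_op]
  · simp
  · intro e'; by_cases h : e' = e <;> simp [h, contractOnly]
  · simp
  · intro e'; rfl

variable {k : Type*} [Field k]

/-- Instead of relabeling `x` by `σ`, one takes coefficients at trees relabeled by the inverse. -/
lemma ev_act (σ : Equiv.Perm (Fin n)) (x : M k n) (S : Tr ℕ) :
    ev S ((minimalOperad k).act n σ x) = ev (relabelTree (permFun σ⁻¹) S) x := by
  classical
  induction x using Finsupp.induction_linear with
  | zero => simp
  | add x y hx hy => simp only [map_add, hx, hy]
  | single T a =>
    have : (minimalOperad k).act n σ (Finsupp.single T a) =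
        a • ofOriented k n ((T.1.number 0).relabel (permFun σ)) := by
      simp only [minimalOperad, Finsupp.linearCombination_single]
    rw [this, map_smul, ev_ofOriented, ev_single, edges_relabelTree, PTree.edges_relabel,
      PTree.listSign_edges_number, PTree.toTr_relabel, ← Tr.forget_op, ← PTree.toTr_forget,
      PTree.forget_number, relabelTree, ← Tr.forget_op, smul_eq_mul]
    have hiff : T.1.toTr.op (fun a => {permFun σ a}) (fun _ => none) = S.forget ↔
        T.1.toTr = S.forget.op (fun a => {permFun σ⁻¹ a}) fun _ => none := by
      constructor
      · intro h
        rw [← h, Tr.op_op (g'' := fun a => {a}) (h'' := fun _ => none), Tr.op_id fun _ _ => rfl]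
        · intro a; simp [permFun_inv_permFun]
        · intro; rfl
      · intro h
        rw [h, Tr.op_op (g'' := fun a => {a}) (h'' := fun _ => none), Tr.op_id fun _ _ => rfl]
        · intro a; simp [permFun_permFun_inv]
        · intro; rfl
    by_cases h : T.1.toTr.op (fun a => {permFun σ a}) (fun _ => none) = S.forget
    · have hr : S.IsRooted n := by
        rw [← Tr.isRooted_forget, ← h, ← PTree.toTr_relabel]
        exact PTree.isRooted_toTr.2 (isRooted_relabel T.2 σ)
      rw [if_pos ⟨hr, h⟩, if_pos (hiff.1 h)]; push_cast; ring
    · rw [if_neg (fun h' => h h'.2), if_neg (mt hiff.2 h), mul_zero]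

open Classical in
lemma ev_one (S : Tr ℕ) :
    ev S (minimalOperad k).one = if S = ({0}, .nil) then 1 else 0 := by
  change ev S (ofOriented k 1 ⟨some 0, .nil⟩) = _
  rw [ev_ofOriented]
  have hr : (⟨some 0, .nil⟩ : PTree ℕ).IsRooted 1 := by simp [PTree.IsRooted, PTree.whites,
    Branches.whites, Branches.Stable]
  by_cases h : S = ({0}, .nil)
  · subst h
    rw [if_pos, if_pos rfl]
    · simp [PTree.edges, Branches.edges, Tr.edges, Br.edges, listSign_nil]
    · exact ⟨PTree.isRooted_toTr.2 hr, rfl⟩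
  · rw [if_neg, if_neg h]
    rintro ⟨-, h'⟩
    apply h
    obtain ⟨v, _ | _⟩ := S
    · simp only [PTree.toTr, Tr.forget, Tr.mapE, Prod.mk.injEq] at h'
      rw [← h'.1]; rfl
    · simp [PTree.toTr, Branches.toBr, Tr.forget, Tr.mapE, Br.mapE] at h'

/-! ## The axioms of a dg operad -/

lemma Tr.IsRooted.separated {ε : Type} {S : Tr ε} (h : S.IsRooted n) : S.Separated := fun b => by
  rw [h.2.1]; split_ifs <;> omega

lemma isInternal_supported {α : Type*} (f : α → ℤ) :
    DirectSum.IsInternal fun e => Finsupp.supported k k {a | f a = e} := by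
  apply DirectSum.isInternal_submodule_of_iSupIndep_of_iSup_eq_top
  · intro e
    have h : ⨆ e', ⨆ (_ : e' ≠ e), Finsupp.supported k k {a | f a = e'} ≤
        Finsupp.supported k k {a | f a = e}ᶜ :=
      iSup₂_le fun e' he => Finsupp.supported_mono fun a ha ha' => he (ha.symm.trans ha')
    exact (Finsupp.disjoint_supported_supported disjoint_compl_right).mono_right h
  · rw [← Finsupp.supported_iUnion, ← Finsupp.supported_univ]
    congr 1
    ext a
    simp

lemma minimalOperad_internal : DirectSum.IsInternal ((minimalOperad k).gr n) :=
  isInternal_supported fun T : RootedTree n => T.1.degree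

lemma minimalOperad_d_mem (e : ℤ) (x : M k n) (hx : x ∈ (minimalOperad k).gr n e) :
    (minimalOperad k).d n x ∈ (minimalOperad k).gr n (e - 1) := by
  rw [mem_gr_iff] at hx ⊢
  intro S hS h
  have hr := isRooted_of_ev_ne_zero h
  rw [ev_d x hS hr.separated hr.2.2] at h
  obtain ⟨f, hf, hne⟩ := Finset.exists_ne_zero_of_sum_ne_zero h
  have := hx _ (nodup_edges_contractEdge f hS) (right_ne_zero_of_mul hne)
  rw [← List.toFinset_card_of_nodup (nodup_edges_contractEdge f hS), toFinset_edges_contractEdge,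
    Finset.card_erase_of_mem hf, List.toFinset_card_of_nodup hS] at this
  have hpos : 0 < S.edges.length := List.length_pos_of_mem (List.mem_toFinset.1 hf)
  omega

lemma contractEdge_comm (e f : ℕ) (S : Tr ℕ) :
    contractEdge e (contractEdge f S) = contractEdge f (contractEdge e S) := by
  have : ∀ e f, contractEdge e (contractEdge f S) =
      S.op (fun a => {a}) fun e' => if e' = e ∨ e' = f then some ∅ else none := fun e f => by
    rw [contractEdge, contractEdge, Tr.op_op]
    · simp
    · intro e'
      simp only [contractOnly]; split_ifs <;> simp_all
  rw [this, this]
  simp only [or_comm]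

lemma separated_contractEdge (e : ℕ) {S : Tr ℕ} (hs : S.Separated) :
    (contractEdge e S).Separated := fun b => by
  refine (Tr.cnt_op_le (a := b) (fun a h => (Finset.mem_singleton.1 h).symm) (fun e' l h => ?_)
    S).trans (hs _)
  rw [contractOnly] at h
  split_ifs at h
  simp only [Option.some.injEq] at h
  simp [← h]

lemma stable_contractEdge (e : ℕ) {S : Tr ℕ} (hst : S.Stable) : (contractEdge e S).Stable :=
  Tr.stable_op (fun _ => Finset.singleton_nonempty _) hst

/-- The coefficients are sums over ordered pairs of edges contracted one after the other. Exchanging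
the two edges gives the same tree with the opposite sign. -/
lemma minimalOperad_d_d (x : M k n) :
    (minimalOperad k).d n ((minimalOperad k).d n x) = 0 := by
  refine ev_ext fun S hS => ?_
  rw [map_zero]
  by_cases hr : S.IsRooted n
  swap
  · exact ev_eq_zero _ hr
  set E := S.edges.toFinset with hE
  rw [ev_d _ hS hr.separated hr.2.2]
  have h1 : ∀ e ∈ E, (shuffleSign {e} (E.erase e) : k) *
      ev (contractEdge e S) ((minimalOperad k).d n x) =
      ∑ f ∈ E.erase e, (shuffleSign {e} (E.erase e) : k) * (shuffleSign {f} ((E.erase e).erase f) *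
        ev (contractEdge f (contractEdge e S)) x) := fun e _ => by
    rw [ev_d _ (nodup_edges_contractEdge e hS) (separated_contractEdge e hr.separated)
      (stable_contractEdge e hr.2.2), toFinset_edges_contractEdge, Finset.mul_sum]
  rw [Finset.sum_congr rfl h1, Finset.sum_sigma']
  refine Finset.sum_involution (fun p _ => ⟨p.2, p.1⟩) ?_ ?_ ?_ ?_
  · rintro ⟨e, f⟩ h
    simp only [Finset.mem_sigma, Finset.mem_erase] at h
    obtain ⟨he, hfe, hf⟩ := h
    set R := (E.erase e).erase f with hR
    have e1 : E.erase e = {f} ∪ R := by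
      rw [hR, ← Finset.insert_eq, Finset.insert_erase (Finset.mem_erase.2 ⟨hfe, hf⟩)]
    have e2 : (E.erase f).erase e = R := by rw [hR, Finset.erase_right_comm]
    have e3 : E.erase f = {e} ∪ R := by
      rw [← e2, ← Finset.insert_eq, Finset.insert_erase (Finset.mem_erase.2 ⟨Ne.symm hfe, he⟩)]
    have hfR : f ∉ R := by simp [hR]
    have heR : e ∉ R := by simp [hR]
    simp only
    rw [e2, e3, e1, contractEdge_comm, shuffleSign_union_right _ (by simpa using hfR),
      shuffleSign_union_right _ (by simpa using heR),
      shuffleSign_swap (A := {e}) (B := {f}) (by simpa using Ne.symm hfe)]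
    push_cast
    simp only [Finset.card_singleton, mul_one, pow_one]
    ring
  · rintro ⟨e, f⟩ h _ heq
    simp only [Finset.mem_sigma, Finset.mem_erase] at h
    simp only [Sigma.mk.injEq] at heq
    exact h.2.1 heq.1
  · rintro ⟨e, f⟩ h
    simp only [Finset.mem_sigma, Finset.mem_erase] at h ⊢
    exact ⟨h.2.2, Ne.symm h.2.1, h.1⟩
  · rintro ⟨e, f⟩ h; rfl

lemma minimalOperad_act_d (σ : Equiv.Perm (Fin n)) (x : M k n) :
    (minimalOperad k).d n ((minimalOperad k).act n σ x) =
      (minimalOperad k).act n σ ((minimalOperad k).d n x) := by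
  refine ev_ext fun S hS => ?_
  by_cases hr : S.IsRooted n
  swap
  · rw [ev_eq_zero _ hr, ev_eq_zero _ hr]
  rw [ev_d _ hS hr.separated hr.2.2, ev_act, ev_d _ (by rwa [edges_relabelTree])
    (separated_relabelTree _ hr.separated)
    (Tr.stable_op (fun _ => Finset.singleton_nonempty _) hr.2.2), edges_relabelTree]
  refine Finset.sum_congr rfl fun e _ => ?_
  rw [ev_act, contractEdge_relabelTree]

lemma minimalOperad_act_mem (σ : Equiv.Perm (Fin n)) (e : ℤ) (x : M k n)
    (hx : x ∈ (minimalOperad k).gr n e) :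
    (minimalOperad k).act n σ x ∈ (minimalOperad k).gr n e := by
  rw [mem_gr_iff] at hx ⊢
  intro S hS h
  rw [ev_act] at h
  simpa [edges_relabelTree] using hx _ (by rwa [edges_relabelTree]) h

lemma minimalOperad_one_mem : (minimalOperad k).one ∈ (minimalOperad k).gr 1 0 := by
  classical
  rw [mem_gr_iff]
  intro S hS h
  rw [ev_one] at h
  obtain rfl : S = ({0}, .nil) := by by_contra hne; simp [hne] at h
  simp [Tr.edges, Br.edges]

/-- For reasons of degree a tree in the differential would have one edge. Neither end has two
branches above it, so stability asks for labels at both ends, but there is only one label. -/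
lemma minimalOperad_d_one : (minimalOperad k).d 1 (minimalOperad k).one = 0 := by
  refine ev_ext fun S hS => ?_
  rw [map_zero]
  by_contra h
  have hl := mem_gr_iff.1 (minimalOperad_d_mem 0 _ minimalOperad_one_mem) S hS h
  obtain ⟨-, hc, h0, hst⟩ := isRooted_of_ev_ne_zero h
  obtain ⟨v, _ | ⟨e, w, A, R⟩⟩ := S
  · simp [Tr.edges, Br.edges] at hl
  simp only [Tr.edges, Br.edges, List.length_cons, List.length_append] at hl
  obtain rfl : A = .nil := Br.eq_nil_of_edges (List.length_eq_zero_iff.1 (by omega))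
  obtain rfl : R = .nil := Br.eq_nil_of_edges (List.length_eq_zero_iff.1 (by omega))
  have hv : v.Nonempty := by
    by_contra hv
    simpa [Br.length] using h0 (Finset.not_nonempty_iff_eq_empty.1 hv)
  have hw : w.Nonempty := by
    by_contra hw
    simpa [Br.length] using hst.1 (Finset.not_nonempty_iff_eq_empty.1 hw)
  obtain ⟨a, ha⟩ := hv
  obtain ⟨b, hb⟩ := hw
  have ha' := hc a
  have hb' := hc b
  have h0' := hc 0
  simp only [Tr.cnt, Br.cnt, ha, hb, if_true] at ha' hb' h0'
  obtain rfl : a = 0 := by split_ifs at ha' <;> omega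
  obtain rfl : b = 0 := by split_ifs at hb' <;> omega
  simp [ha, hb] at h0'

end

/-! ### Degrees and units of compositions -/

section

variable {k : Type*} [Field k] {n m l : ℕ}

lemma minimalOperad_comp_mem (h : n + m = l + 1) (i : Fin n) (e f : ℤ) (x : M k n)
    (hx : x ∈ (minimalOperad k).gr n e) (y : M k m) (hy : y ∈ (minimalOperad k).gr m f) :
    (minimalOperad k).comp h i x y ∈ (minimalOperad k).gr l (e + f) := by
  rw [mem_gr_iff] at *
  intro S hS hne
  rw [ev_comp h i x y hS] at hne
  obtain ⟨P, hP, hne⟩ := Finset.exists_ne_zero_of_sum_ne_zero hne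
  have hne := right_ne_zero_of_mul hne
  have h1 := hx _ (nodup_edges_outerTree hS) (left_ne_zero_of_mul hne)
  have h2 := hy _ (nodup_edges_innerTree hS) (right_ne_zero_of_mul hne)
  rw [Finset.mem_powerset] at hP
  rw [← List.toFinset_card_of_nodup (nodup_edges_outerTree hS), toFinset_edges_outerTree,
    Finset.card_sdiff_of_subset hP] at h1
  rw [← List.toFinset_card_of_nodup (nodup_edges_innerTree hS), toFinset_edges_innerTree hP] at h2
  have := Finset.card_le_card hP
  rw [← List.toFinset_card_of_nodup hS]
  omega

lemma edges_of_ev_one_ne_zero {S : Tr ℕ} (h : ev S (minimalOperad k).one ≠ 0) : S.edges = [] := by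
  classical
  rw [ev_one] at h
  obtain rfl : S = ({0}, .nil) := by by_contra hne; simp [hne] at h
  rfl

/-- When everything collapses to one vertex, only its set of labels has to be known; the last two
clauses determine it. -/
lemma Tr.op_of_isSome {ε : Type} {g : ℕ → Finset ℕ} {h : ε → Option (Finset ℕ)} {S : Tr ε}
    (hh : ∀ e ∈ S.edges, (h e).isSome) :
    S.op g h = ((S.op g h).1, .nil) ∧ (∀ a b, 0 < S.cnt a → b ∈ g a → b ∈ (S.op g h).1) ∧
      ∀ b ∈ (S.op g h).1, (∃ a, 0 < S.cnt a ∧ b ∈ g a) ∨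
        ∃ e ∈ S.edges, ∃ l, h e = some l ∧ b ∈ l := by
  have hnil : (S.2.op g h).2 = .nil := Br.eq_nil_of_edges (by
    rw [Br.edges_op, List.filter_eq_nil_iff]
    intro e he
    simpa [Option.isSome_iff_ne_none] using hh e he)
  refine ⟨Prod.ext rfl hnil, fun a b ha hb => ?_, fun b hb => ?_⟩
  · simp only [op, Finset.mem_union, Finset.mem_biUnion]
    by_cases hv : a ∈ S.1
    · exact Or.inl ⟨a, hv, hb⟩
    · rw [cnt, if_neg hv, zero_add] at ha
      rcases Br.mem_op_or (h := h) ha hb with h' | h'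
      · exact Or.inr h'
      · simp [hnil, Br.cnt] at h'
  · simp only [op, Finset.mem_union, Finset.mem_biUnion] at hb
    rcases hb with ⟨a, ha, hb⟩ | hb
    · exact Or.inl ⟨a, by simp [cnt, ha], hb⟩
    · rcases Br.of_mem_op (Or.inl hb) with ⟨a, ha, hb⟩ | h'
      · exact Or.inl ⟨a, by rw [cnt]; omega, hb⟩
      · exact Or.inr h'

/-- The unit has no edges, so only `P = ∅` contributes, for which nothing is contracted in the outer
tree. -/
lemma minimalOperad_comp_one (i : Fin n) (x : M k n) :
    (minimalOperad k).comp rfl i x (minimalOperad k).one = x := by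
  classical
  refine ev_ext fun S hS => ?_
  by_cases hr : S.IsRooted n
  swap
  · rw [ev_eq_zero _ hr, ev_eq_zero _ hr]
  rw [ev_comp _ i _ _ hS, Finset.sum_eq_single_of_mem ∅ (Finset.empty_mem_powerset _)]
  · have h1 : outerTree i 1 ∅ S = S := by
      have : (fun a => {outerLabel i 1 a} : ℕ → Finset ℕ) = fun a => {a} := by
        funext a; unfold outerLabel; split_ifs <;> congr 1 <;> omega
      rw [outerTree, this, Tr.op_id fun _ _ => by simp]
    have h2 : innerTree i 1 ∅ S = ({0}, .nil) := by
      obtain ⟨a1, a2, a3⟩ := Tr.op_of_isSome (S := S) (g := innerLabel i 1)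
        (h := fun e => if e ∈ (∅ : Finset ℕ) then none else some ∅) fun _ _ => by simp
      rw [innerTree, a1]
      congr 1
      ext b
      rw [Finset.mem_singleton]
      constructor
      · intro hb
        rcases a3 b hb with ⟨a, -, h⟩ | ⟨e, -, l, hl, h⟩
        · unfold innerLabel at h
          split_ifs at h with h'
          · simp only [Finset.mem_singleton] at h; omega
          · simp at h
        · simp at hl
          simp [← hl] at h
      · rintro rfl
        exact a2 i 0 (by simp [hr.2.1]) (by simp [innerLabel])
    rw [h1, h2, ev_one, if_pos rfl, shuffleSign_empty_right]; simp
  · intro P hP hne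
    have : ev (innerTree i 1 P S) (minimalOperad k).one = 0 := by
      by_contra h
      have := toFinset_edges_innerTree (i := (i : ℕ)) (m := 1) (Finset.mem_powerset.1 hP)
      rw [edges_of_ev_one_ne_zero h] at this
      exact hne this.symm
    rw [this]; ring

/-- Here only the set of all edges contributes, since the outer tree must have no edges. -/
lemma minimalOperad_one_comp (y : M k n) :
    (minimalOperad k).comp (Nat.add_comm 1 n) 0 (minimalOperad k).one y = y := by
  classical
  refine ev_ext fun S hS => ?_
  by_cases hr : S.IsRooted n
  swap
  · rw [ev_eq_zero _ hr, ev_eq_zero _ hr]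
  have hlt : ∀ a, 0 < S.cnt a → a < n := fun a ha => by
    rw [hr.2.1] at ha; split_ifs at ha <;> omega
  rw [ev_comp _ 0 _ _ hS, Finset.sum_eq_single_of_mem _ (Finset.mem_powerset_self _)]
  · have h1 : innerTree 0 n S.edges.toFinset S = S := by
      rw [innerTree, Tr.op_congr (g' := fun a => {a}) (h' := fun _ => none),
        Tr.op_id fun _ _ => rfl]
      · intro a ha; simp [innerLabel, hlt a ha]
      · intro e he; simp [he]
    have h2 : outerTree 0 n S.edges.toFinset S = ({0}, .nil) := by
      obtain ⟨a1, a2, a3⟩ := Tr.op_of_isSome (S := S) (g := fun a => {outerLabel 0 n a})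
        (h := fun e => if e ∈ S.edges.toFinset then some {0} else none) fun e he => by simp [he]
      rw [outerTree, a1]
      congr 1
      ext b
      rw [Finset.mem_singleton]
      have hpos := hr.pos
      constructor
      · intro hb
        rcases a3 b hb with ⟨a, ha, h⟩ | ⟨e, -, l, hl, h⟩
        · have := hlt a ha
          simpa [outerLabel, this] using h
        · split_ifs at hl
          rw [Option.some.injEq] at hl
          simpa [← hl] using h
      · rintro rfl
        exact a2 0 0 (by simp [hr.2.1, hpos]) (by simp [outerLabel, hpos])
    rw [Fin.val_zero, h1, h2, ev_one, if_pos rfl, Finset.sdiff_self, shuffleSign_empty_left]; simp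
  · intro P hP hne
    have : ev (outerTree (0 : Fin 1) n P S) (minimalOperad k).one = 0 := by
      by_contra h
      have := toFinset_edges_outerTree (i := ((0 : Fin 1) : ℕ)) (m := n) (P := P) (S := S)
      rw [edges_of_ev_one_ne_zero h] at this
      exact hne (Finset.Subset.antisymm (Finset.mem_powerset.1 hP)
        (Finset.sdiff_eq_empty_iff_subset.1 this.symm))
    rw [this]; ring

/-! ### Associativity -/

lemma sum_powerset_sdiff_comm (E : Finset ℕ) (F : Finset ℕ → Finset ℕ → k) :
    ∑ P ∈ E.powerset, ∑ Q ∈ (E \ P).powerset, F P Q =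
      ∑ Q ∈ E.powerset, ∑ P ∈ (E \ Q).powerset, F P Q := by
  refine Finset.sum_comm' fun P Q => ?_
  simp only [Finset.mem_powerset, Finset.subset_sdiff]
  exact ⟨fun ⟨h1, h2, h3⟩ => ⟨⟨h1, h3.symm⟩, h2⟩, fun ⟨⟨h1, h3⟩, h2⟩ => ⟨h1, h2, h3.symm⟩⟩

/-- Two successive choices of disjoint sets amount to the choice of their union and of the first set
inside it; these are the two ways of indexing an iterated composition. -/
lemma sum_powerset_powerset (E : Finset ℕ) (F : Finset ℕ → Finset ℕ → k) :
    ∑ P ∈ E.powerset, ∑ Q ∈ (E \ P).powerset, F P Q =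
      ∑ U ∈ E.powerset, ∑ P ∈ U.powerset, F P (U \ P) := by
  rw [Finset.sum_sigma', Finset.sum_sigma']
  refine Finset.sum_bij' (fun p _ => ⟨p.1 ∪ p.2, p.1⟩) (fun q _ => ⟨q.2, q.1 \ q.2⟩)
    ?_ ?_ ?_ ?_ ?_
  · rintro ⟨P, Q⟩ h
    simp only [Finset.mem_sigma, Finset.mem_powerset, Finset.subset_sdiff] at h ⊢
    exact ⟨Finset.union_subset h.1 h.2.1, Finset.subset_union_left⟩
  · rintro ⟨U, P⟩ h
    simp only [Finset.mem_sigma, Finset.mem_powerset] at h ⊢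
    exact ⟨h.2.trans h.1, Finset.sdiff_subset_sdiff h.1 subset_rfl⟩
  · rintro ⟨P, Q⟩ h
    simp only [Finset.mem_sigma, Finset.mem_powerset, Finset.subset_sdiff] at h
    simp [Finset.union_sdiff_cancel_left h.2.2.symm]
  · rintro ⟨U, P⟩ h
    simp only [Finset.mem_sigma, Finset.mem_powerset] at h
    simp [Finset.union_sdiff_of_subset h.2]
  · rintro ⟨P, Q⟩ h
    simp only [Finset.mem_sigma, Finset.mem_powerset, Finset.subset_sdiff] at h
    simp [Finset.union_sdiff_cancel_left h.2.2.symm]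

section

variable {i j p r s t : ℕ} {P Q : Finset ℕ}

/-- In a nested composition `P` consists of the edges of the innermost tree, `Q` of those of the
middle tree, and the others belong to the host. This lemma and the next two say that both
bracketings cut `S` into the same three trees. -/
lemma outerTree_outerTree_seq (hj : j < m) (hs : s = i + j) (hr : m + p = r + 1) (S : Tr ℕ) :
    outerTree i m Q (outerTree s p P S) = outerTree i r (P ∪ Q) S := by
  rw [outerTree, outerTree, outerTree, Tr.op_op]
  · intro a
    rw [Finset.singleton_biUnion, Finset.singleton_inj]
    unfold outerLabel; split_ifs <;> omega
  · intro e
    have : outerLabel i m s = i := by unfold outerLabel; split_ifs <;> omega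
    by_cases h : e ∈ P <;> by_cases h' : e ∈ Q <;> simp [h, h', this]

lemma innerTree_outerTree_seq (hj : j < m) (hs : s = i + j)
    (hr : m + p = r + 1) (S : Tr ℕ) :
    innerTree i m Q (outerTree s p P S) = outerTree j p P (innerTree i r (P ∪ Q) S) := by
  rw [innerTree, outerTree, outerTree, innerTree, Tr.op_op
    (g'' := fun a => innerLabel i m (outerLabel s p a))
    (h'' := fun e => if e ∈ P then some {j} else if e ∈ Q then none else some ∅), Tr.op_op]
  · intro a
    unfold innerLabel
    by_cases h : i ≤ a ∧ a < i + r
    · rw [if_pos h, Finset.singleton_biUnion]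
      unfold outerLabel
      split_ifs <;> first | omega | skip
      all_goals first | rfl | (congr 1; omega)
    · rw [if_neg h, if_neg, Finset.biUnion_empty]
      unfold outerLabel; split_ifs <;> omega
  · intro e
    by_cases h : e ∈ P
    · simp [h]
    · by_cases h' : e ∈ Q <;> simp [h, h']
  · intro a; simp
  · intro e
    by_cases h : e ∈ P
    · have : innerLabel i m s = {j} := by
        rw [innerLabel, if_pos (by omega)]; congr 1; omega
      simp [h, this]
    · by_cases h' : e ∈ Q <;> simp [h, h']

lemma innerTree_innerTree_seq (hj : j < m) (hs : s = i + j) (hr : m + p = r + 1) (S : Tr ℕ) :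
    innerTree s p P S = innerTree j p P (innerTree i r (P ∪ Q) S) := by
  rw [innerTree, innerTree, innerTree, Tr.op_op]
  · intro a
    unfold innerLabel
    by_cases h : i ≤ a ∧ a < i + r
    · rw [if_pos h, Finset.singleton_biUnion]
      split_ifs <;> first | omega | rfl | skip
      all_goals first | rfl | (congr 1; omega)
    · rw [if_neg h, if_neg, Finset.biUnion_empty]; omega
  · intro e
    by_cases h : e ∈ P
    · simp [h]
    · by_cases h' : e ∈ Q <;> simp [h, h']

end

theorem minimalOperad_assoc_seq {p r q : ℕ} (h₁ : n + m = l + 1) (h₂ : l + p = q + 1)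
    (h₃ : m + p = r + 1) (h₄ : n + r = q + 1) (i : Fin n) (j : Fin m) (s : Fin l)
    (hs : (s : ℕ) = i + j) (x : M k n) (y : M k m) (z : M k p) :
    (minimalOperad k).comp h₂ s ((minimalOperad k).comp h₁ i x y) z =
      (minimalOperad k).comp h₄ i x ((minimalOperad k).comp h₃ j y z) := by
  refine ev_ext fun S hS => ?_
  rw [ev_comp _ _ _ _ hS, ev_comp _ _ _ _ hS]
  set E := S.edges.toFinset with hE
  have hL : ∀ P ∈ E.powerset, (shuffleSign (E \ P) P : k) *
      (ev (outerTree s p P S) ((minimalOperad k).comp h₁ i x y) * ev (innerTree s p P S) z) =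
      ∑ Q ∈ (E \ P).powerset, (shuffleSign (E \ P) P * shuffleSign ((E \ P) \ Q) Q : k) *
        (ev (outerTree i m Q (outerTree s p P S)) x *
          ev (innerTree i m Q (outerTree s p P S)) y * ev (innerTree s p P S) z) := fun P _ => by
    rw [ev_comp _ _ _ _ (nodup_edges_outerTree hS), toFinset_edges_outerTree, Finset.sum_mul,
      Finset.mul_sum]
    exact Finset.sum_congr rfl fun Q _ => by ring
  have hR : ∀ U ∈ E.powerset, (shuffleSign (E \ U) U : k) * (ev (outerTree i r U S) x *
      ev (innerTree i r U S) ((minimalOperad k).comp h₃ j y z)) =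
      ∑ P ∈ U.powerset, (shuffleSign (E \ U) U * shuffleSign (U \ P) P : k) *
        (ev (outerTree i r U S) x * ev (outerTree j p P (innerTree i r U S)) y *
          ev (innerTree j p P (innerTree i r U S)) z) := fun U hU => by
    rw [ev_comp _ _ _ _ (nodup_edges_innerTree hS),
      toFinset_edges_innerTree (Finset.mem_powerset.1 hU), Finset.mul_sum, Finset.mul_sum]
    exact Finset.sum_congr rfl fun Q _ => by ring
  rw [Finset.sum_congr rfl hL, Finset.sum_congr rfl hR, sum_powerset_powerset]
  refine Finset.sum_congr rfl fun U hU => Finset.sum_congr rfl fun P hP => ?_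
  rw [Finset.mem_powerset] at hU hP
  have hPU : P ∪ U \ P = U := Finset.union_sdiff_of_subset hP
  have hd : Disjoint P (U \ P) := Finset.disjoint_sdiff
  rw [outerTree_outerTree_seq j.2 hs h₃, innerTree_outerTree_seq j.2 hs h₃,
    innerTree_innerTree_seq (Q := U \ P) j.2 hs h₃, hPU]
  have e1 : (E \ P) \ (U \ P) = E \ U := by
    ext a; simp only [Finset.mem_sdiff]; have := @hP a; tauto
  have e2 : E \ P = (E \ U) ∪ (U \ P) := by
    ext a; simp only [Finset.mem_sdiff, Finset.mem_union]; have := @hP a; have := @hU a; tauto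
  have hd2 : Disjoint (E \ U) (U \ P) := Finset.sdiff_disjoint.mono_right Finset.sdiff_subset
  have e3 := shuffleSign_union_right (E \ U) hd
  rw [hPU] at e3
  -- Both signs become the product of the shuffle signs of the three pairs formed from the edge sets
  -- `E \ U`, `U \ P` and `P`.
  rw [e1, e2, shuffleSign_union_left _ hd2, e3]
  push_cast; ring

section

variable {i j p s : ℕ} {P Q : Finset ℕ}

/-- Here `P` and `Q` belong to trees inserted at different vertices; as they are disjoint, each
contracted edge leaves an unambiguous mark. -/
lemma outerTree_outerTree_par (hPQ : Disjoint P Q) (hij : i < j) (hs : s + 1 = j + m) (S : Tr ℕ) :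
    outerTree i m Q (outerTree s p P S) = outerTree j p P (outerTree i m Q S) := by
  rw [outerTree, outerTree, outerTree, outerTree, Tr.op_op
    (g'' := fun a => {outerLabel i m (outerLabel s p a)})
    (h'' := fun e => if e ∈ P then some {j} else if e ∈ Q then some {i} else none), Tr.op_op]
  · intro a
    rw [Finset.singleton_biUnion, Finset.singleton_inj]
    unfold outerLabel; split_ifs <;> omega
  · intro e
    have : outerLabel j p i = i := by unfold outerLabel; split_ifs <;> omega
    by_cases h : e ∈ P
    · have : e ∉ Q := Finset.disjoint_left.1 hPQ h
      simp [h, this]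
    · by_cases h' : e ∈ Q <;> simp [h, h', this]
  · intro a; simp
  · intro e
    have : outerLabel i m s = j := by unfold outerLabel; split_ifs <;> omega
    by_cases h : e ∈ P
    · simp [h, this]
    · by_cases h' : e ∈ Q <;> simp [h, h']

lemma innerTree_outerTree_left (hPQ : Disjoint P Q) (hij : i < j) (hs : s + 1 = j + m)
    (S : Tr ℕ) : innerTree i m Q (outerTree s p P S) = innerTree i m Q S := by
  rw [innerTree, outerTree, innerTree, Tr.op_op]
  · intro a
    rw [Finset.singleton_biUnion]
    unfold innerLabel outerLabel; split_ifs <;> first | rfl | omega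
  · intro e
    have : innerLabel i m s = ∅ := by rw [innerLabel, if_neg (by omega)]
    by_cases h : e ∈ P
    · have h' : e ∉ Q := Finset.disjoint_left.1 hPQ h
      simp [h, h', this]
    · by_cases h' : e ∈ Q <;> simp [h, h']

lemma innerTree_outerTree_right (hPQ : Disjoint P Q) (hij : i < j) (hs : s + 1 = j + m)
    (S : Tr ℕ) : innerTree j p P (outerTree i m Q S) = innerTree s p P S := by
  rw [innerTree, outerTree, innerTree, Tr.op_op]
  · intro a
    rw [Finset.singleton_biUnion]
    unfold innerLabel outerLabel
    split_ifs <;> first | rfl | omega | skip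
    all_goals first | rfl | (congr 1; omega)
  · intro e
    have : innerLabel j p i = ∅ := by rw [innerLabel, if_neg (by omega)]
    by_cases h : e ∈ P
    · have h' : e ∉ Q := Finset.disjoint_left.1 hPQ h
      simp [h, h']
    · by_cases h' : e ∈ Q <;> simp [h, h', this]

end

lemma card_of_ev_innerTree_ne_zero {e : ℤ} {y : M k m} (hy : y ∈ (minimalOperad k).gr m e) {i : ℕ}
    {P : Finset ℕ} {S : Tr ℕ} (hS : S.edges.Nodup) (hP : P ⊆ S.edges.toFinset)
    (h : ev (innerTree i m P S) y ≠ 0) : (P.card : ℤ) = 2 * m - 2 - e := by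
  rw [← mem_gr_iff.1 hy _ (nodup_edges_innerTree hS) h,
    ← List.toFinset_card_of_nodup (nodup_edges_innerTree hS), toFinset_edges_innerTree hP]

theorem minimalOperad_assoc_par {p r q : ℕ} (h₁ : n + m = l + 1) (h₂ : l + p = q + 1)
    (h₃ : n + p = r + 1) (h₄ : r + m = q + 1) (i j : Fin n) (s : Fin l) (t : Fin r) (hij : i < j)
    (hs : (s : ℕ) + 1 = j + m) (ht : (t : ℕ) = i) (e f : ℤ) (x : M k n) (y : M k m)
    (hy : y ∈ (minimalOperad k).gr m e) (z : M k p) (hz : z ∈ (minimalOperad k).gr p f) :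
    (minimalOperad k).comp h₂ s ((minimalOperad k).comp h₁ i x y) z =
      ((e * f).negOnePow : ℤ) •
        (minimalOperad k).comp h₄ t ((minimalOperad k).comp h₃ j x z) y := by
  refine ev_ext fun S hS => ?_
  rw [map_zsmul, ev_comp _ _ _ _ hS, ev_comp _ _ _ _ hS]
  set E := S.edges.toFinset with hE
  have key : ∀ {n m l p : ℕ} (h₁ : n + m = l + 1) (i : Fin n) (s : ℕ) (x : M k n) (y : M k m)
      (z : M k p) (P : Finset ℕ), (shuffleSign (E \ P) P : k) *
      (ev (outerTree s p P S) ((minimalOperad k).comp h₁ i x y) * ev (innerTree s p P S) z) =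
      ∑ Q ∈ (E \ P).powerset, (shuffleSign (E \ P) P * shuffleSign ((E \ P) \ Q) Q : k) *
        (ev (outerTree i m Q (outerTree s p P S)) x *
          ev (innerTree i m Q (outerTree s p P S)) y * ev (innerTree s p P S) z) := by
    intro n m l p h₁ i s x y z P
    rw [ev_comp _ _ _ _ (nodup_edges_outerTree hS), toFinset_edges_outerTree, Finset.sum_mul,
      Finset.mul_sum]
    exact Finset.sum_congr rfl fun Q _ => by ring
  rw [Finset.sum_congr rfl fun P _ => key h₁ i s x y z P,
    Finset.sum_congr rfl fun P _ => key h₃ j t x z y P, sum_powerset_sdiff_comm, Finset.smul_sum]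
  refine Finset.sum_congr rfl fun Q hQ => ?_
  rw [Finset.smul_sum]
  refine Finset.sum_congr rfl fun P hP => ?_
  rw [Finset.mem_powerset, Finset.subset_sdiff] at hP
  rw [Finset.mem_powerset] at hQ
  obtain ⟨hPE, hPQ⟩ := hP
  have hij' : (i : ℕ) < j := hij
  rw [ht, outerTree_outerTree_par hPQ hij' hs, innerTree_outerTree_left hPQ hij' hs,
    innerTree_outerTree_right hPQ hij' hs]
  by_cases hy0 : ev (innerTree i m Q S) y = 0
  · simp [hy0]
  by_cases hz0 : ev (innerTree s p P S) z = 0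
  · simp [hz0]
  have c1 := card_of_ev_innerTree_ne_zero hy hS hQ hy0
  have c2 := card_of_ev_innerTree_ne_zero hz hS hPE hz0
  -- By the degree formula `Q.card` and `P.card` have the parities of `e` and `f`.
  have hsgn : ((e * f).negOnePow : ℤ) = (-1) ^ (P.card * Q.card) := by
    rw [← Int.coe_negOnePow_natCast]
    congr 1
    rw [Int.negOnePow_eq_iff]
    push_cast
    rw [c1, c2]
    -- Half of the difference of `e * f` and `P.card * Q.card`.
    exact ⟨2 * (e * p + f * m) - 2 * p * m * 2 + 2 * p + 2 * m - e - f - 2 - e * p - f * m +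
      2 * m * p, by ring⟩
  have e1 : (E \ Q) \ P = (E \ P) \ Q := by rw [sdiff_right_comm]
  set R := (E \ P) \ Q with hR
  have e2 : E \ P = R ∪ Q := by
    rw [hR, Finset.sdiff_union_of_subset (Finset.subset_sdiff.2 ⟨hQ, hPQ.symm⟩)]
  have e3 : E \ Q = R ∪ P := by
    rw [← e1, Finset.sdiff_union_of_subset (Finset.subset_sdiff.2 ⟨hPE, hPQ⟩)]
  have d1 : Disjoint R Q := Finset.sdiff_disjoint
  have d2 : Disjoint R P := by rw [← e1]; exact Finset.sdiff_disjoint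
  rw [e1, e2, e3, shuffleSign_union_left _ d1, shuffleSign_union_left _ d2, hsgn,
    shuffleSign_swap hPQ, zsmul_eq_mul]
  push_cast
  ring

/-! ### Equivariance -/

section

variable {i : Fin n} {σ : Equiv.Perm (Fin n)} {τ : Equiv.Perm (Fin m)} {ρ : Equiv.Perm (Fin l)}

/-- Labels in the block come from the second tree and are governed by `τ`, the others come from the
first tree and are governed by `σ`. Labels from `l` on are included because contractions are
compared through label maps on all of `ℕ`; there all permutations act trivially. -/
lemma labels_of_equivariant (h : n + m = l + 1)
    (hσ : ∀ (s : Fin l) (j : Fin n), j ≠ i → (s : ℕ) = outerIndex i m j →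
      (ρ s : ℕ) = outerIndex (σ i) m (σ j))
    (hτ : ∀ (s : Fin l) (j : Fin m), (s : ℕ) = i + j → (ρ s : ℕ) = σ i + τ j) (a : ℕ) :
    permFun σ⁻¹ (outerLabel (σ i) m a) = outerLabel i m (permFun ρ⁻¹ a) ∧
      (innerLabel (σ i) m a).biUnion (fun b => {permFun τ⁻¹ b}) =
        innerLabel i m (permFun ρ⁻¹ a) := by
  have hi := i.2
  have hσi := (σ i).2
  by_cases ha : a < l
  · obtain ⟨b, hb⟩ : ∃ b : Fin l, (ρ b : ℕ) = a := ⟨ρ⁻¹ ⟨a, ha⟩, by simp⟩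
    have hρ : permFun ρ⁻¹ a = b := by
      rw [← hb, permFun_fin]; simp
    rw [hρ]
    by_cases hbl : (i : ℕ) ≤ b ∧ (b : ℕ) < i + m
    · obtain ⟨j, hj⟩ : ∃ j : Fin m, (b : ℕ) = i + j :=
        ⟨⟨b - i, by omega⟩, by simp only; omega⟩
      rw [hτ b j hj] at hb
      have hτj := (τ j).2
      have o1 : outerLabel (σ i) m a = σ i := by unfold outerLabel; split_ifs <;> omega
      have o2 : outerLabel i m b = i := by unfold outerLabel; split_ifs <;> omega
      have i1 : innerLabel (σ i) m a = {(τ j : ℕ)} := by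
        rw [innerLabel, if_pos (by omega)]; congr 1; omega
      have i2 : innerLabel i m b = {(j : ℕ)} := by
        rw [innerLabel, if_pos (by omega)]; congr 1; omega
      rw [o1, o2, i1, i2, permFun_fin, Finset.singleton_biUnion, permFun_fin]
      simp
    · obtain ⟨j, hji, hj⟩ : ∃ j : Fin n, j ≠ i ∧ (b : ℕ) = outerIndex i m j := by
        have hb2 := b.2
        refine ⟨⟨outerLabel i m b, ?_⟩, ?_, ?_⟩
        · unfold outerLabel; split_ifs <;> omega
        · intro h
          have h := congrArg Fin.val h
          simp only [outerLabel] at h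
          split_ifs at h <;> omega
        · simp only [outerLabel, outerIndex]
          split_ifs <;> omega
      rw [hσ b j hji hj] at hb
      have hne : (σ j : ℕ) ≠ σ i := fun h => hji (σ.injective (Fin.ext h))
      have hne' : (j : ℕ) ≠ i := fun h => hji (Fin.ext h)
      have o1 : outerLabel (σ i) m a = σ j := by
        unfold outerLabel; unfold outerIndex at hb; split_ifs at hb ⊢ <;> omega
      have o2 : outerLabel i m b = j := by
        unfold outerLabel; unfold outerIndex at hj; split_ifs at hj ⊢ <;> omega
      have i1 : innerLabel (σ i) m a = ∅ := by
        rw [innerLabel, if_neg]; unfold outerIndex at hb; split_ifs at hb <;> omega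
      have i2 : innerLabel i m b = ∅ := by rw [innerLabel, if_neg hbl]
      rw [o1, o2, i1, i2, permFun_fin]
      simp
  · have hρ : permFun ρ⁻¹ a = a := permFun_of_le _ (by omega)
    have o1 : outerLabel (σ i) m a = a + 1 - m := by unfold outerLabel; split_ifs <;> omega
    have o2 : outerLabel i m a = a + 1 - m := by unfold outerLabel; split_ifs <;> omega
    have i1 : innerLabel (σ i) m a = ∅ := by rw [innerLabel, if_neg (by omega)]
    have i2 : innerLabel i m a = ∅ := by rw [innerLabel, if_neg (by omega)]
    rw [hρ, o1, o2, i1, i2, permFun_of_le _ (by omega)]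
    simp

theorem minimalOperad_equivariant (h : n + m = l + 1)
    (hσ : ∀ (s : Fin l) (j : Fin n), j ≠ i → (s : ℕ) = outerIndex i m j →
      (ρ s : ℕ) = outerIndex (σ i) m (σ j))
    (hτ : ∀ (s : Fin l) (j : Fin m), (s : ℕ) = i + j → (ρ s : ℕ) = σ i + τ j)
    (x : M k n) (y : M k m) :
    (minimalOperad k).comp h (σ i) ((minimalOperad k).act n σ x) ((minimalOperad k).act m τ y) =
      (minimalOperad k).act l ρ ((minimalOperad k).comp h i x y) := by
  refine ev_ext fun S hS => ?_
  rw [ev_act, ev_comp _ _ _ _ hS, ev_comp _ _ _ _ (by rwa [edges_relabelTree]), edges_relabelTree]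
  refine Finset.sum_congr rfl fun P _ => ?_
  have hlab := labels_of_equivariant h hσ hτ
  rw [ev_act, ev_act]
  congr 3
  · rw [relabelTree, outerTree, relabelTree, outerTree, Tr.op_op
      (g'' := fun a => {permFun σ⁻¹ (outerLabel (σ i) m a)})
      (h'' := fun e => if e ∈ P then some {(i : ℕ)} else none), Tr.op_op]
    · intro a; rw [(hlab a).1, Finset.singleton_biUnion]
    · intro e; rfl
    · intro a; simp
    · intro e
      have : permFun σ⁻¹ (σ i) = i := by rw [permFun_fin]; simp
      by_cases he : e ∈ P <;> simp [he, this]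
  · rw [relabelTree, innerTree, relabelTree, innerTree, Tr.op_op
      (g'' := fun a => (innerLabel (σ i) m a).biUnion fun b => {permFun τ⁻¹ b})
      (h'' := fun e => if e ∈ P then none else some ∅), Tr.op_op]
    · intro a; rw [(hlab a).2, Finset.singleton_biUnion]
    · intro e; rfl
    · intro a; rfl
    · intro e
      by_cases he : e ∈ P <;> simp [he]

end

theorem isDGOperad_minimalOperad (k : Type*) [Field k] : IsDGOperad (minimalOperad k) where
  internal _ := minimalOperad_internal
  d_mem _ := minimalOperad_d_mem
  d_d _ := minimalOperad_d_d
  act_one n x := ev_ext fun S _ => by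
    rw [ev_act, relabelTree, Tr.op_congr (g' := fun a => {a}) (h' := fun _ => none)
      (fun a _ => by rw [inv_one, permFun_one]) fun _ _ => rfl, Tr.op_id fun _ _ => rfl]
  act_mul n σ τ x := ev_ext fun S _ => by
    rw [ev_act, ev_act, ev_act]
    congr 2
    rw [relabelTree, relabelTree, relabelTree, Tr.op_op]
    · intro a
      rw [mul_inv_rev, permFun_mul, Finset.singleton_biUnion]
    · intro e; rfl
  act_mem _ := minimalOperad_act_mem
  act_d _ := minimalOperad_act_d
  one_mem := minimalOperad_one_mem
  d_one := minimalOperad_d_one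
  comp_mem h i e f x hx y hy := minimalOperad_comp_mem h i e f x hx y hy
  comp_one := minimalOperad_comp_one
  one_comp := minimalOperad_one_comp
  d_comp := minimalOperad_d_comp
  assoc_seq := minimalOperad_assoc_seq
  assoc_par h₁ h₂ h₃ h₄ i j s t hij hs ht e f x y hy z hz :=
    minimalOperad_assoc_par h₁ h₂ h₃ h₄ i j s t hij hs ht e f x y hy z hz
  equivariant h _ _ _ _ hσ hτ := minimalOperad_equivariant h hσ hτ

end

/-! ## Transport of operad structures -/

section

variable {k : Type*} [Field k]
variable {P : ℕ → Type*} [∀ n, AddCommGroup (P n)] [∀ n, Module k (P n)]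
variable {Q : ℕ → Type*} [∀ n, AddCommGroup (Q n)] [∀ n, Module k (Q n)]

/-- Independence pulls back along an injective map. That the preimages span is exactly the
assumption that the range is a graded subspace. -/
lemma isInternal_comap {ι V W : Type*} [DecidableEq ι] [AddCommGroup V] [AddCommGroup W]
    [Module k V] [Module k W] {A : ι → Submodule k W} (hA : DirectSum.IsInternal A)
    {f : V →ₗ[k] W} (hf : Function.Injective f)
    (hr : LinearMap.range f = ⨆ i, LinearMap.range f ⊓ A i) :
    DirectSum.IsInternal fun i => (A i).comap f := by
  rw [DirectSum.isInternal_submodule_iff_iSupIndep_and_iSup_eq_top]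
  constructor
  · rw [iSupIndep_def]
    intro i
    rw [Submodule.disjoint_def]
    intro x hx hx'
    apply hf
    rw [map_zero]
    refine Submodule.disjoint_def.1 (iSupIndep_def.1 hA.submodule_iSupIndep i) _ hx ?_
    have := Submodule.mem_map_of_mem (f := f) hx'
    simp only [Submodule.map_iSup] at this
    exact (iSup₂_mono fun j _ => Submodule.map_comap_le f (A j)) this
  · rw [eq_top_iff]
    intro x _
    have hx : f x ∈ Submodule.map f (⨆ i, (A i).comap f) := by
      simp only [Submodule.map_iSup, Submodule.map_comap_eq]
      rw [← hr]
      exact ⟨x, rfl⟩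
    obtain ⟨y, hy, hxy⟩ := hx
    rwa [← hf hxy]

/-- The operations preserve the ranges and are pulled back along the injections; each axiom can be
checked after applying `φ`. -/
lemma existsUnique_isDGOperad {E : OperadData k Q} (hE : IsDGOperad E)
    {φ : ∀ n, P n →ₗ[k] Q n} (hφ : ∀ n, Function.Injective (φ n))
    (hN : IsDGSuboperad E fun n => LinearMap.range (φ n)) :
    ∃! D : OperadData k P, IsDGOperad D ∧ IsDGMorphism D E φ := by
  let χ : ∀ n, LinearMap.range (φ n) →ₗ[k] P n := fun n =>
    (LinearEquiv.ofInjective (φ n) (hφ n)).symm.toLinearMap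
  have hχ : ∀ n (y : LinearMap.range (φ n)), φ n (χ n y) = y := fun n y =>
    congrArg Subtype.val ((LinearEquiv.ofInjective (φ n) (hφ n)).apply_symm_apply y)
  have hr : ∀ n a, φ n a ∈ LinearMap.range (φ n) := fun n a => ⟨a, rfl⟩
  let d : ∀ n, P n →ₗ[k] P n := fun n =>
    χ n ∘ₗ (E.d n ∘ₗ φ n).codRestrict _ fun a => hN.d_mem n _ (hr n a)
  have hd : ∀ n a, φ n (d n a) = E.d n (φ n a) := fun n a => hχ n _
  let act : ∀ n, Equiv.Perm (Fin n) → P n →ₗ[k] P n := fun n σ =>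
    χ n ∘ₗ (E.act n σ ∘ₗ φ n).codRestrict _ fun a => hN.act_mem n σ _ (hr n a)
  have hact : ∀ n σ a, φ n (act n σ a) = E.act n σ (φ n a) := fun n σ a => hχ n _
  have hone : φ 1 (χ 1 ⟨E.one, hN.one_mem⟩) = E.one := hχ 1 _
  let comp : ∀ {n m l : ℕ} (_ : n + m = l + 1) (_ : Fin n), P n →ₗ[k] P m →ₗ[k] P l :=
    fun {n m l} h i => LinearMap.mk₂ k
      (fun a b => χ l ⟨E.comp h i (φ n a) (φ m b), hN.comp_mem h i _ (hr n a) _ (hr m b)⟩)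
      (fun a a' b => hφ l (by simp [hχ])) (fun c a b => hφ l (by simp [hχ]))
      (fun a b b' => hφ l (by simp [hχ])) (fun c a b => hφ l (by simp [hχ]))
  have hcomp : ∀ {n m l : ℕ} (h : n + m = l + 1) (i : Fin n) (a : P n) (b : P m),
      φ l (comp h i a b) = E.comp h i (φ n a) (φ m b) := fun h i a b => hχ _ _
  have hD : IsDGOperad (P := P)
      ⟨fun n e => (E.gr n e).comap (φ n), d, act, χ 1 ⟨E.one, hN.one_mem⟩, comp⟩ :=
    { internal := fun n => isInternal_comap (hE.internal n) (hφ n) (hN.graded n)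
      d_mem := fun n e a ha => by
        simp only [Submodule.mem_comap, hd] at ha ⊢
        exact hE.d_mem n e _ ha
      d_d := fun n a => hφ n (by simp only [hd, hE.d_d, map_zero])
      act_one := fun n a => hφ n (by simp only [hact, hE.act_one])
      act_mul := fun n σ τ a => hφ n (by simp only [hact, hE.act_mul])
      act_mem := fun n σ e a ha => by
        simp only [Submodule.mem_comap, hact] at ha ⊢
        exact hE.act_mem n σ e _ ha
      act_d := fun n σ a => hφ n (by simp only [hact, hd, hE.act_d])
      one_mem := by
        simp only [Submodule.mem_comap, hone]
        exact hE.one_mem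
      d_one := hφ 1 (by simp only [hd, hone, hE.d_one, map_zero])
      comp_mem := fun h i e f a ha b hb => by
        simp only [Submodule.mem_comap, hcomp] at ha hb ⊢
        exact hE.comp_mem h i e f _ ha _ hb
      comp_one := fun i a => hφ _ (by simp only [hcomp, hone, hE.comp_one])
      one_comp := fun b => hφ _ (by simp only [hcomp, hone, hE.one_comp])
      d_comp := fun h i e a ha b => hφ _ (by
        simp only [Submodule.mem_comap] at ha
        simp only [hcomp, hd, map_add, map_zsmul, hE.d_comp h i e _ ha])
      assoc_seq := fun h₁ h₂ h₃ h₄ i j s hs a b c => hφ _ (by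
        simp only [hcomp, hE.assoc_seq h₁ h₂ h₃ h₄ i j s hs])
      assoc_par := fun h₁ h₂ h₃ h₄ i j s t hij hs ht e f a b hb c hc => hφ _ (by
        simp only [Submodule.mem_comap] at hb hc
        simp only [hcomp, map_zsmul,
          hE.assoc_par h₁ h₂ h₃ h₄ i j s t hij hs ht e f (φ _ a) _ hb _ hc])
      equivariant := fun h i σ τ ρ h₁ h₂ a b => hφ _ (by
        simp only [hcomp, hact, hE.equivariant h i σ τ ρ h₁ h₂]) }
  refine ⟨_, ⟨hD, ⟨fun n e a ha => ha, hd, hact, hone, hcomp⟩⟩, ?_⟩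
  rintro ⟨gr', d', act', one', comp'⟩ ⟨hD', hm⟩
  -- A morphism only gives an inclusion of the homogeneous parts. However, a decomposition that
  -- spans and is contained part by part in an independent family coincides with it.
  have h1 : gr' = fun n e => (E.gr n e).comap (φ n) := funext fun n =>
    ((hD.internal n).submodule_iSupIndep.le_iff_eq_of_iSup_eq_top
      (hD'.internal n).submodule_iSup_eq_top).1 fun e a ha => hm.map_gr n e a ha
  have h2 : d' = d := funext fun n => LinearMap.ext fun a =>
    hφ n ((hm.map_d n a).trans (hd n a).symm)
  have h3 : act' = act := funext fun n => funext fun σ => LinearMap.ext fun a =>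
    hφ n ((hm.map_act n σ a).trans (hact n σ a).symm)
  have h4 : one' = χ 1 ⟨E.one, hN.one_mem⟩ := hφ 1 (hm.map_one.trans hone.symm)
  have h5 : @comp' = @comp := by
    funext n m l h i
    exact LinearMap.ext₂ fun a b => hφ l ((hm.map_comp h i a b).trans (hcomp h i a b).symm)
  subst h1 h2 h3 h4 h5
  rfl

end

/-! ## Cyclic invariance -/

section

variable {k : Type*} [Field k] {n m l : ℕ}

/-- The elements whose coefficients at oriented trees do not depend on the root. -/
def rotInvariants (k : Type*) [Field k] (n : ℕ) : Submodule k (M k n) where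
  carrier := {x | ∀ S : Tr ℕ, S.edges.Nodup → ev S.rot x = ev S x}
  add_mem' hx hy S hS := by rw [map_add, map_add, hx S hS, hy S hS]
  zero_mem' S _ := by simp
  smul_mem' c x hx S hS := by rw [map_smul, map_smul, hx S hS]

lemma nodup_edges_rot {S : Tr ℕ} : S.rot.edges.Nodup ↔ S.edges.Nodup :=
  S.edges_rot.nodup_iff

lemma toFinset_edges_rot (S : Tr ℕ) : S.rot.edges.toFinset = S.edges.toFinset :=
  List.toFinset_eq_of_perm _ _ S.edges_rot

/-- Moving the root before a contraction moves it by one step or not at all afterwards, and an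
invariant notices neither. -/
lemma ev_op_rot {x : M k n} (hx : x ∈ rotInvariants k n) {S : Tr ℕ} (hS : S.edges.Nodup)
    (g : ℕ → Finset ℕ) (h : ℕ → Option (Finset ℕ)) :
    ev (S.rot.op g h) x = ev (S.op g h) x := by
  rcases Tr.op_rot (g := g) (h := h) S with h' | h' <;> rw [h']
  exact hx _ (by rw [Tr.edges_op]; exact hS.filter _)

/-- The index set of the formula for the coefficients and its shuffle signs depend on the set of
edges only, not on the root. -/
lemma rotInvariants_comp_mem (h : n + m = l + 1) (i : Fin n) {x : M k n}
    (hx : x ∈ rotInvariants k n) {y : M k m} (hy : y ∈ rotInvariants k m) :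
    (minimalOperad k).comp h i x y ∈ rotInvariants k l := by
  intro S hS
  rw [ev_comp h i x y hS, ev_comp h i x y (nodup_edges_rot.2 hS), toFinset_edges_rot]
  refine Finset.sum_congr rfl fun P _ => ?_
  rw [outerTree, innerTree, ev_op_rot hx hS, ev_op_rot hy hS]
  rfl

lemma rotInvariants_act_mem (σ : Equiv.Perm (Fin n)) {x : M k n} (hx : x ∈ rotInvariants k n) :
    (minimalOperad k).act n σ x ∈ rotInvariants k n := by
  intro S hS
  rw [ev_act, ev_act, relabelTree, ev_op_rot hx hS]
  rfl

lemma rotInvariants_one_mem : (minimalOperad k).one ∈ rotInvariants k 1 := by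
  classical
  intro S _
  rw [ev_one, ev_one]
  refine if_congr ?_ rfl rfl
  exact ⟨fun h => Tr.rot_injective (h.trans (Tr.rot_nil _).symm), fun h => by rw [h, Tr.rot_nil]⟩

lemma separated_rot {S : Tr ℕ} : S.rot.Separated ↔ S.Separated :=
  forall_congr' fun b => by rw [Tr.cnt_rot]

/-- A rooted tree with a black root vertex and just two branches becomes unstable when the root
moves on. The formula without a stability assumption treats both positions of the root alike, as its
condition on edges does not involve the root. -/
lemma rotInvariants_d_mem {x : M k n} (hx : x ∈ rotInvariants k n) :
    (minimalOperad k).d n x ∈ rotInvariants k n := by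
  intro S hS
  by_cases hs : S.Separated
  · rw [ev_d_of_separated x hS hs, ev_d_of_separated x (nodup_edges_rot.2 hS) (separated_rot.2 hs),
      toFinset_edges_rot]
    refine Finset.sum_congr rfl fun e _ => ?_
    rw [contractEdge, ev_op_rot hx hS, twoSided_rot hS]
    rfl
  · rw [ev_eq_zero _ fun h => hs h.separated,
      ev_eq_zero _ fun h => hs (separated_rot.1 h.separated)]

/-! ## Trees without a root -/

/-- The tree without its root is stable; see `PTree.IsUnrooted`. -/
def Tr.IsUnrooted {ε : Type} (n : ℕ) (S : Tr ε) : Prop :=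
  S.IsRooted n ∧ (S.1 = ∅ → 3 ≤ S.2.length)

lemma PTree.isUnrooted_toTr {ε : Type} {n : ℕ} {T : PTree ε} :
    T.toTr.IsUnrooted n ↔ T.IsUnrooted n := by
  rw [Tr.IsUnrooted, PTree.isRooted_toTr, PTree.IsRooted, PTree.IsUnrooted]
  have : T.toTr.1 = ∅ ↔ T.root = none := by cases h : T.root <;> simp [PTree.toTr, h]
  rw [this, show T.toTr.2.length = T.branches.length from Branches.length_toBr _]
  constructor
  · exact fun h => ⟨h.1.1, h.2, h.1.2.2⟩
  · exact fun h => ⟨⟨h.1, fun h' => (h.2.1 h').trans' (by norm_num), h.2.2⟩, h.2.1⟩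

lemma Tr.isUnrooted_mapE {ε δ : Type} {S : Tr ε} (f : ε → δ) :
    (S.mapE f).IsUnrooted n ↔ S.IsUnrooted n := by
  rw [Tr.IsUnrooted, Tr.IsUnrooted, Tr.isRooted_mapE]
  simp [Tr.mapE]

/-- After one step the former root vertex has lost its first branch from above. If it is black,
stability there leaves at least two branches, so it had at least three. -/
lemma Tr.IsRooted.isUnrooted {ε : Type} {S : Tr ε} (h : S.IsRooted n) (h' : S.rot.IsRooted n)
    (hn : S.1 = ∅ → S.2 ≠ .nil) : S.IsUnrooted n := by
  refine ⟨h, fun h0 => ?_⟩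
  obtain ⟨v, _ | ⟨e, w, A, R⟩⟩ := S
  · exact absurd rfl (hn h0)
  · have h1 := h'.2.2.2
    rw [Tr.rot_cons, Br.stable_app] at h1
    have := h1.2.1 h0
    simp only [Br.length]
    omega

lemma Tr.IsUnrooted.isRooted_rot {ε : Type} {S : Tr ε} (h : S.IsUnrooted n) : S.rot.IsRooted n := by
  obtain ⟨v, _ | ⟨e, w, A, R⟩⟩ := S
  · exact h.1
  · obtain ⟨⟨⟨h1, h1', h1'', h1'''⟩, h2, ⟨h3, h4, h5, h6⟩⟩, h7⟩ := h
    refine ⟨⟨h1', ?_⟩, fun b => by rw [Tr.cnt_rot]; exact h2 b, ?_⟩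
    · exact Br.simple_app.2 ⟨h1'', h1, h1''', trivial⟩
    · refine ⟨fun h => ?_, ?_⟩
      · have := h4 h; simp [Br.length]; omega
      · refine Br.stable_app.2 ⟨h5, fun h => ?_, h6, trivial⟩
        have := h7 h; simp only [Br.length] at this; omega

lemma Tr.IsUnrooted.rot {ε : Type} {S : Tr ε} (h : S.IsUnrooted n) : S.rot.IsUnrooted n := by
  refine ⟨h.isRooted_rot, ?_⟩
  obtain ⟨v, _ | ⟨e, w, A, R⟩⟩ := S
  · exact h.2
  · intro h0
    have := h.1.2.2.2.1 h0
    simp [Br.length]; omega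

/-- The coefficient at `S.rot` is the same, hence `S.rot` is a basis tree as well. -/
lemma isUnrooted_of_ev_ne_zero {x : M k n} (hx : x ∈ rotInvariants k n) {S : Tr ℕ}
    (hS : S.edges.Nodup) (h : ev S x ≠ 0) : S.IsUnrooted n := by
  have h1 := isRooted_of_ev_ne_zero h
  refine h1.isUnrooted (isRooted_of_ev_ne_zero (x := x) (by rwa [hx S hS])) fun h2 h3 => ?_
  have := h1.2.2.1 h2
  simp [h3, Br.length] at this

end

/-! ## The sum over all angles -/

section

variable {k : Type*} [Field k] {n : ℕ}

lemma toTr_iterate_rot {ε : Type} (T : PTree ε) (j : ℕ) :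
    (PTree.rot^[j] T).toTr = Tr.rot^[j] T.toTr :=
  Function.Semiconj.iterate_right (fun T => T.toTr_rot) j T

lemma perm_edges_iterate_rot {ε : Type} (S : Tr ε) (j : ℕ) : (Tr.rot^[j] S).edges.Perm S.edges := by
  induction j with
  | zero => rfl
  | succ j ih => rw [Function.iterate_succ_apply']; exact (Tr.edges_rot _).trans ih

lemma Tr.IsUnrooted.iterate_rot {ε : Type} {S : Tr ε} (h : S.IsUnrooted n) (j : ℕ) :
    (Tr.rot^[j] S).IsUnrooted n := by
  induction j with
  | zero => exact h
  | succ j ih => rw [Function.iterate_succ_apply']; exact ih.rot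

lemma numAngles_eq {ε : Type} (T : PTree ε) : T.numAngles = max 1 (2 * T.toTr.edges.length) := by
  rw [PTree.numAngles, PTree.size_eq_length_edges, PTree.edges_toTr]

lemma Tr.iterate_rot_max {ε : Type} (S : Tr ε) : Tr.rot^[max 1 (2 * S.edges.length)] S = S := by
  by_cases h : S.edges = []
  · obtain ⟨v, F⟩ := S
    obtain rfl := Br.eq_nil_of_edges h
    simp [h]
  · have := List.length_pos_iff.2 h
    rw [max_eq_right (by omega), iterate_rot_self]

lemma iterate_rot_numAngles {ε : Type} (T : PTree ε) : PTree.rot^[T.numAngles] T = T := by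
  apply PTree.toTr_injective
  rw [toTr_iterate_rot, numAngles_eq, Tr.iterate_rot_max]

/-- A change of the root changes the signs of two orientations by the same factor. -/
lemma listSign_iterate_rot_mul {S R : Tr ℕ} (hS : S.edges.Nodup) (hR : R.edges.Nodup)
    (h : S.forget = R.forget) (j : ℕ) :
    listSign (Tr.rot^[j] S).edges * listSign (Tr.rot^[j] R).edges =
      listSign S.edges * listSign R.edges := by
  obtain ⟨f, rfl⟩ := Tr.exists_mapE_eq hS h
  have : Tr.rot^[j] (S.mapE f) = (Tr.rot^[j] S).mapE f :=
    (Function.Semiconj.iterate_right (f := fun S : Tr ℕ => S.mapE f) (ga := Tr.rot)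
      (fun S => Tr.mapE_rot f S) j S).symm
  rw [this, Tr.edges_mapE, Tr.edges_mapE, mul_comm, mul_comm (listSign S.edges)]
  have hp := perm_edges_iterate_rot S j
  rw [Tr.edges_mapE] at hR
  exact listSign_map_mul hp (hp.nodup_iff.2 hS) f ((hp.map f).nodup_iff.2 hR)

lemma forget_iterate_rot (S : Tr ℕ) (j : ℕ) : (Tr.rot^[j] S).forget = Tr.rot^[j] S.forget :=
  Function.Semiconj.iterate_right (f := fun S : Tr ℕ => S.forget) (ga := Tr.rot)
    (fun S => Tr.forget_rot S) j S

/-- When both trees are rotated together, neither their equality up to names nor the sign between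
their orientations changes. -/
lemma ev_iterate_rot_ofOriented {T : PTree ℕ} (hT : T.toTr.IsUnrooted n)
    (hn : T.toTr.edges.Nodup) {S : Tr ℕ} (hS : S.edges.Nodup) (j : ℕ) :
    ev (Tr.rot^[j] S) (ofOriented k n (PTree.rot^[j] T)) = ev S (ofOriented k n T) := by
  classical
  have hiff : (PTree.rot^[j] T).toTr.forget = (Tr.rot^[j] S).forget ↔
      T.toTr.forget = S.forget := by
    rw [toTr_iterate_rot, forget_iterate_rot, forget_iterate_rot]
    exact (Tr.rot_injective.iterate j).eq_iff
  by_cases h : T.toTr.forget = S.forget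
  · have hS' : S.IsUnrooted n := by
      have hT' : T.toTr.forget.IsUnrooted n := (Tr.isUnrooted_mapE _).2 hT
      rw [h] at hT'
      exact (Tr.isUnrooted_mapE _).1 hT'
    rw [ev_ofOriented, ev_ofOriented, if_pos ⟨(hS'.iterate_rot j).1, hiff.2 h⟩,
      if_pos ⟨hS'.1, h⟩, ← PTree.edges_toTr, toTr_iterate_rot, ← PTree.edges_toTr]
    exact_mod_cast congrArg (Int.cast : ℤ → k) (listSign_iterate_rot_mul hn hS h j)
  · rw [ev_ofOriented, ev_ofOriented, if_neg fun h' => h (hiff.1 h'.2), if_neg fun h' => h h'.2]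

/-- A function with period `N` has the same sum over each period. -/
lemma sum_range_succ_of_periodic {A : Type*} [AddCommGroup A] {f : ℕ → A} {N : ℕ} (h : f N = f 0) :
    ∑ j ∈ Finset.range N, f (j + 1) = ∑ j ∈ Finset.range N, f j := by
  have := Finset.sum_range_succ' f N
  rw [Finset.sum_range_succ, h] at this
  exact (add_right_cancel this).symm

namespace OrderedTree

lemma isUnrooted_toTr (T : OrderedTree n) : T.1.toTr.IsUnrooted n := PTree.isUnrooted_toTr.2 T.2.1

lemma nodup_edges (T : OrderedTree n) : T.1.toTr.edges.Nodup := by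
  rw [PTree.edges_toTr]
  exact T.2.2.nodup_iff.2 List.nodup_range

/-- Another choice of the auxiliary angle. -/
lemma exists_iterate_rot (T : OrderedTree n) (j : ℕ) :
    ∃ T' : OrderedTree n, T'.1 = PTree.rot^[j] T.1 := by
  have hp := perm_edges_iterate_rot T.1.toTr j
  rw [← toTr_iterate_rot, PTree.edges_toTr, PTree.edges_toTr] at hp
  refine ⟨⟨_, ?_, hp.trans ?_⟩, rfl⟩
  · rw [← PTree.isUnrooted_toTr, toTr_iterate_rot]
    exact T.isUnrooted_toTr.iterate_rot j
  · rw [PTree.size_eq_length_edges, hp.length_eq, ← PTree.size_eq_length_edges]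
    exact T.2.2

end OrderedTree

/-- The summands are shifted cyclically, since the number of angles is a period of the walk. -/
lemma sumOverAngles_of_rot {T T' : OrderedTree n} (h : T'.1 = T.1.rot) :
    sumOverAngles k T' = sumOverAngles k T := by
  have hN : T'.1.numAngles = T.1.numAngles := by
    rw [numAngles_eq, numAngles_eq, h, PTree.toTr_rot, (Tr.edges_rot _).length_eq]
  rw [sumOverAngles, sumOverAngles, hN, h]
  exact sum_range_succ_of_periodic (f := fun j => ofOriented k n (PTree.rot^[j] T.1))
    (by rw [iterate_rot_numAngles]; rfl)

/-- The sign between two orders of the edges is the same seen from every angle, so it factors out of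
the sum. -/
lemma sumOverAngles_of_forget {T T' : OrderedTree n} (h : T'.1.forget = T.1.forget) :
    sumOverAngles k T =
      ((listSign T.1.edges * listSign T'.1.edges : ℤ) : k) • sumOverAngles k T' := by
  have h' : T'.1.toTr.forget = T.1.toTr.forget := by
    rw [← PTree.toTr_forget, h, PTree.toTr_forget]
  have hN : T'.1.numAngles = T.1.numAngles := by
    have := congrArg (fun S => S.edges.length) h'
    simp only [Tr.forget, Tr.edges_mapE, List.length_map] at this
    rw [numAngles_eq, numAngles_eq, this]
  rw [sumOverAngles, sumOverAngles, hN, Finset.smul_sum]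
  refine Finset.sum_congr rfl fun j _ => ?_
  obtain ⟨T₁, hT₁⟩ := T.exists_iterate_rot j
  have hr : T₁.1.forget.IsRooted n := by
    rw [← PTree.isRooted_toTr, PTree.toTr_forget, Tr.isRooted_forget]
    exact T₁.isUnrooted_toTr.1
  have hf : (PTree.rot^[j] T'.1).forget = T₁.1.forget := by
    apply PTree.toTr_injective
    rw [PTree.toTr_forget, PTree.toTr_forget, hT₁, toTr_iterate_rot, toTr_iterate_rot,
      forget_iterate_rot, forget_iterate_rot, h']
  obtain ⟨T₀, hT₀⟩ : ∃ T₀ : RootedTree n, T₁.1.forget = T₀.1 := ⟨⟨_, hr⟩, rfl⟩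
  rw [ofOriented_eq_single (hf.trans hT₀), ofOriented_eq_single (hT₁ ▸ hT₀), Finsupp.smul_single,
    smul_eq_mul]
  congr 1
  have key := listSign_iterate_rot_mul T.nodup_edges T'.nodup_edges h'.symm j
  simp only [← toTr_iterate_rot, PTree.edges_toTr] at key
  rw [← key]
  push_cast
  linear_combination -(listSign (PTree.rot^[j] T.1).edges : k) *
    listSign_cast_mul_self (k := k) (PTree.rot^[j] T'.1).edges

lemma cyclicRelations_le_ker :
    cyclicRelations k n ≤
      LinearMap.ker (Finsupp.linearCombination k fun T : OrderedTree n => sumOverAngles k T) := by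
  rw [cyclicRelations, Submodule.span_le]
  rintro x (⟨T, T', h, rfl⟩ | ⟨T, T', h, rfl⟩)
  · simp [sumOverAngles_of_rot h]
  · simp only [SetLike.mem_coe, LinearMap.mem_ker, map_sub, map_smul,
      Finsupp.linearCombination_single, one_smul]
    rw [sub_eq_zero]
    exact sumOverAngles_of_forget h

/-- The sum over all angles, as a map on the space of oriented unrooted trees. -/
def angleSum (k : Type*) [Field k] (n : ℕ) : MCyc k n →ₗ[k] M k n :=
  (cyclicRelations k n).liftQ _ cyclicRelations_le_ker

lemma angleSum_mk (T : OrderedTree n) : angleSum k n (MCyc.mk k T) = sumOverAngles k T := by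
  simp [angleSum, MCyc.mk]

lemma mCyc_induction {p : MCyc k n → Prop} (h0 : p 0) (hadd : ∀ a b, p a → p b → p (a + b))
    (hsmul : ∀ (c : k) T, p (c • MCyc.mk k T)) (a : MCyc k n) : p a := by
  obtain ⟨a, rfl⟩ := (cyclicRelations k n).mkQ_surjective a
  induction a using Finsupp.induction_linear with
  | zero => rwa [map_zero]
  | add a b ha hb => rw [map_add]; exact hadd _ _ ha hb
  | single T c => rw [← mul_one c, ← smul_eq_mul, ← Finsupp.smul_single, map_smul]; exact hsmul c T

/-- Replacing `T` by its rotation does not change the sum. Then the trees on the left are rotated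
together with `S`, and the sums agree term by term. -/
lemma sumOverAngles_mem_rotInvariants (T : OrderedTree n) :
    sumOverAngles k T ∈ rotInvariants k n := by
  intro S hS
  obtain ⟨T', hT'⟩ := T.exists_iterate_rot 1
  conv_lhs => rw [← sumOverAngles_of_rot hT']
  have hN : T'.1.numAngles = T.1.numAngles := by
    rw [numAngles_eq, numAngles_eq, hT', Function.iterate_one, PTree.toTr_rot,
      (Tr.edges_rot _).length_eq]
  rw [sumOverAngles, sumOverAngles, hN, map_sum, map_sum]
  refine Finset.sum_congr rfl fun j _ => ?_
  obtain ⟨T₁, hT₁⟩ := T.exists_iterate_rot j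
  rw [← ev_iterate_rot_ofOriented (T := PTree.rot^[j] T.1) (hT₁ ▸ T₁.isUnrooted_toTr)
    (hT₁ ▸ T₁.nodup_edges) hS 1, hT', ← Function.iterate_add_apply, ← Function.iterate_add_apply,
    add_comm]
  rfl

lemma angleSum_mem_rotInvariants (a : MCyc k n) : angleSum k n a ∈ rotInvariants k n := by
  induction a using mCyc_induction with
  | h0 => rw [map_zero]; exact zero_mem _
  | hadd a b ha hb => rw [map_add]; exact add_mem ha hb
  | hsmul c T =>
    rw [map_smul, angleSum_mk]
    exact Submodule.smul_mem _ _ (sumOverAngles_mem_rotInvariants T)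

lemma sumOverAngles_mem_gr (T : OrderedTree n) :
    ∃ e, sumOverAngles k T ∈ (minimalOperad k).gr n e := by
  refine ⟨2 * n - 2 - T.1.toTr.edges.length, Submodule.sum_mem _ fun j _ => ?_⟩
  rw [mem_gr_iff]
  intro S _ hS
  classical
  rw [ev_ofOriented] at hS
  have := (ite_ne_right_iff.1 hS).1.2
  have := congrArg (fun S => S.edges.length) this
  simp only [Tr.forget, Tr.edges_mapE, List.length_map, toTr_iterate_rot,
    (perm_edges_iterate_rot _ _).length_eq] at this
  omega

lemma range_angleSum_graded : LinearMap.range (angleSum k n) =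
    ⨆ e, LinearMap.range (angleSum k n) ⊓ (minimalOperad k).gr n e := by
  refine le_antisymm ?_ (iSup_le fun e => inf_le_left)
  rintro _ ⟨a, rfl⟩
  induction a using mCyc_induction with
  | h0 => rw [map_zero]; exact zero_mem _
  | hadd a b ha hb => rw [map_add]; exact add_mem ha hb
  | hsmul c T =>
    rw [map_smul]
    obtain ⟨e, he⟩ := sumOverAngles_mem_gr (k := k) T
    exact Submodule.smul_mem _ _ (Submodule.mem_iSup_of_mem e
      ⟨⟨_, rfl⟩, by rw [SetLike.mem_coe, angleSum_mk]; exact he⟩)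

end

/-! ## The image of the sum over all angles -/

section

variable {k : Type*} [Field k] {n : ℕ}

lemma perm_edges_number {ε : Type} (T : PTree ε) :
    (T.number 0).edges.Perm (List.range (T.number 0).size) := by
  rw [(T.number 0).size_eq_length_edges, PTree.edges_number, List.length_range',
    List.range_eq_range']

lemma isUnrooted_number {T : PTree Unit} (h : T.IsUnrooted n) : (T.number 0).IsUnrooted n := by
  rw [← PTree.isUnrooted_toTr] at h ⊢
  rwa [← Tr.isUnrooted_mapE (fun _ => ()), ← PTree.toTr_mapEdges,
    show (T.number 0).mapEdges _ = T from T.forget_number 0]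

open Classical in
/-- Forget the root of a tree, and divide by the number of angles. -/
def forgetRoot (k : Type*) [Field k] (n : ℕ) : M k n →ₗ[k] MCyc k n :=
  Finsupp.linearCombination k fun T : RootedTree n =>
    if h : T.1.IsUnrooted n then
      (T.1.numAngles : k)⁻¹ • MCyc.mk k ⟨T.1.number 0, isUnrooted_number h, perm_edges_number T.1⟩
    -- This concerns a black root vertex with only two branches, which is not allowed without the
    -- root; invariants have coefficient zero at such trees.
    else 0

lemma MCyc.mk_eq_of_rot {T T' : OrderedTree n} (h : T'.1 = T.1.rot) :
    MCyc.mk k T' = MCyc.mk k T := by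
  refine (sub_eq_zero.1 ?_).symm
  rw [MCyc.mk, MCyc.mk, ← map_sub, Submodule.mkQ_apply, Submodule.Quotient.mk_eq_zero]
  exact Submodule.subset_span (Or.inl ⟨T, T', h, rfl⟩)

lemma MCyc.mk_eq_of_forget {T T' : OrderedTree n} (h : T'.1.forget = T.1.forget) :
    MCyc.mk k T = ((listSign T.1.edges * listSign T'.1.edges : ℤ) : k) • MCyc.mk k T' := by
  refine sub_eq_zero.1 ?_
  rw [MCyc.mk, MCyc.mk, ← map_smul, ← map_sub, Submodule.mkQ_apply, Submodule.Quotient.mk_eq_zero]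
  exact Submodule.subset_span (Or.inr ⟨T, T', h, rfl⟩)

lemma MCyc.mk_eq_of_iterate_rot {T T' : OrderedTree n} {j : ℕ} (h : T'.1 = PTree.rot^[j] T.1) :
    MCyc.mk k T' = MCyc.mk k T := by
  induction j generalizing T' with
  | zero => rw [Subtype.ext h]
  | succ j ih =>
    obtain ⟨T₁, hT₁⟩ := T.exists_iterate_rot j
    rw [Function.iterate_succ_apply', ← hT₁] at h
    rw [mk_eq_of_rot h, ih hT₁]

lemma forgetRoot_ofOriented (T : OrderedTree n) :
    forgetRoot k n (ofOriented k n T.1) = (T.1.numAngles : k)⁻¹ • MCyc.mk k T := by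
  have hu : T.1.forget.IsUnrooted n := by
    rw [← PTree.isUnrooted_toTr, PTree.toTr_forget]
    exact (Tr.isUnrooted_mapE _).2 T.isUnrooted_toTr
  have hr : T.1.forget.IsRooted n := by
    rw [← PTree.isRooted_toTr]
    exact (PTree.isUnrooted_toTr.2 hu).1
  obtain ⟨T₀, hT₀⟩ : ∃ T₀ : RootedTree n, T.1.forget = T₀.1 := ⟨⟨_, hr⟩, rfl⟩
  have hN : T₀.1.numAngles = T.1.numAngles := by
    rw [numAngles_eq, numAngles_eq, ← hT₀, PTree.toTr_forget, Tr.forget, Tr.edges_mapE,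
      List.length_map]
  rw [hT₀] at hu
  rw [ofOriented_eq_single hT₀, forgetRoot, Finsupp.linearCombination_single, dif_pos hu, hN,
    smul_comm, MCyc.mk_eq_of_forget (T := T)
      (T' := ⟨T₀.1.number 0, isUnrooted_number hu, perm_edges_number T₀.1⟩)
      ((T₀.1.forget_number 0).trans hT₀.symm), PTree.listSign_edges_number, mul_one]

/-- The average over all angles. -/
lemma ev_angleSum_forgetRoot (x : M k n) {S : Tr ℕ} (hS : S.edges.Nodup) (hu : S.IsUnrooted n) :
    ev S (angleSum k n (forgetRoot k n x)) =
      ((max 1 (2 * S.edges.length) : ℕ) : k)⁻¹ *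
        ∑ j ∈ Finset.range (max 1 (2 * S.edges.length)), ev (Tr.rot^[j + 1] S) x := by
  classical
  induction x using Finsupp.induction_linear with
  | zero => simp
  | add x y hx hy => simp only [map_add, hx, hy, Finset.sum_add_distrib, mul_add]
  | single T c =>
    have hfor : ∀ j, ev (Tr.rot^[j] S) (Finsupp.single T c) ≠ 0 →
        T.1.toTr = (Tr.rot^[j] S).forget := fun j h => by
      rw [ev_single] at h
      exact (ite_ne_right_iff.1 h).1
    by_cases hT : T.1.IsUnrooted n
    · let T' : OrderedTree n := ⟨T.1.number 0, isUnrooted_number hT, perm_edges_number T.1⟩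
      have hof : ofOriented k n T'.1 = Finsupp.single T 1 := by
        rw [ofOriented_eq_single (T.1.forget_number 0), PTree.listSign_edges_number, Int.cast_one]
      have hsing : Finsupp.single T c = c • ofOriented k n T'.1 := by
        rw [hof, Finsupp.smul_single, smul_eq_mul, mul_one]
      have hN : T.1.numAngles = T'.1.numAngles := by
        rw [numAngles_eq, numAngles_eq, PTree.edges_toTr (T.1.number 0), PTree.edges_number,
          List.length_range', PTree.edges_toTr, PTree.size_eq_length_edges]
      have hl : forgetRoot k n (Finsupp.single T c) = c • (T'.1.numAngles : k)⁻¹ • MCyc.mk k T' := by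
        rw [forgetRoot, Finsupp.linearCombination_single, dif_pos hT, hN]
      rw [hl, map_smul, map_smul, map_smul, map_smul, angleSum_mk, sumOverAngles, map_sum, hsing]
      simp only [map_smul, smul_eq_mul, ← Finset.mul_sum]
      rw [mul_left_comm]
      by_cases hlen : S.edges.length = T'.1.toTr.edges.length
      · rw [hlen, ← numAngles_eq]
        congr 2
        -- Rotating both trees until the second one is back at `T'` runs through the angles in the
        -- opposite direction.
        rw [← Finset.sum_range_reflect]
        refine Finset.sum_congr rfl fun j hj => ?_
        rw [Finset.mem_range] at hj
        obtain ⟨T₁, hT₁⟩ := T'.exists_iterate_rot (T'.1.numAngles - 1 - j)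
        rw [← ev_iterate_rot_ofOriented (T := PTree.rot^[_] T'.1) (hT₁ ▸ T₁.isUnrooted_toTr)
          (hT₁ ▸ T₁.nodup_edges) hS (j + 1), ← Function.iterate_add_apply,
          show j + 1 + (T'.1.numAngles - 1 - j) = T'.1.numAngles by omega, iterate_rot_numAngles]
      -- If the numbers of edges differ, the two ranges of summation need not match, but all terms
      -- vanish.
      · have hz : ∀ i j, ev (Tr.rot^[i] S) (ofOriented k n (PTree.rot^[j] T'.1)) = 0 := by
          intro i j
          rw [ev_ofOriented, if_neg]
          rintro ⟨-, h⟩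
          have := congrArg (fun S => S.edges.length) h
          simp only [Tr.forget, Tr.edges_mapE, List.length_map, toTr_iterate_rot,
            (perm_edges_iterate_rot _ _).length_eq] at this
          exact hlen this.symm
        have h1 := Finset.sum_eq_zero (s := Finset.range T'.1.numAngles) fun j _ => hz 0 j
        have h2 := Finset.sum_eq_zero (s := Finset.range (max 1 (2 * S.edges.length)))
          fun j _ => hz (j + 1) 0
        simp only [Function.iterate_zero, id_eq] at h1 h2
        rw [h1, h2, mul_zero, mul_zero]
        simp
    · rw [forgetRoot, Finsupp.linearCombination_single, dif_neg hT, Finset.sum_eq_zero]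
      · simp
      · intro j _
        by_contra h
        apply hT
        rw [← PTree.isUnrooted_toTr, hfor _ h]
        exact (Tr.isUnrooted_mapE _).2 (hu.iterate_rot _)

variable [CharZero k]

/-- Without their roots all summands of the sum over angles have the same class, and
`T.1.numAngles`, a positive number, is invertible in characteristic zero. -/
lemma forgetRoot_angleSum (a : MCyc k n) : forgetRoot k n (angleSum k n a) = a := by
  induction a using mCyc_induction with
  | h0 => simp
  | hadd a b ha hb => rw [map_add, map_add, ha, hb]
  | hsmul c T =>
    rw [map_smul, map_smul, angleSum_mk, sumOverAngles, map_sum]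
    congr 1
    have : ∀ j ∈ Finset.range T.1.numAngles,
        forgetRoot k n (ofOriented k n (PTree.rot^[j] T.1)) =
          (T.1.numAngles : k)⁻¹ • MCyc.mk k T := by
      intro j _
      obtain ⟨T', hT'⟩ := T.exists_iterate_rot j
      have hN : T'.1.numAngles = T.1.numAngles := by
        rw [numAngles_eq, numAngles_eq, hT', toTr_iterate_rot,
          (perm_edges_iterate_rot _ _).length_eq]
      rw [← hT', forgetRoot_ofOriented, hN, MCyc.mk_eq_of_iterate_rot hT']
    rw [Finset.sum_congr rfl this, Finset.sum_const, Finset.card_range, ← Nat.cast_smul_eq_nsmul k,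
      smul_smul, mul_inv_cancel₀, one_smul]
    rw [PTree.numAngles]
    exact Nat.cast_ne_zero.2 (by omega)

/-- An element whose coefficients are independent of the root equals its average over all angles,
and the average is the sum over angles of `forgetRoot`. At trees that are unstable without their
root both sides vanish. -/
lemma range_angleSum : LinearMap.range (angleSum k n) = rotInvariants k n := by
  refine le_antisymm ?_ fun x hx => ⟨forgetRoot k n x, ev_ext fun S hS => ?_⟩
  · rintro _ ⟨a, rfl⟩
    exact angleSum_mem_rotInvariants a
  · by_cases hu : S.IsUnrooted n
    · have : ∀ j, ev (Tr.rot^[j] S) x = ev S x := by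
        intro j
        induction j with
        | zero => rfl
        | succ j ih =>
          rw [Function.iterate_succ_apply', hx _ ((perm_edges_iterate_rot S j).nodup_iff.2 hS), ih]
      rw [ev_angleSum_forgetRoot x hS hu, Finset.sum_congr rfl fun j _ => this (j + 1),
        Finset.sum_const, Finset.card_range, nsmul_eq_mul, inv_mul_cancel_left₀]
      exact Nat.cast_ne_zero.2 (by omega)
    · have h0 : ∀ y ∈ rotInvariants k n, ev S y = 0 := fun y hy => by
        by_contra h
        exact hu (isUnrooted_of_ev_ne_zero hy hS h)
      rw [h0 _ (angleSum_mem_rotInvariants _), h0 x hx]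

lemma isDGSuboperad_range_angleSum :
    IsDGSuboperad (minimalOperad k) fun n => LinearMap.range (angleSum k n) where
  graded _ := range_angleSum_graded
  d_mem n a ha := by
    rw [range_angleSum] at ha ⊢
    exact rotInvariants_d_mem ha
  act_mem n σ a ha := by
    rw [range_angleSum] at ha ⊢
    exact rotInvariants_act_mem σ ha
  one_mem := by
    rw [range_angleSum]
    exact rotInvariants_one_mem
  comp_mem h i a ha b hb := by
    rw [range_angleSum] at ha hb ⊢
    exact rotInvariants_comp_mem h i ha hb

end

end AInfTrees

end

theorem mainTheorem11 (k : Type*) [Field k] [CharZero k] :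
    -- the minimal operad is a dg operad
    IsDGOperad (minimalOperad k) ∧
    -- summing over all angles is a well defined map
    ∃ φ : ∀ n, MCyc k n →ₗ[k] M k n,
      (∀ n (T : OrderedTree n), φ n (MCyc.mk k T) = sumOverAngles k T) ∧
      (∀ n, Function.Injective (φ n)) ∧
      IsDGSuboperad (minimalOperad k) (fun n => LinearMap.range (φ n)) ∧
      ∃! D : OperadData k (MCyc k), IsDGOperad D ∧ IsDGMorphism D (minimalOperad k) φ := by
  have hinj : ∀ n, Function.Injective (angleSum k n) := fun n =>
    Function.LeftInverse.injective forgetRoot_angleSum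
  exact ⟨isDGOperad_minimalOperad k, angleSum k, fun n T => angleSum_mk T, hinj,
    isDGSuboperad_range_angleSum,
    existsUnique_isDGOperad (isDGOperad_minimalOperad k) hinj isDGSuboperad_range_angleSum⟩
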